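/- Let $n\ge 3$, let $p_1,\dots,p_n\ge 2$ be pairwise coprime integers and $q_1,\dots,q_n$ nonzero integers with $p_1\cdots p_n\sum_{j} q_j/p_j=1$, so that the Seifert fibered manifold $M(p_1/q_1,\dots,p_n/q_n)$ is an integral homology $3$-sphere. Put $P=p_1\cdots p_n$ and $\Theta_0=3-\frac1P+12\sum_j s(q_j,p_j)$ with the Dedekind sum $s(q,p)=\frac1{4p}\sum_{l=1}^{p-1}\cot\frac{\pi l}{p}\cot\frac{\pi l q}{p}$. For $\tau$ in the upper half-plane $\mathbb H$ write $q^a=e^{2\pi i a\tau}$; powers $z^s$ and $\sqrt z$ of complex numbers are principal ($\arg z\in(-\pi,\pi]$). For $\varepsilon\in\{\pm1\}^n$ put $x_\varepsilon=n-2+\sum_j\varepsilon_j/p_j$, and let $m_0=m_0(\varepsilon)\in\mathbb Z$ and $\ell=\ell(\varepsilon)\in\{1,\dots,2P-1\}$ be the unique integers with $Px_\varepsilon=2Pm_0+\ell$. Let $$\Psi(q)=\sum_{\varepsilon}\varepsilon_1\cdots\varepsilon_n\sum_{m\ge0}\binom{m+n-3}{n-3}q^{\frac1{4P}(2Pm+Px_\varepsilon)^2},$$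 so that the homological block $$\Phi(q)=\frac{(-1)^n}{2(q^{1/2}-q^{-1/2})}\,q^{-\Theta_0/4}\sum_{\varepsilon}\varepsilon_1\cdots\varepsilon_n\sum_{m\ge0}\binom{m+n-3}{n-3}q^{\frac P4(2m+x_\varepsilon)^2}$$ of $M(p_1/q_1,\dots,p_n/q_n)$ is $\Phi(q)=\frac{(-1)^n}{2(q^{1/2}-q^{-1/2})}q^{-\Theta_0/4}\,\Psi(q)$. For $0\le k\le n-3$ let $$c_\varepsilon(k)=\frac{(-1)^k}{P^k(n-3)!}\sum_{l=k}^{n-3}(-2)^{-l}x_\varepsilon^{\,l-k}\left[{n-2\atop l+1}\right]\binom lk$$ with unsigned Stirling numbers of the first kind, let $\mathrm{sgn}_\varepsilon(m)$ be $1$ if $m\ge 2Pm_0+\ell$, $-1$ if $m\le 2P(m_0-n+2)+\ell$, and $0$ otherwise, and let $$\mathcal P(q)=\frac12\sum_\varepsilon\varepsilon_1\cdots\varepsilon_n\sum_{k=0}^{n-3}c_\varepsilon(k)\sum_{m\equiv\ell\,(2P)}\bigl(\mathrm{sgn}_\varepsilon(m)-\mathrm{sgn}(m)\bigr)m^kq^{\frac{m^2}{4P}},$$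 which is a finite sum, and $\widehat\Psi(\tau)=\Psi(q)-\mathcal P(q)$. For $k\ge0$ and real $\mu$ let $$\theta_{k,\mu}(\tau)=\sum_{x\in\sqrt{2P}\,\mathbb Z+\mu}x^kq^{x^2/2},\qquad \widetilde\theta_{k,\mu}(\tau)=\sum_{x\in\sqrt{2P}\,\mathbb Z+\mu}\mathrm{sgn}(x)\,x^kq^{x^2/2},$$ with $\mathrm{sgn}(0)=0$. For each $k$ write $k=2\kappa+\iota$ with $\iota\in\{0,1\}$, and for $0\le r\le\kappa$ put $d_{\kappa,\iota,r}=\frac{(4\pi i)^r(2\kappa+\iota)!}{2^\kappa(\kappa-r)!(2r+\iota)!}$ and $$\widetilde\eta_{k,r}(\tau)=-\frac12\sum_{\nu=0}^{2P-1}\sum_\varepsilon\varepsilon_1\cdots\varepsilon_n\,c_\varepsilon(k)\,e^{2\pi i\frac{\ell\nu}{2P}}\,\widetilde\theta_{2r+\iota,\frac{\nu}{\sqrt{2P}}}(\tau),\qquad \eta_{k+1}(\tau)=-\frac12\sum_\varepsilon\varepsilon_1\cdots\varepsilon_n\,c_\varepsilon(k)\,\theta_{k+1,\frac{\ell}{\sqrt{2P}}}(\tau).$$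 Then all the series above converge absolutely on $\mathbb H$, and for every $\tau\in\mathbb H$ with $\mathrm{Re}(\tau)\ne0$, $$\widehat\Psi\left(-\frac1\tau\right)=\mathrm{sgn}(\mathrm{Re}(\tau))\sum_{k=0}^{n-3}\frac{(-1)^\iota(-i)^{1/2}(2P)^{\frac{k-1}2}\tau^{\kappa+\iota+\frac12}}{(2\pi i)^\kappa}\sum_{r=0}^\kappa d_{\kappa,\iota,r}\,\tau^r\,\widetilde\eta_{k,r}(\tau)+i\sum_{k=0}^{n-3}(2P)^{k/2}\int_0^{i\infty}\frac{\eta_{k+1}(z)}{\sqrt{-i(z+1/\tau)}}\,dz,$$ where the integrals are taken along the positive imaginary axis and converge absolutely. -/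

import Mathlib

open scoped BigOperators

noncomputable section

namespace SeifertBlock

/-! ### Theta functions and false theta functions -/

/-- The power `q ^ a` for a real exponent `a`, where `q = exp (2 π i τ)`. -/
def qpow (a : ℝ) (τ : ℂ) : ℂ := Complex.exp (2 * Real.pi * Complex.I * a * τ)

/-- The square root with `arg √z ∈ (-π/2, π/2]`. -/
def csqrt (z : ℂ) : ℂ := z ^ (1 / 2 : ℂ)

/-- The point `√M j + μ` of the shifted lattice `√M ℤ + μ`. -/
def latticePt (M : ℕ) (μ : ℝ) (j : ℤ) : ℝ := Real.sqrt M * j + μ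

/-- The summand `x ^ k q ^ (x ^ 2 / 2)` of the theta function, at `x = √M j + μ`. -/
def thetaTerm (M k : ℕ) (μ : ℝ) (τ : ℂ) (j : ℤ) : ℂ :=
  ((latticePt M μ j ^ k : ℝ) : ℂ) * qpow (latticePt M μ j ^ 2 / 2) τ

/-- The summand `sgn(x) x ^ k q ^ (x ^ 2 / 2)` of the false theta function, at `x = √M j + μ`. -/
def falseThetaTerm (M k : ℕ) (μ : ℝ) (τ : ℂ) (j : ℤ) : ℂ :=
  ((Real.sign (latticePt M μ j) * latticePt M μ j ^ k : ℝ) : ℂ) *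
    qpow (latticePt M μ j ^ 2 / 2) τ

/-- The ordinary theta function `θ_{k,μ}(τ)` of the lattice `√M ℤ`. -/
def theta (M k : ℕ) (μ : ℝ) (τ : ℂ) : ℂ := ∑' j : ℤ, thetaTerm M k μ τ j

/-- The false theta function of the lattice `√M ℤ`. -/
def falseTheta (M k : ℕ) (μ : ℝ) (τ : ℂ) : ℂ := ∑' j : ℤ, falseThetaTerm M k μ τ j

/-- The constants `d_{κ,ι,r}`. -/
def dCoeff (κ ι r : ℕ) : ℂ :=
  if r ≤ κ then
    (4 * Real.pi * Complex.I) ^ r * ((2 * κ + ι).factorial : ℂ) /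
      (2 ^ κ * ((κ - r).factorial : ℂ) * ((2 * r + ι).factorial : ℂ))
  else 0

/-! ### The homological block -/

variable {n : ℕ}

/-- The product `P = p_1 ⋯ p_n`. -/
def bigP (p : Fin n → ℕ) : ℕ := ∏ j, p j

/-- The product of signs `ε_1 ⋯ ε_n`, where `ε ∈ {±1}^n`. -/
def signProd (ε : Fin n → ℤˣ) : ℤ := ∏ j, ((ε j : ℤˣ) : ℤ)

/-- The rational number `n - 2 + ∑ ε_j / p_j`. -/
def shift (p : Fin n → ℕ) (ε : Fin n → ℤˣ) : ℚ :=
  (n : ℚ) - 2 + ∑ j, (((ε j : ℤˣ) : ℤ) : ℚ) / (p j : ℚ)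

/-- The integer `P (n - 2 + ∑ ε_j / p_j)`, written without division
(see `numer_eq`). -/
def numer (p : Fin n → ℕ) (ε : Fin n → ℤˣ) : ℤ :=
  (bigP p : ℤ) * ((n : ℤ) - 2) +
    ∑ j, ((ε j : ℤˣ) : ℤ) * ∏ i ∈ Finset.univ.erase j, (p i : ℤ)

/-- The integer `m_0` in `P (n - 2 + ∑ ε_j / p_j) = 2 P m_0 + ℓ`. -/
def m0 (p : Fin n → ℕ) (ε : Fin n → ℤˣ) : ℤ := numer p ε / (2 * (bigP p : ℤ))

/-- The residue `ℓ` in `P (n - 2 + ∑ ε_j / p_j) = 2 P m_0 + ℓ`. -/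
def ell (p : Fin n → ℕ) (ε : Fin n → ℤˣ) : ℤ := numer p ε % (2 * (bigP p : ℤ))

theorem numer_eq (p : Fin n → ℕ) (hp : ∀ j, 2 ≤ p j) (ε : Fin n → ℤˣ) :
    (numer p ε : ℚ) = (bigP p : ℚ) * shift p ε := by
  have key : ∀ j, (bigP p : ℚ) / (p j : ℚ) = ∏ i ∈ Finset.univ.erase j, (p i : ℚ) := by
    intro j
    have hj : (p j : ℚ) ≠ 0 := by
      have := hp j
      positivity
    rw [div_eq_iff hj, bigP, Nat.cast_prod]
    exact (Finset.prod_erase_mul _ _ (Finset.mem_univ j)).symm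
  unfold numer shift
  push_cast
  rw [mul_add, Finset.mul_sum]
  congr 1
  refine Finset.sum_congr rfl fun j _ => ?_
  rw [← key j]
  ring

theorem shift_eq (p : Fin n → ℕ) (hp : ∀ j, 2 ≤ p j) (ε : Fin n → ℤˣ) :
    (bigP p : ℚ) * shift p ε = 2 * (bigP p : ℚ) * (m0 p ε : ℚ) + (ell p ε : ℚ) := by
  rw [← numer_eq p hp ε]
  have h := Int.mul_ediv_add_emod (numer p ε) (2 * (bigP p : ℤ))
  have h' : ((2 * (bigP p : ℤ) * m0 p ε + ell p ε : ℤ) : ℚ) = (numer p ε : ℚ) := by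
    exact_mod_cast h
  rw [← h']
  push_cast
  ring

theorem ell_mem (p : Fin n → ℕ) (hn : 0 < n) (hp : ∀ j, 2 ≤ p j)
    (hcop : Pairwise fun i j => Nat.Coprime (p i) (p j)) (ε : Fin n → ℤˣ) :
    1 ≤ ell p ε ∧ ell p ε ≤ 2 * (bigP p : ℤ) - 1 := by
  have hP : 0 < bigP p := Finset.prod_pos fun j _ => by
    have := hp j
    omega
  have hP' : (0 : ℤ) < 2 * (bigP p : ℤ) := by
    have : (0 : ℤ) < (bigP p : ℤ) := by exact_mod_cast hP
    omega
  have h0 : 0 ≤ ell p ε := Int.emod_nonneg _ hP'.ne'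
  have h1 : ell p ε < 2 * (bigP p : ℤ) := Int.emod_lt_of_pos _ hP'
  have hne : ell p ε ≠ 0 := by
    intro hz
    have hdvd : 2 * (bigP p : ℤ) ∣ numer p ε := Int.dvd_of_emod_eq_zero hz
    let a : Fin n := ⟨0, hn⟩
    have haP : (p a : ℤ) ∣ (bigP p : ℤ) := by
      exact_mod_cast Finset.dvd_prod_of_mem p (Finset.mem_univ a)
    have haN : (p a : ℤ) ∣ numer p ε := (haP.mul_left 2).trans hdvd
    have haS : (p a : ℤ) ∣ ∑ j, ((ε j : ℤˣ) : ℤ) * ∏ i ∈ Finset.univ.erase j, (p i : ℤ) :=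
      (Int.dvd_add_right (haP.mul_right _)).mp haN
    rw [← Finset.add_sum_erase _ _ (Finset.mem_univ a)] at haS
    have haR : (p a : ℤ) ∣ ∑ j ∈ Finset.univ.erase a,
        ((ε j : ℤˣ) : ℤ) * ∏ i ∈ Finset.univ.erase j, (p i : ℤ) := by
      refine Finset.dvd_sum fun j hj => Dvd.dvd.mul_left ?_ _
      refine Finset.dvd_prod_of_mem (fun i => (p i : ℤ)) ?_
      exact Finset.mem_erase.mpr ⟨(Finset.ne_of_mem_erase hj).symm, Finset.mem_univ a⟩
    have haM := (Int.dvd_add_left haR).mp haS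
    have haU : (p a : ℤ) ∣ ∏ i ∈ Finset.univ.erase a, (p i : ℤ) :=
      (Units.dvd_mul_left (u := ε a)).mp haM
    have hc : IsCoprime (p a : ℤ) (∏ i ∈ Finset.univ.erase a, (p i : ℤ)) := by
      refine IsCoprime.prod_right fun i hi => ?_
      exact Nat.isCoprime_iff_coprime.mpr (hcop (Finset.ne_of_mem_erase hi).symm)
    have hu := hc.isUnit_of_dvd' dvd_rfl haU
    have h2 := hp a
    rcases Int.isUnit_iff.mp hu with h | h <;> omega
  omega

/-- The Dedekind sum `s(q, p)`. -/
def dedekindSum (q : ℤ) (p : ℕ) : ℝ :=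
  1 / (4 * (p : ℝ)) * ∑ l ∈ Finset.Icc 1 (p - 1),
    Real.cot (Real.pi * l / p) * Real.cot (Real.pi * l * q / p)

/-- The number `Θ_0 = 3 - 1/P + 12 ∑ s(q_j, p_j)`. -/
def Theta0 (p : Fin n → ℕ) (q : Fin n → ℤ) : ℝ :=
  3 - 1 / (bigP p : ℝ) + 12 * ∑ j, dedekindSum (q j) (p j)

/-- The homological block `Φ(q)` of `M(p_1/q_1, …, p_n/q_n)`, at `q = exp (2 π i τ)`. -/
def Phi (p : Fin n → ℕ) (q : Fin n → ℤ) (τ : ℂ) : ℂ :=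
  (-1) ^ n / (2 * (qpow (1 / 2) τ - qpow (-(1 / 2)) τ)) * qpow (-(1 / 4) * Theta0 p q) τ *
    ∑ ε : Fin n → ℤˣ, (signProd ε : ℂ) * ∑' m : ℕ,
      ((m + n - 3).choose (n - 3) : ℂ) *
        qpow ((bigP p : ℝ) / 4 *
          (2 * m + n - 2 + ∑ j, (((ε j : ℤˣ) : ℤ) : ℝ) / (p j : ℝ)) ^ 2) τ

/-- The summand, with index `m`, of the inner series of `Ψ(q)`. -/
def psiTerm (p : Fin n → ℕ) (ε : Fin n → ℤˣ) (τ : ℂ) (m : ℕ) : ℂ :=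
  ((m + n - 3).choose (n - 3) : ℂ) *
    qpow (1 / (4 * (bigP p : ℝ)) *
      (2 * (bigP p : ℝ) * m + (bigP p : ℝ) * (shift p ε : ℝ)) ^ 2) τ

/-- The factor `Ψ(q)` of the homological block, at `q = exp (2 π i τ)`. -/
def Psi (p : Fin n → ℕ) (τ : ℂ) : ℂ :=
  ∑ ε : Fin n → ℤˣ, (signProd ε : ℂ) * ∑' m : ℕ, psiTerm p ε τ m

/-- The rational coefficients `c_ε(k)`. -/
def cCoeff (p : Fin n → ℕ) (ε : Fin n → ℤˣ) (k : ℕ) : ℚ :=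
  (-1) ^ k / ((bigP p : ℚ) ^ k * ((n - 3).factorial : ℚ)) *
    ∑ l ∈ Finset.Icc k (n - 3),
      ((-2 : ℚ) ^ l)⁻¹ * shift p ε ^ (l - k) *
        (Nat.stirlingFirst (n - 2) (l + 1) : ℚ) * (l.choose k : ℚ)

/-- The modified sign function `sgn_ε(m)`. -/
def sgnEps (p : Fin n → ℕ) (ε : Fin n → ℤˣ) (m : ℤ) : ℤ :=
  if 2 * (bigP p : ℤ) * m0 p ε + ell p ε ≤ m then 1
  else if m ≤ 2 * (bigP p : ℤ) * (m0 p ε - n + 2) + ell p ε then -1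
  else 0

/-- The summand of `𝒫(q)` at the integer `m = 2 P j + ℓ`; as `j` runs over `ℤ`, the integer `m`
runs over the class `m ≡ ℓ (mod 2P)`. -/
def polyTerm (p : Fin n → ℕ) (ε : Fin n → ℤˣ) (k : ℕ) (τ : ℂ) (j : ℤ) : ℂ :=
  let m : ℤ := 2 * (bigP p : ℤ) * j + ell p ε
  ((sgnEps p ε m - m.sign : ℤ) : ℂ) * (m : ℂ) ^ k * qpow ((m : ℝ) ^ 2 / (4 * (bigP p : ℝ))) τ

/-- The polynomial `𝒫(q)` in `q ^ (1 / (4 P))`, at `q = exp (2 π i τ)`. -/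
def polyP (p : Fin n → ℕ) (τ : ℂ) : ℂ :=
  1 / 2 * ∑ ε : Fin n → ℤˣ, (signProd ε : ℂ) * ∑ k ∈ Finset.range (n - 2),
    (cCoeff p ε k : ℂ) * ∑' j : ℤ, polyTerm p ε k τ j

/-- `Ψ(q) - 𝒫(q)` as a function of `τ`. -/
def PsiHat (p : Fin n → ℕ) (τ : ℂ) : ℂ := Psi p τ - polyP p τ

/-- The combination of false theta functions `η̃_{k,r}(τ)`, where `ι = k % 2`. -/
def etaTilde (p : Fin n → ℕ) (k r : ℕ) (τ : ℂ) : ℂ :=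
  -(1 / 2) * ∑ ν ∈ Finset.range (2 * bigP p), ∑ ε : Fin n → ℤˣ,
    (signProd ε : ℂ) * (cCoeff p ε k : ℂ) *
      Complex.exp (2 * Real.pi * Complex.I * ((ell p ε : ℂ) * ν / (2 * (bigP p : ℂ)))) *
      falseTheta (2 * bigP p) (2 * r + k % 2) ((ν : ℝ) / Real.sqrt (2 * (bigP p : ℝ))) τ

/-- The combination `η_{k+1}(τ)` of the theta functions `θ_{k+1,μ}`, with coefficients
`c_ε(k)`; the argument of this function is `k`, not `k + 1`. -/
def etaSucc (p : Fin n → ℕ) (k : ℕ) (τ : ℂ) : ℂ :=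
  -(1 / 2) * ∑ ε : Fin n → ℤˣ, (signProd ε : ℂ) * (cCoeff p ε k : ℂ) *
    theta (2 * bigP p) (k + 1) ((ell p ε : ℝ) / Real.sqrt (2 * (bigP p : ℝ))) τ

/-- The integrand `η_{k+1}(z) / √(-i (z + 1/τ))`. -/
def eichlerIntegrand (p : Fin n → ℕ) (k : ℕ) (τ z : ℂ) : ℂ :=
  etaSucc p k z / csqrt (-Complex.I * (z + 1 / τ))

/-- The integral `∫_0^{i∞} f(z) dz` along the positive imaginary axis `z = i y`. -/
def imAxisIntegral (f : ℂ → ℂ) : ℂ :=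
  ∫ y : ℝ in Set.Ioi 0, f (Complex.I * y) * Complex.I

end SeifertBlock

end

noncomputable section

namespace SeifertBlock

open Complex Filter Topology Set MeasureTheory

section

/-! ### Theta series with bounded coefficients -/

/-! Write N = 2P. The binomial coefficient in Ψ is a polynomial in m of degree n-3 that vanishes at
-1, …, -(n-3) and is even or odd under reflection about its centre. It therefore makes sense for all
integers m, and pairing ε with -ε shows that the signed sum over all of ℤ is zero. So Ψ is half the
sum over ℤ weighted by `sgnEps`. Expanding the polynomial in powers of M = 2Pm + P x_ε produces the
coefficients c_ε(k), and subtracting 𝒫 replaces `sgnEps` by the true sign. Hence Ψ̂ is a sum over k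
of false theta series whose coefficients b_k (`blockCoeff`) are N-periodic
(`PsiHat_eq_sum_blockCoeff`).

Let b' be the finite Fourier transform of b = b_k, without its normalising factor. Poisson summation
exchanges the theta series of b and b' under z ↦ -1/z. Here b(0) = 0 because N does not divide ℓ(ε),
and b'(0) = 0 because an alternating sum over signs of a polynomial in x_ε of degree less than n is
zero (`sum_signProd_mul_cCoeff`). With no constant term on either side, the theta series decays
exponentially at 0 and at i∞ inside every cone (`IsThetaPair.coneDecay`).

The false theta series are Eichler integrals of these theta series. Integrate f(z)/√(-i(z-w)), where
f is the theta series of b with one more power of m and w = -1/τ, along the ray from 0 through w.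
Beyond w the integral is elementary term by term and gives the false theta series of b at w, since
m/|m| = sgn m. Between 0 and w, inversion gives the false theta series of b' at τ. As Re w ≠ 0, the
ray can be rotated onto the imaginary axis without crossing the branch cut, which hangs vertically
below w (`integral_imAxis_eq_integral_ray`). The product of the two square roots √(iw)√(-iw) =
sgn(Re w) w is the source of sgn(Re τ).

This settles k = 0 and k = 1 (`falseTheta_transform_base`). Differentiating in τ raises k by 2 in
the false theta series and in the Eichler integral, and it acts on the elementary part through a
two-term recursion satisfied by d_{κ,ι,r}; induction on κ gives every k (`falseTheta_transform`). -/

/-- The summand of `twistTheta`. -/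
def twistTerm (N : ℕ) (b : ℤ → ℂ) (K : ℕ) (z : ℂ) (m : ℤ) : ℂ :=
  b m * (m : ℂ) ^ K * cexp (Real.pi * I * (m : ℂ) ^ 2 / N * z)

/-- The theta series `∑ b(m) m ^ K exp (π i m² z / N)` with coefficients `b`. -/
def twistTheta (N : ℕ) (b : ℤ → ℂ) (K : ℕ) (z : ℂ) : ℂ := ∑' m : ℤ, twistTerm N b K z m

theorem norm_exp_quadratic (N : ℕ) (m : ℤ) (z : ℂ) :
    ‖cexp (Real.pi * I * (m : ℂ) ^ 2 / N * z)‖ = Real.exp (-Real.pi * (m : ℝ) ^ 2 / N * z.im) := by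
  rw [Complex.norm_exp]
  congr 1
  have : (Real.pi * I * (m : ℂ) ^ 2 / N * z) = ((Real.pi * (m : ℝ) ^ 2 / N : ℝ) : ℂ) * (I * z) := by
    push_cast; ring
  rw [this, re_ofReal_mul]
  simp
  ring

theorem summable_pow_mul_exp_sq (k : ℕ) {y : ℝ} (hy : 0 < y) :
    Summable fun m : ℤ => |(m : ℝ)| ^ k * Real.exp (-Real.pi * y * (m : ℝ) ^ 2) := by
  refine (summable_pow_mul_jacobiTheta₂_term_bound 0 hy k).congr fun m => ?_
  rw [Int.cast_abs]
  ring_nf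

variable {N : ℕ} {b : ℤ → ℂ} {B : ℝ}

theorem norm_twistTerm_le (hb : ∀ m, ‖b m‖ ≤ B) (K : ℕ) {z : ℂ} {y : ℝ} (hy : y ≤ z.im) (m : ℤ) :
    ‖twistTerm N b K z m‖ ≤
      B * (|(m : ℝ)| ^ K * Real.exp (-Real.pi * (y / N) * (m : ℝ) ^ 2)) := by
  rw [twistTerm, norm_mul, norm_mul, norm_exp_quadratic, norm_pow, Complex.norm_intCast, mul_assoc]
  have hB : 0 ≤ B := (norm_nonneg _).trans (hb 0)
  refine mul_le_mul (hb m) ?_ (mul_nonneg (by positivity) (Real.exp_pos _).le) hB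
  refine mul_le_mul_of_nonneg_left (Real.exp_le_exp.mpr ?_) (by positivity)
  have h1 : Real.pi * (m : ℝ) ^ 2 / N * y ≤ Real.pi * (m : ℝ) ^ 2 / N * z.im :=
    mul_le_mul_of_nonneg_left hy (by positivity)
  calc -Real.pi * (m : ℝ) ^ 2 / N * z.im = -(Real.pi * (m : ℝ) ^ 2 / N * z.im) := by ring
    _ ≤ -(Real.pi * (m : ℝ) ^ 2 / N * y) := neg_le_neg h1
    _ = _ := by ring

theorem summable_twistTerm (hN : 0 < N) (hb : ∀ m, ‖b m‖ ≤ B) (K : ℕ) {z : ℂ} (hz : 0 < z.im) :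
    Summable (twistTerm N b K z) :=
  .of_norm_bounded ((summable_pow_mul_exp_sq K (div_pos hz (Nat.cast_pos.mpr hN))).mul_left B)
    (norm_twistTerm_le hb K le_rfl)

theorem hasDerivAt_twistTheta (hN : 0 < N) (hb : ∀ m, ‖b m‖ ≤ B) (K : ℕ) {z : ℂ}
    (hz : 0 < z.im) :
    HasDerivAt (twistTheta N b K) (Real.pi * I / N * twistTheta N b (K + 2) z) z := by
  have hs : IsOpen {w : ℂ | z.im / 2 < w.im} := isOpen_lt continuous_const continuous_im
  have hc : IsPreconnected {w : ℂ | z.im / 2 < w.im} := (convex_halfSpace_im_gt _).isPreconnected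
  have hzs : z ∈ {w : ℂ | z.im / 2 < w.im} := by simp only [mem_ofPred_eq]; linarith
  have hN' : (0 : ℝ) < N := Nat.cast_pos.mpr hN
  have hd : ∀ (m : ℤ) (w : ℂ), HasDerivAt (fun w => twistTerm N b K w m)
      (Real.pi * I / N * twistTerm N b (K + 2) w m) w := by
    intro m w
    have h1 : HasDerivAt (fun w : ℂ => Real.pi * I * (m : ℂ) ^ 2 / N * w)
        (Real.pi * I * (m : ℂ) ^ 2 / N) w := by
      simpa using (hasDerivAt_id w).const_mul (Real.pi * I * (m : ℂ) ^ 2 / N)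
    refine (h1.cexp.const_mul (b m * (m : ℂ) ^ K)).congr_deriv ?_
    rw [twistTerm]
    ring
  have key := hasDerivAt_tsum_of_isPreconnected
    (g := fun m w => twistTerm N b K w m)
    (g' := fun m w => Real.pi * I / N * twistTerm N b (K + 2) w m)
    (u := fun m : ℤ => Real.pi / N * (B * (|(m : ℝ)| ^ (K + 2) *
      Real.exp (-Real.pi * (z.im / 2 / N) * (m : ℝ) ^ 2))))
    (((summable_pow_mul_exp_sq (K + 2) (div_pos (half_pos hz) hN')).mul_left B).mul_left _)
    hs hc (fun m w _ => hd m w) (fun m w hw => ?_) hzs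
    (summable_twistTerm hN hb K hz) hzs
  · rw [tsum_mul_left] at key
    exact key
  · rw [norm_mul, norm_div, norm_mul, norm_I, norm_natCast, mul_one, Complex.norm_real,
      Real.norm_of_nonneg Real.pi_pos.le]
    exact mul_le_mul_of_nonneg_left (norm_twistTerm_le hb _ (le_of_lt hw) m) (by positivity)

/-- With b(0) = 0 the constant term is absent and every surviving term has m² ≥ 1. -/
theorem exists_norm_twistTheta_le (hN : 0 < N) (hb : ∀ m, ‖b m‖ ≤ B) (h0 : b 0 = 0) (K : ℕ)
    {δ : ℝ} (hδ : 0 < δ) : ∃ C c : ℝ, 0 < C ∧ 0 < c ∧ ∀ z : ℂ, δ ≤ z.im →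
      ‖twistTheta N b K z‖ ≤ C * Real.exp (-c * z.im) := by
  have hN' : (0 : ℝ) < N := Nat.cast_pos.mpr hN
  have hB : 0 ≤ B := (norm_nonneg _).trans (hb 0)
  set S : ℤ → ℝ := fun m => |(m : ℝ)| ^ K * Real.exp (-Real.pi * (δ / 2 / N) * (m : ℝ) ^ 2) with hS
  have hSs : Summable S := summable_pow_mul_exp_sq K (div_pos (half_pos hδ) hN')
  have hS0 : 0 ≤ ∑' m, S m := tsum_nonneg fun m => by rw [hS]; positivity
  refine ⟨B * ∑' m, S m + 1, Real.pi / (2 * N), by positivity, by positivity, fun z hz => ?_⟩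
  have hterm : ∀ m, ‖twistTerm N b K z m‖ ≤ B * Real.exp (-(Real.pi / (2 * N)) * z.im) * S m := by
    intro m
    rcases eq_or_ne m 0 with rfl | hm
    · simp only [twistTerm, h0, zero_mul, norm_zero]
      rw [hS]; positivity
    refine (norm_twistTerm_le hb K le_rfl m).trans ?_
    rw [hS, mul_assoc B]
    refine mul_le_mul_of_nonneg_left ?_ hB
    simp only
    rw [mul_left_comm, ← Real.exp_add]
    refine mul_le_mul_of_nonneg_left (Real.exp_le_exp.mpr ?_) (by positivity)
    have hm1 : (1 : ℝ) ≤ (m : ℝ) ^ 2 := by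
      have : (1 : ℤ) ≤ m ^ 2 := by have := sq_pos_of_ne_zero hm; omega
      exact_mod_cast this
    -- Half of the Gaussian exponent supplies the decay in Im z; the other half, with δ in place of
    -- Im z, keeps the series in m summable uniformly.
    have h2 : z.im + δ * (m : ℝ) ^ 2 ≤ 2 * z.im * (m : ℝ) ^ 2 := by nlinarith
    have h3 : Real.pi / (2 * N) * (z.im + δ * (m : ℝ) ^ 2) ≤
        Real.pi / (2 * N) * (2 * z.im * (m : ℝ) ^ 2) :=
      mul_le_mul_of_nonneg_left h2 (by positivity)
    have e1 : -Real.pi * (z.im / N) * (m : ℝ) ^ 2 =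
      -(Real.pi / (2 * N) * (2 * z.im * (m : ℝ) ^ 2)) := by field_simp
    have e2 : -(Real.pi / (2 * N)) * z.im + -Real.pi * (δ / 2 / N) * (m : ℝ) ^ 2 =
      -(Real.pi / (2 * N) * (z.im + δ * (m : ℝ) ^ 2)) := by field_simp; ring
    rw [e1, e2]
    exact neg_le_neg h3
  have := tsum_of_norm_bounded ((hSs.mul_left _).hasSum) hterm
  rw [tsum_mul_left] at this
  refine this.trans ?_
  have := Real.exp_pos (-(Real.pi / (2 * N)) * z.im)
  nlinarith

end

/-! ### The modular transformation -/

theorem csqrt_ofReal_mul {r : ℝ} (hr : 0 < r) (z : ℂ) :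
    csqrt (r * z) = (Real.sqrt r : ℂ) * csqrt z := by
  rcases eq_or_ne z 0 with rfl | hz
  · simp [csqrt]
  have hr' : (r : ℂ) ≠ 0 := ofReal_ne_zero.mpr hr.ne'
  rw [csqrt, csqrt, cpow_def_of_ne_zero (mul_ne_zero hr' hz), cpow_def_of_ne_zero hz,
    Complex.log_ofReal_mul hr hz, add_mul, Complex.exp_add, Real.sqrt_eq_rpow, ofReal_cpow hr.le,
    cpow_def_of_ne_zero hr', ofReal_log hr.le]
  norm_num

theorem neg_one_div_im_pos {z : ℂ} (hz : 0 < z.im) : 0 < (-1 / z).im := by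
  rw [div_eq_mul_inv, neg_one_mul, neg_im, inv_im, neg_div, neg_neg]
  exact div_pos hz (normSq_pos.mpr fun h => lt_irrefl 0 (zero_im ▸ h ▸ hz))

theorem ne_zero_of_im_pos {z : ℂ} (hz : 0 < z.im) : z ≠ 0 :=
  fun h => lt_irrefl 0 (zero_im ▸ h ▸ hz)

/-- The indicator function of the residue class of `ℓ` modulo `N`. -/
def residueInd (N : ℕ) (ℓ m : ℤ) : ℂ := if (N : ℤ) ∣ m - ℓ then 1 else 0

/-- The additive character `m ↦ exp (2 π i ℓ m / N)`. -/
def residueChar (N : ℕ) (ℓ m : ℤ) : ℂ := cexp (2 * Real.pi * I * (ℓ * m / N))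

theorem tsum_residueInd_mul {N : ℕ} (hN : 0 < N) (ℓ : ℤ) (f : ℤ → ℂ) :
    ∑' m, residueInd N ℓ m * f m = ∑' j : ℤ, f (N * j + ℓ) := by
  have hN' : (N : ℤ) ≠ 0 := by exact_mod_cast hN.ne'
  have hinj : Function.Injective fun j : ℤ => (N : ℤ) * j + ℓ := fun i j h => by
    exact mul_left_cancel₀ hN' (add_right_cancel h)
  rw [← hinj.tsum_eq (f := fun m => residueInd N ℓ m * f m)]
  · simp [residueInd]
  · intro m hm
    by_cases h : (N : ℤ) ∣ m - ℓ
    · obtain ⟨j, hj⟩ := h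
      exact ⟨j, by simp only; omega⟩
    · simp [residueInd, h] at hm

theorem norm_residueInd_le (N : ℕ) (ℓ m : ℤ) : ‖residueInd N ℓ m‖ ≤ 1 := by
  rw [residueInd]; split_ifs <;> simp

theorem norm_residueChar (N : ℕ) (ℓ m : ℤ) : ‖residueChar N ℓ m‖ = 1 := by
  rw [residueChar, show (2 * Real.pi * I * (ℓ * m / N) : ℂ) =
    ((2 * Real.pi * (ℓ * m / N) : ℝ) : ℂ) * I by push_cast; ring]
  exact norm_exp_ofReal_mul_I _

theorem jacobiTheta₂_residue {N : ℕ} (hN : 0 < N) (ℓ : ℤ) {z : ℂ} (hz : z ≠ 0) :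
    jacobiTheta₂ (ℓ / N) (-1 / (N * z)) = twistTheta N (residueChar N ℓ) 0 (-1 / z) := by
  have hN' : (N : ℂ) ≠ 0 := Nat.cast_ne_zero.mpr hN.ne'
  refine tsum_congr fun m => ?_
  rw [jacobiTheta₂_term, twistTerm, residueChar, pow_zero, mul_one, ← Complex.exp_add]
  congr 1
  field_simp

theorem jacobiTheta₂'_residue {N : ℕ} (hN : 0 < N) (ℓ : ℤ) {z : ℂ} (hz : z ≠ 0) :
    jacobiTheta₂' (ℓ / N) (-1 / (N * z)) =
      2 * Real.pi * I * twistTheta N (residueChar N ℓ) 1 (-1 / z) := by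
  have hN' : (N : ℂ) ≠ 0 := Nat.cast_ne_zero.mpr hN.ne'
  rw [twistTheta, ← tsum_mul_left]
  refine tsum_congr fun m => ?_
  rw [jacobiTheta₂'_term, jacobiTheta₂_term, twistTerm, residueChar, pow_one, Complex.exp_add,
    show (2 * Real.pi * I * m * (ℓ / N) : ℂ) = 2 * Real.pi * I * (ℓ * m / N) by ring,
    show (Real.pi * I * m ^ 2 * (-1 / (N * z)) : ℂ) = Real.pi * I * m ^ 2 / N * (-1 / z) by
      field_simp]
  ring

theorem csqrt_neg_I_mul_natCast_mul {N : ℕ} (hN : 0 < N) (z : ℂ) :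
    1 / (-I * (N * z)) ^ (1 / 2 : ℂ) = ((Real.sqrt N : ℂ))⁻¹ * (csqrt (-I * z))⁻¹ := by
  have := csqrt_ofReal_mul (Nat.cast_pos.mpr hN : (0 : ℝ) < N) (-I * z)
  rw [one_div, ← mul_inv, ← this, csqrt]
  congr 2
  push_cast
  ring

/-- Poisson summation for one residue class. Putting m = Nj + ℓ and expanding the square gives a
two-variable Jacobi theta function at (ℓz, Nz) times a Gaussian factor, and that factor cancels the
one in the functional equation. -/
theorem twistTheta_zero_residueInd {N : ℕ} (hN : 0 < N) (ℓ : ℤ) {z : ℂ} (hz : 0 < z.im) :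
    twistTheta N (residueInd N ℓ) 0 z = ((Real.sqrt N : ℂ))⁻¹ * (csqrt (-I * z))⁻¹ *
      twistTheta N (residueChar N ℓ) 0 (-1 / z) := by
  have hN' : (N : ℂ) ≠ 0 := Nat.cast_ne_zero.mpr hN.ne'
  have hz0 : z ≠ 0 := ne_zero_of_im_pos hz
  have h1 : twistTheta N (residueInd N ℓ) 0 z =
      cexp (Real.pi * I * ℓ ^ 2 / N * z) * jacobiTheta₂ (ℓ * z) (N * z) := by
    rw [twistTheta]
    simp only [twistTerm, mul_assoc]
    rw [tsum_residueInd_mul hN, jacobiTheta₂, ← tsum_mul_left]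
    refine tsum_congr fun j => ?_
    rw [jacobiTheta₂_term, pow_zero, one_mul, ← Complex.exp_add]
    congr 1
    push_cast
    field_simp
    ring
  rw [h1, jacobiTheta₂_functional_equation, csqrt_neg_I_mul_natCast_mul hN,
    show (ℓ * z / (N * z) : ℂ) = ℓ / N by field_simp, jacobiTheta₂_residue hN ℓ hz0]
  have h2 : cexp (Real.pi * I * ℓ ^ 2 / N * z) * cexp (-Real.pi * I * (ℓ * z) ^ 2 / (N * z)) = 1 := by
    rw [← Complex.exp_add, Complex.exp_eq_one_iff]
    exact ⟨0, by field_simp; ring⟩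
  linear_combination ((Real.sqrt N : ℂ))⁻¹ * (csqrt (-I * z))⁻¹ *
      twistTheta N (residueChar N ℓ) 0 (-1 / z) * h2

/-- The factor m = Nj + ℓ gives a combination of the Jacobi theta function and its derivative. The
anomalous term in the functional equation of the derivative cancels the contribution of ℓ, leaving a
clean transformation with one extra factor 1/z. -/
theorem twistTheta_one_residueInd {N : ℕ} (hN : 0 < N) (ℓ : ℤ) {z : ℂ} (hz : 0 < z.im) :
    twistTheta N (residueInd N ℓ) 1 z = ((Real.sqrt N : ℂ))⁻¹ * (csqrt (-I * z))⁻¹ * z⁻¹ *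
      twistTheta N (residueChar N ℓ) 1 (-1 / z) := by
  have hN' : (N : ℂ) ≠ 0 := Nat.cast_ne_zero.mpr hN.ne'
  have hz0 : z ≠ 0 := ne_zero_of_im_pos hz
  have hNz : 0 < ((N : ℂ) * z).im := by
    rw [← ofReal_natCast, im_ofReal_mul]
    exact mul_pos (Nat.cast_pos.mpr hN) hz
  have hpi : (Real.pi : ℂ) ≠ 0 := ofReal_ne_zero.mpr Real.pi_ne_zero
  have h1 : twistTheta N (residueInd N ℓ) 1 z =
      cexp (Real.pi * I * ℓ ^ 2 / N * z) * (N / (2 * Real.pi * I) * jacobiTheta₂' (ℓ * z) (N * z) +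
        ℓ * jacobiTheta₂ (ℓ * z) (N * z)) := by
    rw [twistTheta]
    simp only [twistTerm, mul_assoc]
    rw [tsum_residueInd_mul hN, jacobiTheta₂, jacobiTheta₂', ← tsum_mul_left, ← tsum_mul_left,
      ← Summable.tsum_add, ← tsum_mul_left]
    · refine tsum_congr fun j => ?_
      rw [jacobiTheta₂'_term, jacobiTheta₂_term, pow_one,
        show (Real.pi * (I * ((N * j + ℓ : ℤ) : ℂ) ^ 2) / N * z : ℂ) = Real.pi * (I * ℓ ^ 2) / N *
          z +
          (2 * Real.pi * I * j * (ℓ * z) + Real.pi * I * j ^ 2 * (N * z)) by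
            push_cast; field_simp; ring, Complex.exp_add]
      push_cast
      field_simp
    · exact ((summable_jacobiTheta₂'_term_iff _ _).mpr hNz).mul_left _
    · exact ((summable_jacobiTheta₂_term_iff _ _).mpr hNz).mul_left _
  rw [h1, jacobiTheta₂_functional_equation, jacobiTheta₂'_functional_equation,
    csqrt_neg_I_mul_natCast_mul hN,
    show (ℓ * z / (N * z) : ℂ) = ℓ / N by field_simp, jacobiTheta₂'_residue hN ℓ hz0]
  have h2 : cexp (Real.pi * I * ℓ ^ 2 / N * z) * cexp (-Real.pi * I * (ℓ * z) ^ 2 / (N * z)) = 1 := by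
    rw [← Complex.exp_add, Complex.exp_eq_one_iff]
    exact ⟨0, by field_simp; ring⟩
  have e : ∀ X J : ℂ, N / (2 * Real.pi * I) * (X / (N * z) *
      (2 * Real.pi * I * twistTheta N (residueChar N ℓ) 1 (-1 / z) -
        2 * Real.pi * I * (ℓ * z) * J)) + ℓ * (X * J) =
      X * z⁻¹ * twistTheta N (residueChar N ℓ) 1 (-1 / z) := by
    intro X J
    field_simp
    ring
  rw [e]
  linear_combination ((Real.sqrt N : ℂ))⁻¹ * (csqrt (-I * z))⁻¹ * z⁻¹ *
      twistTheta N (residueChar N ℓ) 1 (-1 / z) * h2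

/-- Bounded coefficients `b`, `b'` vanishing at zero whose theta series are exchanged by
`z ↦ -1 / z`. -/
structure IsThetaPair (N : ℕ) (b b' : ℤ → ℂ) : Prop where
  bdd : ∃ B : ℝ, ∀ m, ‖b m‖ ≤ B
  bdd' : ∃ B : ℝ, ∀ m, ‖b' m‖ ≤ B
  zero : b 0 = 0
  zero' : b' 0 = 0
  trans_zero : ∀ z : ℂ, 0 < z.im → twistTheta N b 0 z =
    ((Real.sqrt N : ℂ))⁻¹ * (csqrt (-I * z))⁻¹ * twistTheta N b' 0 (-1 / z)
  trans_one : ∀ z : ℂ, 0 < z.im → twistTheta N b 1 z =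
    ((Real.sqrt N : ℂ))⁻¹ * (csqrt (-I * z))⁻¹ * z⁻¹ * twistTheta N b' 1 (-1 / z)

theorem twistTheta_sum {N : ℕ} (hN : 0 < N) {α : Type*} (s : Finset α) (a : α → ℂ)
    (f : α → ℤ → ℂ) {B : ℝ} (hf : ∀ i m, ‖f i m‖ ≤ B) (K : ℕ) {z : ℂ} (hz : 0 < z.im) :
    twistTheta N (fun m => ∑ i ∈ s, a i * f i m) K z = ∑ i ∈ s, a i * twistTheta N (f i) K z := by
  simp only [twistTheta, ← tsum_mul_left]
  rw [← Summable.tsum_finsetSum fun i _ => (summable_twistTerm hN (hf i) K hz).mul_left (a i)]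
  refine tsum_congr fun m => ?_
  simp only [twistTerm, Finset.sum_mul, mul_assoc]

/-- The two hypotheses are the two cuspidality conditions: `hℓ` removes the constant term of the
series itself, `ha` that of its Fourier dual. -/
theorem isThetaPair_residue {N : ℕ} (hN : 0 < N) {α : Type*} [Fintype α] (a : α → ℂ) (ℓ : α → ℤ)
    (ha : ∑ i, a i = 0) (hℓ : ∀ i, ¬ (N : ℤ) ∣ ℓ i) :
    IsThetaPair N (fun m => ∑ i, a i * residueInd N (ℓ i) m)
      (fun m => ∑ i, a i * residueChar N (ℓ i) m) where
  bdd := ⟨∑ i, ‖a i‖, fun m => norm_sum_le_of_le _ fun i _ => by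
    rw [norm_mul]
    exact mul_le_of_le_one_right (norm_nonneg _) (norm_residueInd_le _ _ _)⟩
  bdd' := ⟨∑ i, ‖a i‖, fun m => norm_sum_le_of_le _ fun i _ => by
    rw [norm_mul, norm_residueChar, mul_one]⟩
  zero := Finset.sum_eq_zero fun i _ => by simp [residueInd, hℓ i]
  zero' := by simpa [residueChar] using ha
  trans_zero z hz := by
    rw [twistTheta_sum hN _ _ _ (fun i m => norm_residueInd_le N (ℓ i) m) 0 hz,
      twistTheta_sum hN _ _ _ (fun i m => (norm_residueChar N (ℓ i) m).le) 0
        (neg_one_div_im_pos hz), Finset.mul_sum]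
    refine Finset.sum_congr rfl fun i _ => ?_
    rw [twistTheta_zero_residueInd hN _ hz]
    ring
  trans_one z hz := by
    rw [twistTheta_sum hN _ _ _ (fun i m => norm_residueInd_le N (ℓ i) m) 1 hz,
      twistTheta_sum hN _ _ _ (fun i m => (norm_residueChar N (ℓ i) m).le) 1
        (neg_one_div_im_pos hz), Finset.mul_sum]
    refine Finset.sum_congr rfl fun i _ => ?_
    rw [twistTheta_one_residueInd hN _ hz]
    ring

/-! ### Decay in cones -/

/-- Exponential decay at `0` and at `∞`, uniformly in every cone `δ |z| ≤ Im z` of the upper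
half-plane. -/
def ConeDecay (f : ℂ → ℂ) : Prop :=
  ∀ δ : ℝ, 0 < δ → ∃ C c : ℝ, 0 < C ∧ 0 < c ∧ ∀ z : ℂ, 0 < z.im → δ * ‖z‖ ≤ z.im →
    ‖f z‖ ≤ C * Real.exp (-c * (‖z‖ + ‖z‖⁻¹))

theorem sq_mul_exp_neg_le {c x : ℝ} (hc : 0 < c) (hx : 0 ≤ x) :
    x ^ 2 * Real.exp (-c * x) ≤ 8 / c ^ 2 * Real.exp (-(c / 2) * x) := by
  have h := Real.quadratic_le_exp_of_nonneg (x := c / 2 * x) (by positivity)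
  have h1 : x ^ 2 ≤ 8 / c ^ 2 * Real.exp (c / 2 * x) := by
    rw [div_mul_eq_mul_div, le_div_iff₀ (by positivity)]
    nlinarith [mul_nonneg hc.le hx]
  calc x ^ 2 * Real.exp (-c * x) ≤ 8 / c ^ 2 * Real.exp (c / 2 * x) * Real.exp (-c * x) :=
        mul_le_mul_of_nonneg_right h1 (Real.exp_pos _).le
    _ = 8 / c ^ 2 * Real.exp (-(c / 2) * x) := by
        rw [mul_assoc, ← Real.exp_add]; congr 2; ring

theorem csqrt_sq (z : ℂ) : csqrt z ^ 2 = z := by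
  have := Complex.cpow_nat_inv_pow z (n := 2) two_ne_zero
  rwa [show ((2 : ℕ) : ℂ)⁻¹ = 1 / 2 by norm_num] at this

theorem norm_csqrt (z : ℂ) : ‖csqrt z‖ = Real.sqrt ‖z‖ := by
  rw [← csqrt_sq z, norm_pow, Real.sqrt_sq (norm_nonneg _), csqrt_sq]

theorem ConeDecay.const_mul {f : ℂ → ℂ} (hf : ConeDecay f) (a : ℂ) :
    ConeDecay fun z => a * f z := by
  intro δ hδ
  obtain ⟨C, c, hC, hc, h⟩ := hf δ hδ
  refine ⟨(‖a‖ + 1) * C, c, by positivity, hc, fun z hz hz' => ?_⟩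
  rw [norm_mul, mul_assoc]
  exact mul_le_mul (by linarith) (h z hz hz') (norm_nonneg _) (by positivity)

theorem ConeDecay.congr {f g : ℂ → ℂ} (hf : ConeDecay f) (h : ∀ z : ℂ, 0 < z.im → g z = f z) :
    ConeDecay g := by
  intro δ hδ
  obtain ⟨C, c, hC, hc, h'⟩ := hf δ hδ
  exact ⟨C, c, hC, hc, fun z hz hz' => by rw [h z hz]; exact h' z hz hz'⟩

/-- In a cone, Im z is at least δ|z| and Im(-1/z) is at least δ/|z|. So decay of f at i∞ handles |z|
≥ 1, and decay of g at i∞, carried over by inversion, handles |z| ≤ 1. -/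
theorem coneDecay_of_inversion {f g : ℂ → ℂ}
    (hf : ∀ δ : ℝ, 0 < δ → ∃ C c : ℝ, 0 < C ∧ 0 < c ∧ ∀ z : ℂ, δ ≤ z.im →
      ‖f z‖ ≤ C * Real.exp (-c * z.im))
    (hg : ∀ δ : ℝ, 0 < δ → ∃ C c : ℝ, 0 < C ∧ 0 < c ∧ ∀ z : ℂ, δ ≤ z.im →
      ‖g z‖ ≤ C * Real.exp (-c * z.im))
    (hfg : ∀ z : ℂ, 0 < z.im → ‖z‖ ≤ 1 → ‖f z‖ ≤ ‖z‖⁻¹ ^ 2 * ‖g (-1 / z)‖) :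
    ConeDecay f := by
  intro δ hδ
  obtain ⟨C₁, c₁, hC₁, hc₁, h₁⟩ := hf δ hδ
  obtain ⟨C₂, c₂, hC₂, hc₂, h₂⟩ := hg δ hδ
  have hc₂δ : 0 < c₂ * δ := mul_pos hc₂ hδ
  set D := C₂ * (8 / (c₂ * δ) ^ 2) with hD
  have hDpos : 0 < D := by positivity
  -- Both halves use |z| + 1/|z| ≤ 2 max(|z|, 1/|z|); near 0 another factor 2 is spent on absorbing
  -- |z|⁻² into the exponential.
  set c := min (c₁ * δ / 2) (c₂ * δ / 4) with hcdef
  have hc : 0 < c := lt_min (by positivity) (by positivity)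
  refine ⟨C₁ + D, c, by positivity, hc, fun z hz hz' => ?_⟩
  have hz0 : 0 < ‖z‖ := norm_pos_iff.mpr (ne_zero_of_im_pos hz)
  rcases le_total 1 ‖z‖ with hn | hn
  · have hinv : ‖z‖⁻¹ ≤ ‖z‖ := (inv_le_one_of_one_le₀ hn).trans hn
    refine (h₁ z (by nlinarith)).trans ?_
    refine mul_le_mul (by linarith) (Real.exp_le_exp.mpr ?_) (Real.exp_pos _).le (by positivity)
    have h3 : c * (‖z‖ + ‖z‖⁻¹) ≤ c₁ * δ / 2 * (2 * ‖z‖) :=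
      mul_le_mul (min_le_left _ _) (by linarith) (by positivity) (by positivity)
    nlinarith [mul_le_mul_of_nonneg_left hz' hc₁.le]
  · have hinv : ‖z‖ ≤ ‖z‖⁻¹ := hn.trans ((one_le_inv₀ hz0).mpr hn)
    have him : δ * ‖z‖⁻¹ ≤ (-1 / z).im := by
      rw [div_eq_mul_inv, neg_one_mul, neg_im, inv_im, neg_div, neg_neg, normSq_eq_norm_sq,
        le_div_iff₀ (by positivity)]
      calc δ * ‖z‖⁻¹ * ‖z‖ ^ 2 = δ * ‖z‖ := by field_simp
        _ ≤ z.im := hz'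
    have hone : 1 ≤ ‖z‖⁻¹ := (one_le_inv₀ hz0).mpr hn
    refine (hfg z hz hn).trans ?_
    have h4 := h₂ (-1 / z) (le_trans (by nlinarith) him)
    have h5 : Real.exp (-c₂ * (-1 / z).im) ≤ Real.exp (-(c₂ * δ) * ‖z‖⁻¹) :=
      Real.exp_le_exp.mpr (by nlinarith [mul_le_mul_of_nonneg_left him hc₂.le])
    calc ‖z‖⁻¹ ^ 2 * ‖g (-1 / z)‖
        ≤ ‖z‖⁻¹ ^ 2 * (C₂ * Real.exp (-(c₂ * δ) * ‖z‖⁻¹)) := by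
          refine mul_le_mul_of_nonneg_left (h4.trans ?_) (by positivity)
          exact mul_le_mul_of_nonneg_left h5 hC₂.le
      _ = C₂ * (‖z‖⁻¹ ^ 2 * Real.exp (-(c₂ * δ) * ‖z‖⁻¹)) := by ring
      _ ≤ C₂ * (8 / (c₂ * δ) ^ 2 * Real.exp (-(c₂ * δ / 2) * ‖z‖⁻¹)) :=
          mul_le_mul_of_nonneg_left (sq_mul_exp_neg_le hc₂δ (by positivity)) hC₂.le
      _ = D * Real.exp (-(c₂ * δ / 2) * ‖z‖⁻¹) := by rw [hD]; ring
      _ ≤ (C₁ + D) * Real.exp (-c * (‖z‖ + ‖z‖⁻¹)) := by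
          refine mul_le_mul (by linarith) (Real.exp_le_exp.mpr ?_) (Real.exp_pos _).le
            (by positivity)
          have h3 : c * (‖z‖ + ‖z‖⁻¹) ≤ c₂ * δ / 4 * (2 * ‖z‖⁻¹) :=
            mul_le_mul (min_le_right _ _) (by linarith) (by positivity) (by positivity)
          linarith

/-- Cauchy's estimate on a disc of radius proportional to |z|: the disc stays in a slightly wider
cone, where f is already known to decay. -/
theorem ConeDecay.of_hasDerivAt {f f' : ℂ → ℂ} (hf : ConeDecay f)
    (h : ∀ z : ℂ, 0 < z.im → HasDerivAt f (f' z) z) : ConeDecay f' := by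
  intro δ hδ
  obtain ⟨C, c, hC, hc, hb⟩ := hf (δ / 2) (half_pos hδ)
  have hc4 : 0 < c / 4 := by positivity
  refine ⟨C * (4 / δ) * (4 / c), c / 4, by positivity, hc4, fun z hz hz' => ?_⟩
  have hz0 : 0 < ‖z‖ := norm_pos_iff.mpr (ne_zero_of_im_pos hz)
  -- Since Im z ≤ |z|, a nonempty cone forces δ ≤ 1; this keeps the disc of radius (δ/4)|z| away
  -- from 0.
  have hδ1 : δ ≤ 1 := by
    have := hz'.trans ((le_abs_self _).trans (abs_im_le_norm z))
    nlinarith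
  set r := δ / 4 * ‖z‖ with hr
  have hr0 : 0 < r := by positivity
  have him : ∀ w ∈ Metric.closedBall z r, 3 / 4 * (δ * ‖z‖) ≤ w.im := by
    intro w hw
    have h1 : |(w - z).im| ≤ r := (abs_im_le_norm _).trans (by rwa [← dist_eq_norm])
    have h2 := (abs_le.mp h1).1
    rw [sub_im] at h2
    linarith
  have hdiff : DiffContOnCl ℂ f (Metric.ball z r) := by
    refine DifferentiableOn.diffContOnCl fun w hw => ?_
    have := him w (Metric.closure_ball_subset_closedBall hw)
    exact (h w (lt_of_lt_of_le (by positivity) this)).differentiableAt.differentiableWithinAt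
  have hs : ∀ w ∈ Metric.sphere z r,
      ‖f w‖ ≤ C * Real.exp (-(c / 2) * (‖z‖ + ‖z‖⁻¹)) := by
    intro w hw
    have h1 := him w (Metric.sphere_subset_closedBall hw)
    have h2 : ‖w - z‖ = r := by rw [← dist_eq_norm]; exact hw
    have h3 : ‖w‖ ≤ 5 / 4 * ‖z‖ := by
      have := norm_add_le (w - z) z
      rw [sub_add_cancel, h2] at this
      nlinarith
    have h4 : 3 / 4 * ‖z‖ ≤ ‖w‖ := by
      have := norm_sub_norm_le z w
      rw [norm_sub_rev, h2] at this
      nlinarith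
    have hw0 : 0 < ‖w‖ := by linarith
    refine (hb w (lt_of_lt_of_le (by positivity) h1) (by nlinarith)).trans ?_
    refine mul_le_mul_of_nonneg_left (Real.exp_le_exp.mpr ?_) hC.le
    have h5 : (1 / 2) * ‖z‖⁻¹ ≤ ‖w‖⁻¹ := by
      rw [← one_div, ← one_div, div_mul_div_comm, div_le_div_iff₀ (by positivity) hw0]
      linarith
    nlinarith
  have key := Complex.norm_deriv_le_of_forall_mem_sphere_norm_le hr0 hdiff hs
  rw [(h z hz).deriv] at key
  refine key.trans ?_
  set s := ‖z‖ + ‖z‖⁻¹ with hsdef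
  -- Dividing by the radius costs a factor 1/|z|, which is paid for with half of the remaining
  -- exponent.
  have h6 : ‖z‖⁻¹ ≤ 4 / c * Real.exp (c / 4 * s) := by
    have h7 := Real.add_one_le_exp (c / 4 * s)
    rw [div_mul_eq_mul_div, le_div_iff₀ hc]
    have h8 : ‖z‖⁻¹ ≤ s := by linarith
    nlinarith
  calc C * Real.exp (-(c / 2) * s) / r
      = C * (4 / δ) * Real.exp (-(c / 2) * s) * ‖z‖⁻¹ := by rw [hr]; field_simp
    _ ≤ C * (4 / δ) * Real.exp (-(c / 2) * s) * (4 / c * Real.exp (c / 4 * s)) :=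
        mul_le_mul_of_nonneg_left h6 (by positivity)
    _ = C * (4 / δ) * (4 / c) * (Real.exp (-(c / 2) * s) * Real.exp (c / 4 * s)) := by ring
    _ = C * (4 / δ) * (4 / c) * Real.exp (-(c / 4) * s) := by
        rw [← Real.exp_add]; congr 2; ring

theorem norm_inv_csqrt_le {z : ℂ} (hz0 : z ≠ 0) (hz : ‖z‖ ≤ 1) :
    ‖(csqrt (-I * z))⁻¹‖ ≤ ‖z‖⁻¹ := by
  rw [norm_inv, norm_csqrt, norm_mul, norm_neg, norm_I, one_mul]
  have h0 := norm_pos_iff.mpr hz0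
  exact inv_anti₀ h0 (Real.le_sqrt_of_sq_le (by nlinarith))

theorem norm_inv_sqrt_natCast_le {N : ℕ} (hN : 0 < N) : ‖((Real.sqrt N : ℂ))⁻¹‖ ≤ 1 := by
  rw [norm_inv, Complex.norm_real, Real.norm_of_nonneg (Real.sqrt_nonneg _)]
  exact inv_le_one_of_one_le₀ (Real.one_le_sqrt.mpr (Nat.one_le_cast.mpr hN))

/-- Only K = 0 and K = 1 transform without correction terms. Higher K are reached by
differentiation, which raises K by 2 up to a constant. -/
theorem IsThetaPair.coneDecay {N : ℕ} (hN : 0 < N) {b b' : ℤ → ℂ} (h : IsThetaPair N b b')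
    (K : ℕ) : ConeDecay (twistTheta N b K) := by
  obtain ⟨B, hB⟩ := h.bdd
  obtain ⟨B', hB'⟩ := h.bdd'
  induction K using Nat.twoStepInduction with
  | zero =>
    refine coneDecay_of_inversion (fun δ hδ => exists_norm_twistTheta_le hN hB h.zero 0 hδ)
      (fun δ hδ => exists_norm_twistTheta_le hN hB' h.zero' 0 hδ) fun z hz hz1 => ?_
    have hz0 := ne_zero_of_im_pos hz
    rw [h.trans_zero z hz, norm_mul, norm_mul]
    refine mul_le_mul_of_nonneg_right ?_ (norm_nonneg _)
    calc _ ≤ 1 * ‖z‖⁻¹ := mul_le_mul (norm_inv_sqrt_natCast_le hN) (norm_inv_csqrt_le hz0 hz1)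
            (norm_nonneg _) zero_le_one
      _ ≤ ‖z‖⁻¹ ^ 2 := by
          have := (one_le_inv₀ (norm_pos_iff.mpr hz0)).mpr hz1
          nlinarith
  | one =>
    refine coneDecay_of_inversion (fun δ hδ => exists_norm_twistTheta_le hN hB h.zero 1 hδ)
      (fun δ hδ => exists_norm_twistTheta_le hN hB' h.zero' 1 hδ) fun z hz hz1 => ?_
    have hz0 := ne_zero_of_im_pos hz
    rw [h.trans_one z hz, norm_mul, norm_mul, norm_mul]
    refine mul_le_mul_of_nonneg_right ?_ (norm_nonneg _)
    calc _ ≤ 1 * ‖z‖⁻¹ * ‖z‖⁻¹ := by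
            rw [norm_inv z]
            exact mul_le_mul_of_nonneg_right (mul_le_mul (norm_inv_sqrt_natCast_le hN)
              (norm_inv_csqrt_le hz0 hz1) (norm_nonneg _) zero_le_one) (by positivity)
      _ = ‖z‖⁻¹ ^ 2 := by ring
  | more K ih _ =>
    have hN' : (N : ℂ) ≠ 0 := Nat.cast_ne_zero.mpr hN.ne'
    have hpi : (Real.pi : ℂ) ≠ 0 := ofReal_ne_zero.mpr Real.pi_ne_zero
    refine ((ih.of_hasDerivAt fun z hz => hasDerivAt_twistTheta hN hB K hz).const_mul
      (N / (Real.pi * I))).congr fun z _ => ?_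
    field_simp

/-! ### Rotation of the path of integration -/

theorem integrable_exp_neg_abs_mul_inv_sqrt {c : ℝ} (hc : 0 < c) :
    Integrable fun x : ℝ => |x| ^ (1 / 2 - 1 : ℝ) * Real.exp (-(c * |x|)) := by
  -- The integral of a non-integrable function is 0 by convention, so the nonzero value in terms of
  -- Γ(1/2) proves integrability.
  refine Integrable.of_integral_ne_zero ?_
  rw [integral_comp_abs (f := fun x : ℝ => x ^ (1 / 2 - 1 : ℝ) * Real.exp (-(c * x))),
    Real.integral_rpow_mul_exp_neg_mul_Ioi one_half_pos hc]
  have := Real.Gamma_pos_of_pos one_half_pos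
  positivity

/-- A function dominating the integrands below. -/
def rayBound (c r t : ℝ) : ℝ := Real.exp (-(c * t)) * (Real.sqrt |t - r|)⁻¹

theorem integrableOn_rayBound {c : ℝ} (hc : 0 < c) (r : ℝ) :
    IntegrableOn (rayBound c r) (Ioi 0) := by
  have h := (((integrable_exp_neg_abs_mul_inv_sqrt hc).comp_sub_right r).const_mul
    (Real.exp (c * |r|))).integrableOn (s := Ioi 0)
  refine h.mono' ?_ ?_
  · refine Measurable.aestronglyMeasurable ?_
    unfold rayBound
    fun_prop
  · refine (ae_restrict_iff' measurableSet_Ioi).mpr (ae_of_all _ fun t ht => ?_)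
    have ht0 : 0 < t := ht
    rw [rayBound, Real.norm_of_nonneg (by positivity), Real.sqrt_eq_rpow,
      ← Real.rpow_neg (abs_nonneg _), mul_left_comm, ← Real.exp_add, mul_comm]
    norm_num
    refine mul_le_mul_of_nonneg_left (Real.exp_le_exp.mpr ?_) (Real.rpow_nonneg (abs_nonneg _) _)
    have : |t - r| ≤ t + |r| := by
      calc |t - r| ≤ |t| + |r| := abs_sub _ _
        _ = t + |r| := by rw [abs_of_pos ht0]
    nlinarith

/-- The integrand `f(z) / √(-i (z - w))`. -/
def kernelFun (f : ℂ → ℂ) (w z : ℂ) : ℂ := f z / csqrt (-I * (z - w))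

/-- As |tu - w| ≥ |t - |w||, the bound does not depend on the direction u, so one dominating
function serves all rays in a cone. The point t = |w| must be excluded because the inverse of zero
is zero there. -/
theorem norm_kernelFun_le {f : ℂ → ℂ} (hf : ConeDecay f) {w : ℂ} {δ : ℝ} (hδ : 0 < δ) :
    ∃ C c : ℝ, 0 < C ∧ 0 < c ∧ ∀ u : ℂ, ‖u‖ = 1 → δ ≤ u.im → ∀ t : ℝ, 0 < t → t ≠ ‖w‖ →
      ‖kernelFun f w (t * u)‖ ≤ C * rayBound c ‖w‖ t := by
  obtain ⟨C, c, hC, hc, h⟩ := hf δ hδ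
  refine ⟨C, c, hC, hc, fun u hu hu' t ht htw => ?_⟩
  have hn : ‖(t : ℂ) * u‖ = t := by
    rw [norm_mul, hu, mul_one, Complex.norm_real, Real.norm_of_nonneg ht.le]
  have him : ((t : ℂ) * u).im = t * u.im := im_ofReal_mul _ _
  have hz := h (t * u) (by rw [him]; exact mul_pos ht (hδ.trans_le hu'))
    (by rw [hn, him, mul_comm]; exact mul_le_mul_of_nonneg_left hu' ht.le)
  rw [hn] at hz
  rw [kernelFun, norm_div, norm_csqrt, norm_mul, norm_neg, norm_I, one_mul, rayBound,
    div_eq_mul_inv, ← mul_assoc]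
  have h1 : ‖f (t * u)‖ ≤ C * Real.exp (-(c * t)) := by
    refine hz.trans (mul_le_mul_of_nonneg_left (Real.exp_le_exp.mpr ?_) hC.le)
    have : 0 < t⁻¹ := by positivity
    nlinarith
  refine mul_le_mul h1 ?_ (by positivity) (by positivity)
  refine inv_anti₀ (Real.sqrt_pos.mpr (abs_pos.mpr (sub_ne_zero.mpr htw))) (Real.sqrt_le_sqrt ?_)
  have := abs_norm_sub_norm_le ((t : ℂ) * u) w
  rwa [hn] at this


theorem ae_ne_restrict (r : ℝ) : ∀ᵐ t ∂(volume.restrict (Ioi (0 : ℝ))), t ≠ r :=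
  ae_restrict_of_ae (by simp [ae_iff, measure_singleton])

theorem aestronglyMeasurable_kernelFun_ray {f : ℂ → ℂ}
    (hd : ∀ z : ℂ, 0 < z.im → DifferentiableAt ℂ f z) (w : ℂ) {u : ℂ} (hu : 0 < u.im) :
    AEStronglyMeasurable (fun t : ℝ => kernelFun f w (t * u)) (volume.restrict (Ioi 0)) := by
  refine AEStronglyMeasurable.div₀ (ContinuousOn.aestronglyMeasurable (fun t ht => ?_)
    measurableSet_Ioi) (Measurable.aestronglyMeasurable ?_)
  · refine ContinuousAt.continuousWithinAt ?_
    have h1 : ContinuousAt f (t * u) := (hd _ (by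
      rw [im_ofReal_mul]; exact mul_pos ht hu)).continuousAt
    exact ContinuousAt.comp (f := fun t : ℝ => (t : ℂ) * u) h1 (by fun_prop)
  · unfold csqrt
    fun_prop

theorem integrableOn_kernelFun_ray {f : ℂ → ℂ} (hf : ConeDecay f)
    (hd : ∀ z : ℂ, 0 < z.im → DifferentiableAt ℂ f z) (w : ℂ) {u : ℂ} (hu1 : ‖u‖ = 1)
    (hu : 0 < u.im) : IntegrableOn (fun t : ℝ => kernelFun f w (t * u)) (Ioi 0) := by
  obtain ⟨C, c, _, hc, h⟩ := norm_kernelFun_le hf hu (w := w)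
  refine ((integrableOn_rayBound hc ‖w‖).const_mul C).mono'
    (aestronglyMeasurable_kernelFun_ray hd w hu) ?_
  filter_upwards [ae_restrict_mem measurableSet_Ioi, ae_ne_restrict ‖w‖] with t ht htw
  exact h u hu1 le_rfl t ht htw

theorem differentiableAt_csqrt {z : ℂ} (hz : z ∈ slitPlane) : DifferentiableAt ℂ csqrt z :=
  differentiableAt_id.cpow_const hz

theorem differentiableAt_kernelFun {f : ℂ → ℂ} {w z : ℂ} (hf : DifferentiableAt ℂ f z)
    (h : -I * (z - w) ∈ slitPlane) : DifferentiableAt ℂ (kernelFun f w) z := by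
  refine hf.div (DifferentiableAt.comp z (f := fun z => -I * (z - w)) (differentiableAt_csqrt h)
    (by fun_prop)) fun h0 => ?_
  have := csqrt_sq (-I * (z - w))
  rw [h0] at this
  exact slitPlane_ne_zero h (by rw [← this]; norm_num)

/-- The substitution z = exp ζ turns rays into horizontal lines, so that Cauchy's theorem for a
sector becomes Cauchy's theorem for a rectangle. -/
theorem integral_comp_exp {E : Type*} [NormedAddCommGroup E] [NormedSpace ℝ E] (g : ℝ → E) :
    ∫ x : ℝ, Real.exp x • g (Real.exp x) = ∫ t in Ioi 0, g t := by
  have h := integral_image_eq_integral_abs_deriv_smul (s := univ) MeasurableSet.univ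
    (fun x _ => (Real.hasDerivAt_exp x).hasDerivWithinAt) Real.exp_injective.injOn g
  rw [image_univ, Real.range_exp] at h
  rw [h, setIntegral_univ]
  simp_rw [Real.abs_exp]

theorem integrable_comp_exp {E : Type*} [NormedAddCommGroup E] [NormedSpace ℝ E] {g : ℝ → E}
    (hg : IntegrableOn g (Ioi 0)) : Integrable fun x : ℝ => Real.exp x • g (Real.exp x) := by
  have h := integrableOn_image_iff_integrableOn_abs_deriv_smul (s := univ) MeasurableSet.univ
    (fun x _ => (Real.hasDerivAt_exp x).hasDerivWithinAt) Real.exp_injective.injOn g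
  rw [image_univ, Real.range_exp, integrableOn_univ] at h
  simpa only [Real.abs_exp] using h.mp hg

theorem tendsto_mul_rayBound_atTop {c : ℝ} (hc : 0 < c) (r : ℝ) :
    Tendsto (fun t => t * rayBound c r t) atTop (𝓝 0) := by
  have h1 : Tendsto (fun t : ℝ => t ^ 1 * Real.exp (-c * t)) atTop (𝓝 0) := by
    simpa using tendsto_rpow_mul_exp_neg_mul_atTop_nhds_zero 1 c hc
  refine squeeze_zero' ?_ ?_ h1
  · filter_upwards [eventually_ge_atTop 0] with t ht
    exact mul_nonneg ht (mul_nonneg (Real.exp_pos _).le (by positivity))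
  · filter_upwards [eventually_ge_atTop 0, eventually_ge_atTop (r + 1)] with t ht htr
    rw [rayBound, pow_one, neg_mul]
    refine mul_le_mul_of_nonneg_left (mul_le_of_le_one_right (Real.exp_pos _).le ?_) ht
    refine inv_le_one_of_one_le₀ (Real.one_le_sqrt.mpr ?_)
    rw [abs_of_nonneg (by linarith)]
    linarith

theorem tendsto_mul_rayBound_zero (c : ℝ) {r : ℝ} (hr : r ≠ 0) :
    Tendsto (fun t => t * rayBound c r t) (𝓝 0) (𝓝 0) := by
  have : ContinuousAt (fun t => t * rayBound c r t) 0 := by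
    unfold rayBound
    have h1 : ContinuousAt (fun t : ℝ => (Real.sqrt |t - r|)⁻¹) 0 := by
      refine ContinuousAt.inv₀ (by fun_prop) ?_
      simpa [Real.sqrt_ne_zero'] using hr
    fun_prop
  simpa using this.tendsto

/-- The unit vector of argument `φ`. -/
def unitVec (φ : ℝ) : ℂ := cexp (φ * I)

theorem norm_unitVec (φ : ℝ) : ‖unitVec φ‖ = 1 := norm_exp_ofReal_mul_I φ

theorem unitVec_im (φ : ℝ) : (unitVec φ).im = Real.sin φ := exp_ofReal_mul_I_im φ

theorem unitVec_re (φ : ℝ) : (unitVec φ).re = Real.cos φ := exp_ofReal_mul_I_re φ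

theorem exp_add_mul_I (x φ : ℝ) : cexp (x + φ * I) = (Real.exp x : ℂ) * unitVec φ := by
  rw [Complex.exp_add, ofReal_exp, unitVec]

/-- Two rays in the upper half-plane give the same integral if the integrand is holomorphic
between them. -/
theorem integral_ray_eq_integral_ray {f : ℂ → ℂ} (hf : ConeDecay f) {w : ℂ} (hw : w ≠ 0)
    {φ₁ φ₂ δ : ℝ} (hδ : 0 < δ) (hsin : ∀ φ ∈ uIcc φ₁ φ₂, δ ≤ Real.sin φ)
    (hd : ∀ z : ℂ, 0 < z.im → DifferentiableAt ℂ f z)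
    (hslit : ∀ φ ∈ uIcc φ₁ φ₂, ∀ t : ℝ, 0 < t → -I * (t * unitVec φ - w) ∈ slitPlane) :
    ∫ t in Ioi (0 : ℝ), kernelFun f w (t * unitVec φ₁) * unitVec φ₁ =
      ∫ t in Ioi (0 : ℝ), kernelFun f w (t * unitVec φ₂) * unitVec φ₂ := by
  set g : ℂ → ℂ := fun ζ => kernelFun f w (cexp ζ) * cexp ζ with hg
  have hge : ∀ x φ : ℝ, g (x + φ * I) =
      Real.exp x • (kernelFun f w (Real.exp x * unitVec φ) * unitVec φ) := by
    intro x φ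
    rw [hg]
    simp only
    rw [exp_add_mul_I, real_smul]
    ring
  obtain ⟨C, c, hC, hc, hbd⟩ := norm_kernelFun_le hf hδ (w := w)
  have hw' : ‖w‖ ≠ 0 := norm_ne_zero_iff.mpr hw
  have hint : ∀ φ ∈ uIcc φ₁ φ₂, Integrable fun x : ℝ => g (x + φ * I) := by
    intro φ hφ
    simp_rw [hge]
    refine integrable_comp_exp (g := fun t : ℝ => kernelFun f w (t * unitVec φ) * unitVec φ) ?_
    refine Integrable.mul_const (integrableOn_kernelFun_ray hf hd w (norm_unitVec φ) ?_) _
    rw [unitVec_im]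
    exact hδ.trans_le (hsin φ hφ)
  have hval : ∀ φ : ℝ, ∫ x : ℝ, g (x + φ * I) =
      ∫ t in Ioi (0 : ℝ), kernelFun f w (t * unitVec φ) * unitVec φ := by
    intro φ
    simp_rw [hge]
    exact integral_comp_exp fun t : ℝ => kernelFun f w (t * unitVec φ) * unitVec φ
  -- The vertical sides are circular arcs in the original coordinate. Their integrals vanish as the
  -- radius tends to 0 or ∞, both eventually different from |w|.
  have hvert : ∀ x : ℝ, Real.exp x ≠ ‖w‖ → ‖∫ y in φ₁..φ₂, g (x + y * I)‖ ≤
      C * (Real.exp x * rayBound c ‖w‖ (Real.exp x)) * |φ₂ - φ₁| := by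
    intro x hx
    refine intervalIntegral.norm_integral_le_of_norm_le_const fun y hy => ?_
    have hy' := uIoc_subset_uIcc hy
    rw [hge, norm_smul, norm_mul, norm_unitVec, mul_one, Real.norm_of_nonneg (Real.exp_pos x).le,
      mul_left_comm]
    refine mul_le_mul_of_nonneg_left (hbd _ (norm_unitVec y) ?_ _ (Real.exp_pos x) hx)
      (Real.exp_pos x).le
    rw [unitVec_im]
    exact hsin y hy'
  have hvlim : ∀ {x : ℝ → ℝ}, (∀ᶠ R in atTop, Real.exp (x R) ≠ ‖w‖) →
      Tendsto (fun R => Real.exp (x R) * rayBound c ‖w‖ (Real.exp (x R))) atTop (𝓝 0) →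
      Tendsto (fun R => ∫ y in φ₁..φ₂, g (x R + y * I)) atTop (𝓝 0) := by
    intro x h1 h2
    refine squeeze_zero_norm' (a := fun R => C * (Real.exp (x R) *
      rayBound c ‖w‖ (Real.exp (x R))) * |φ₂ - φ₁|) ?_ ?_
    · filter_upwards [h1] with R hR using hvert _ hR
    · simpa using (h2.const_mul C).mul_const |φ₂ - φ₁|
  have hR := Real.tendsto_exp_atTop
  have hL : Tendsto (fun R : ℝ => Real.exp (-R)) atTop (𝓝 0) := Real.tendsto_exp_neg_atTop_nhds_zero
  have hright := hvlim (x := fun R => R) (hR.eventually (eventually_ne_atTop _))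
    ((tendsto_mul_rayBound_atTop hc ‖w‖).comp hR)
  have hleft := hvlim (x := fun R => -R) (hL.eventually (eventually_ne_nhds hw'.symm))
    ((tendsto_mul_rayBound_zero c hw').comp hL)
  have hbot := intervalIntegral_tendsto_integral (hint φ₁ left_mem_uIcc) tendsto_neg_atTop_atBot
    tendsto_id
  have htop := intervalIntegral_tendsto_integral (hint φ₂ right_mem_uIcc) tendsto_neg_atTop_atBot
    tendsto_id
  have hrect : ∀ R : ℝ, (∫ x in (-R)..R, g (x + φ₁ * I)) - (∫ x in (-R)..R, g (x + φ₂ * I)) +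
      I • (∫ y in φ₁..φ₂, g ((R : ℝ) + y * I)) -
        I • (∫ y in φ₁..φ₂, g ((-R : ℝ) + y * I)) = 0 := by
    intro R
    have := Complex.integral_boundary_rect_eq_zero_of_differentiableOn g ⟨-R, φ₁⟩ ⟨R, φ₂⟩ ?_
    · exact this
    · intro ζ hζ
      refine DifferentiableAt.differentiableWithinAt ?_
      have hζ2 : ζ.im ∈ uIcc φ₁ φ₂ := hζ.2
      have he : cexp ζ = (Real.exp ζ.re : ℂ) * unitVec ζ.im := by
        rw [← exp_add_mul_I, re_add_im]
      have h1 : DifferentiableAt ℂ (kernelFun f w) (cexp ζ) := by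
        rw [he]
        refine differentiableAt_kernelFun (hd _ ?_) (hslit _ hζ2 _ (Real.exp_pos _))
        rw [im_ofReal_mul, unitVec_im]
        exact mul_pos (Real.exp_pos _) (hδ.trans_le (hsin _ hζ2))
      exact (h1.comp ζ Complex.differentiableAt_exp).mul Complex.differentiableAt_exp
  have hlim := (((hbot.sub htop).add (hright.const_smul I)).sub (hleft.const_smul I))
  have hzero := tendsto_nhds_unique (hlim.congr fun R => by simpa using hrect R)
    tendsto_const_nhds
  simp only [smul_zero, add_zero, sub_zero] at hzero
  rw [← hval, ← hval]
  exact sub_eq_zero.mp hzero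

/-- The cut of √(-i(z-w)) is the vertical half-line from w = r e^{iφ₀} downwards. The hypothesis
puts the ray of argument φ on the same side of w as the imaginary axis, where it can meet the
vertical line through w only above w. -/
theorem sub_ray_mem_slitPlane {φ φ₀ r t : ℝ} (h : 0 < Real.cos φ₀ * Real.sin (φ - φ₀))
    (ht : 0 < t) : -I * (t * unitVec φ - r * unitVec φ₀) ∈ slitPlane := by
  rw [mem_slitPlane_iff]
  have hre : (-I * (t * unitVec φ - r * unitVec φ₀)).re = t * Real.sin φ - r * Real.sin φ₀ := by
    simp [unitVec_im]
  have him : (-I * (t * unitVec φ - r * unitVec φ₀)).im = -(t * Real.cos φ - r * Real.cos φ₀) := by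
    simp [unitVec_re]
  rw [hre, him]
  by_cases h0 : t * Real.cos φ - r * Real.cos φ₀ = 0
  · left
    have h1 : Real.cos φ₀ ^ 2 * (t * Real.sin φ - r * Real.sin φ₀) =
        t * (Real.cos φ₀ * Real.sin (φ - φ₀)) := by
      rw [Real.sin_sub]
      linear_combination Real.cos φ₀ * Real.sin φ₀ * h0
    have h2 := mul_pos ht h
    rw [← h1] at h2
    exact pos_of_mul_pos_right h2 (sq_nonneg _)
  · right
    exact neg_ne_zero.mpr h0

theorem continuous_unitVec : Continuous unitVec := by
  unfold unitVec
  fun_prop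

/-- The rotation of the imaginary axis onto the ray through the branch point `w`. -/
theorem integral_imAxis_eq_integral_ray {f : ℂ → ℂ} (hf : ConeDecay f)
    (hd : ∀ z : ℂ, 0 < z.im → DifferentiableAt ℂ f z) {w : ℂ} (hw : 0 < w.im) (hre : w.re ≠ 0) :
    ∫ y in Ioi (0 : ℝ), kernelFun f w (I * y) * I =
      ∫ t in Ioi (0 : ℝ), kernelFun f w (t * w) * w := by
  have hw0 : w ≠ 0 := ne_zero_of_im_pos hw
  have hr : 0 < ‖w‖ := norm_pos_iff.mpr hw0
  set r := ‖w‖ with hrdef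
  set φ₀ := arg w with hφ₀
  have hwu : (r : ℂ) * unitVec φ₀ = w := norm_mul_exp_arg_mul_I w
  have hsin0 : 0 < Real.sin φ₀ := by rw [hφ₀, sin_arg]; exact div_pos hw hr
  have hcos0 : Real.cos φ₀ ≠ 0 := by rw [hφ₀, cos_arg hw0]; exact div_ne_zero hre hr.ne'
  have hφpos : 0 < φ₀ := by
    by_contra hcon
    exact absurd (Real.sin_nonpos_of_nonpos_of_neg_pi_le (not_lt.mp hcon) (neg_pi_lt_arg w).le)
      (not_le.mpr hsin0)
  have hφlt : φ₀ < Real.pi := by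
    refine lt_of_le_of_ne (arg_le_pi w) fun h => ?_
    rw [h, Real.sin_pi] at hsin0
    exact lt_irrefl _ hsin0
  -- The directions φ₀ + s d with 0 < s ≤ 1 sweep from the ray through w to the imaginary axis; d
  -- has the sign of Re w, so one argument covers both sides.
  set d := Real.pi / 2 - φ₀ with hd_def
  have hcosd : Real.cos φ₀ = Real.sin d := by rw [hd_def, Real.sin_pi_div_two_sub]
  have hsind : Real.sin φ₀ = Real.cos d := by rw [hd_def, Real.cos_pi_div_two_sub]
  have hd0 : d ≠ 0 := fun h => hcos0 (by rw [hcosd, h, Real.sin_zero])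
  have hdabs : |d| ≤ Real.pi := by rw [abs_le]; constructor <;> linarith
  -- position of the intermediate directions
  have hpos : ∀ s ∈ Ioc (0 : ℝ) 1, ∀ φ ∈ uIcc (φ₀ + s * d) (Real.pi / 2),
      Real.sin φ₀ ≤ Real.sin φ ∧ 0 < Real.cos φ₀ * Real.sin (φ - φ₀) := by
    intro s hs φ hφ
    obtain ⟨hs0, hs1⟩ := hs
    rcases lt_or_gt_of_ne hd0 with hneg | hpos
    · have hsd : s * d < 0 := mul_neg_of_pos_of_neg hs0 hneg
      rw [uIcc_of_ge (by nlinarith)] at hφ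
      constructor
      · rw [hsind, ← Real.cos_pi_div_two_sub φ, ← Real.cos_abs d,
          ← Real.cos_abs (Real.pi / 2 - φ)]
        refine Real.cos_le_cos_of_nonneg_of_le_pi (abs_nonneg _) hdabs ?_
        rw [abs_of_neg hneg, abs_of_nonpos (by linarith [hφ.1])]
        linarith [hφ.2]
      · rw [hcosd]
        refine mul_pos_of_neg_of_neg (Real.sin_neg_of_neg_of_neg_pi_lt hneg (by linarith))
          (Real.sin_neg_of_neg_of_neg_pi_lt (by linarith [hφ.2]) (by linarith [hφ.1]))
    · have hsd : 0 < s * d := mul_pos hs0 hpos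
      rw [uIcc_of_le (by nlinarith)] at hφ
      constructor
      · rw [hsind, ← Real.cos_pi_div_two_sub φ, ← Real.cos_abs d,
          ← Real.cos_abs (Real.pi / 2 - φ)]
        refine Real.cos_le_cos_of_nonneg_of_le_pi (abs_nonneg _) hdabs ?_
        rw [abs_of_pos hpos, abs_of_nonneg (by linarith [hφ.2])]
        linarith [hφ.1]
      · rw [hcosd]
        refine mul_pos (Real.sin_pos_of_pos_of_lt_pi hpos (by linarith))
          (Real.sin_pos_of_pos_of_lt_pi (by linarith [hφ.1]) (by linarith [hφ.2]))
  set J : ℝ → ℂ := fun φ => ∫ t in Ioi (0 : ℝ), kernelFun f w (t * unitVec φ) * unitVec φ with hJ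
  -- At s = 0 the ray contains the branch point and the contour argument fails. The integrals are
  -- constant for s > 0, and the value at s = 0 is obtained as a limit by dominated convergence.
  have hconst : ∀ s ∈ Ioc (0 : ℝ) 1, J (φ₀ + s * d) = J (Real.pi / 2) := by
    intro s hs
    refine integral_ray_eq_integral_ray hf hw0 hsin0 (fun φ hφ => (hpos s hs φ hφ).1) hd
      fun φ hφ t ht => ?_
    rw [← hwu]
    exact sub_ray_mem_slitPlane (hpos s hs φ hφ).2 ht
  have hmem : ∀ᶠ s in 𝓝[>] (0 : ℝ), s ∈ Ioc (0 : ℝ) 1 := Ioc_mem_nhdsGT zero_lt_one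
  have htend : Tendsto (fun s : ℝ => φ₀ + s * d) (𝓝[>] 0) (𝓝 φ₀) := by
    have : Tendsto (fun s : ℝ => φ₀ + s * d) (𝓝 0) (𝓝 (φ₀ + 0 * d)) := by
      apply Continuous.tendsto
      fun_prop
    rw [zero_mul, add_zero] at this
    exact this.mono_left nhdsWithin_le_nhds
  obtain ⟨C, c, hC, hc, hbd⟩ := norm_kernelFun_le hf hsin0 (w := w)
  have hlim : Tendsto (fun s : ℝ => J (φ₀ + s * d)) (𝓝[>] 0) (𝓝 (J φ₀)) := by
    refine tendsto_integral_filter_of_dominated_convergence (fun t => C * rayBound c r t) ?_ ?_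
      ((integrableOn_rayBound hc r).const_mul C) ?_
    · filter_upwards [hmem] with s hs
      refine (aestronglyMeasurable_kernelFun_ray hd w ?_).mul_const _
      rw [unitVec_im]
      exact hsin0.trans_le (hpos s hs _ left_mem_uIcc).1
    · filter_upwards [hmem] with s hs
      filter_upwards [ae_restrict_mem measurableSet_Ioi, ae_ne_restrict r] with t ht htw
      rw [norm_mul, norm_unitVec, mul_one]
      refine hbd _ (norm_unitVec _) ?_ t ht htw
      rw [unitVec_im]
      exact (hpos s hs _ left_mem_uIcc).1
    · filter_upwards [ae_restrict_mem measurableSet_Ioi, ae_ne_restrict r] with t ht htw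
      -- Away from w, the limit ray gives the root a non-real argument because Re w ≠ 0. So the
      -- principal branch is continuous there and needs no one-sided interpretation.
      have hslit : -I * (t * unitVec φ₀ - w) ∈ slitPlane := by
        rw [mem_slitPlane_iff]
        right
        have : (-I * (t * unitVec φ₀ - w)).im = -((t - r) * Real.cos φ₀) := by
          rw [← hwu]
          simp [unitVec_re]
          ring
        rw [this]
        exact neg_ne_zero.mpr (mul_ne_zero (sub_ne_zero.mpr htw) hcos0)
      have hk : ContinuousAt (kernelFun f w) (t * unitVec φ₀) := by
        refine (differentiableAt_kernelFun (hd _ ?_) hslit).continuousAt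
        rw [im_ofReal_mul, unitVec_im]
        exact mul_pos ht hsin0
      have hk2 : ContinuousAt (fun φ : ℝ => kernelFun f w (t * unitVec φ) * unitVec φ) φ₀ :=
        (ContinuousAt.comp (f := fun φ : ℝ => (t : ℂ) * unitVec φ) hk
          (continuous_const.mul continuous_unitVec).continuousAt).mul
          continuous_unitVec.continuousAt
      exact hk2.tendsto.comp htend
  have heq : J φ₀ = J (Real.pi / 2) := by
    refine tendsto_nhds_unique hlim (tendsto_const_nhds.congr' ?_)
    filter_upwards [hmem] with s hs using (hconst s hs).symm
  have hI : unitVec (Real.pi / 2) = I := by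
    rw [unitVec]; push_cast; exact exp_pi_div_two_mul_I
  have hleft : J (Real.pi / 2) = ∫ y in Ioi (0 : ℝ), kernelFun f w (I * y) * I := by
    rw [hJ]
    simp only [hI]
    simp_rw [mul_comm I]
  rw [← hleft, ← heq]
  simp only [hJ]
  have hscale := integral_comp_mul_left_Ioi'
    (fun t : ℝ => kernelFun f w (t * unitVec φ₀) * unitVec φ₀) 0 hr
  simp only [mul_zero] at hscale
  rw [← hscale, ← integral_smul]
  refine integral_congr_ae (ae_of_all _ fun t => ?_)
  simp only [real_smul]
  rw [show ((r * t : ℝ) : ℂ) * unitVec φ₀ = t * w by rw [← hwu]; push_cast; ring]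
  linear_combination kernelFun f w (t * w) * hwu

/-! ### The two halves of the rotated integral -/

theorem neg_I_mul_mem_slitPlane {z : ℂ} (hz : 0 < z.im) : -I * z ∈ slitPlane := by
  rw [mem_slitPlane_iff]
  left
  simpa using hz

theorem csqrt_ne_zero {z : ℂ} (hz : z ≠ 0) : csqrt z ≠ 0 := fun h => hz (by
  rw [← csqrt_sq z, h]; norm_num)

theorem hasDerivAt_csqrt {z : ℂ} (hz : z ∈ slitPlane) :
    HasDerivAt csqrt (csqrt z / (2 * z)) z := by
  have hz0 := slitPlane_ne_zero hz
  refine ((hasDerivAt_id z).cpow_const (c := 1 / 2) hz).congr_deriv ?_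
  rw [id, cpow_sub _ _ hz0, cpow_one, csqrt]
  field_simp

theorem hasDerivAt_inv_csqrt_neg_I_mul {z : ℂ} (hz : 0 < z.im) :
    HasDerivAt (fun z => (csqrt (-I * z))⁻¹) (-(1 / 2) * z⁻¹ * (csqrt (-I * z))⁻¹) z := by
  have hs := neg_I_mul_mem_slitPlane hz
  have hz0 := ne_zero_of_im_pos hz
  have hc := csqrt_ne_zero (slitPlane_ne_zero hs)
  have h1 : HasDerivAt (fun z : ℂ => -I * z) (-I) z := by
    simpa using (hasDerivAt_id z).const_mul (-I)
  refine (((hasDerivAt_csqrt hs).comp z h1).inv hc).congr_deriv ?_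
  simp only [Function.comp]
  field_simp

theorem hasDerivAt_neg_one_div {z : ℂ} (hz : z ≠ 0) :
    HasDerivAt (fun z : ℂ => -1 / z) (z⁻¹ ^ 2) z := by
  refine ((hasDerivAt_inv hz).const_mul (-1)).congr_deriv (by rw [inv_pow]; ring)
    |>.congr_of_eventuallyEq ?_
  exact Eventually.of_forall fun z => by simp only [div_eq_mul_inv]

/-- Differentiate the transformation law for K = 0. The derivative of the factor (-iz)^{-1/2}
creates the term with K = 0 on the right. -/
theorem IsThetaPair.trans_two {N : ℕ} (hN : 0 < N) {b b' : ℤ → ℂ} (h : IsThetaPair N b b')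
    {z : ℂ} (hz : 0 < z.im) : twistTheta N b 2 z =
      ((Real.sqrt N : ℂ))⁻¹ * (csqrt (-I * z))⁻¹ *
        (-(N / (2 * Real.pi * I)) * z⁻¹ * twistTheta N b' 0 (-1 / z) +
          z⁻¹ ^ 2 * twistTheta N b' 2 (-1 / z)) := by
  obtain ⟨B, hB⟩ := h.bdd
  obtain ⟨B', hB'⟩ := h.bdd'
  have hz0 := ne_zero_of_im_pos hz
  have hN' : (N : ℂ) ≠ 0 := Nat.cast_ne_zero.mpr hN.ne'
  have hpi : (Real.pi : ℂ) ≠ 0 := ofReal_ne_zero.mpr Real.pi_ne_zero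
  have h1 := hasDerivAt_twistTheta hN hB 0 hz
  have h2 := ((hasDerivAt_inv_csqrt_neg_I_mul hz).const_mul ((Real.sqrt N : ℂ))⁻¹).mul
    ((hasDerivAt_twistTheta hN hB' 0 (neg_one_div_im_pos hz)).comp z (hasDerivAt_neg_one_div hz0))
  have h3 := h1.unique (h2.congr_of_eventuallyEq (by
    filter_upwards [(isOpen_lt continuous_const continuous_im).mem_nhds hz] with x hx
    exact h.trans_zero x hx))
  simp only [Function.comp, zero_add] at h3
  have h4 : twistTheta N b 2 z = N / (Real.pi * I) *
      (Real.pi * I / N * twistTheta N b 2 z) := by field_simp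
  rw [h4, h3]
  field_simp

/-- The Abel type integral `∫₀^∞ v ^ (-1/2) f(z (1 + v)) dv`. -/
def abelIntegral (f : ℂ → ℂ) (z : ℂ) : ℂ :=
  ∫ v in Ioi (0 : ℝ), ((Real.sqrt v)⁻¹ : ℂ) * f (z * (1 + v))

theorem integrableOn_kernelFun_ray_self {f : ℂ → ℂ} (hf : ConeDecay f)
    (hd : ∀ z : ℂ, 0 < z.im → DifferentiableAt ℂ f z) {w : ℂ} (hw : 0 < w.im) :
    IntegrableOn (fun t : ℝ => kernelFun f w (t * w)) (Ioi 0) := by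
  have hr : 0 < ‖w‖ := norm_pos_iff.mpr (ne_zero_of_im_pos hw)
  have hr' : (‖w‖ : ℂ) ≠ 0 := ofReal_ne_zero.mpr hr.ne'
  have h := integrableOn_kernelFun_ray hf hd w (u := ((‖w‖⁻¹ : ℝ) : ℂ) * w) (by
    rw [norm_mul, Complex.norm_real, norm_inv, norm_norm, inv_mul_cancel₀ hr.ne'])
    (by rw [im_ofReal_mul]; positivity)
  have h2 := (integrableOn_Ioi_comp_mul_left_iff _ 0 hr).mpr (by rw [mul_zero]; exact h)
  refine h2.congr_fun (fun t _ => ?_) measurableSet_Ioi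
  simp only
  congr 1
  push_cast
  field_simp

/-- Substitute t = 1 + v: then -i(tw - w) = v(-iw), and the positive factor v leaves the root. -/
theorem integral_upper_ray (f : ℂ → ℂ) (w : ℂ) :
    ∫ t in Ioi (1 : ℝ), kernelFun f w (t * w) * w = w / csqrt (-I * w) * abelIntegral f w := by
  have h1 := integral_image_eq_integral_abs_deriv_smul (s := Ioi (0 : ℝ)) measurableSet_Ioi
    (f := fun v : ℝ => 1 + v) (f' := fun _ => 1)
    (fun x _ => ((hasDerivAt_id x).const_add 1).hasDerivWithinAt)
    (fun x _ y _ hxy => add_left_cancel hxy) (fun t : ℝ => kernelFun f w (t * w) * w)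
  rw [image_const_add_Ioi, add_zero] at h1
  rw [h1, abelIntegral, ← integral_const_mul]
  refine setIntegral_congr_fun measurableSet_Ioi fun v hv => ?_
  simp only [abs_one, one_smul, kernelFun]
  rw [show -I * (((1 + v : ℝ) : ℂ) * w - w) = (v : ℂ) * (-I * w) by push_cast; ring,
    csqrt_ofReal_mul hv, show ((1 + v : ℝ) : ℂ) * w = w * (1 + v) by push_cast; ring]
  rw [div_eq_mul_inv, div_eq_mul_inv, mul_inv]
  ring

theorem image_inv_one_add_Ioi :
    (fun v : ℝ => (1 + v)⁻¹) '' Ioi 0 = Ioo 0 1 := by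
  ext t
  simp only [mem_image, mem_Ioi, mem_Ioo]
  constructor
  · rintro ⟨v, hv, rfl⟩
    exact ⟨by positivity, inv_lt_one_of_one_lt₀ (by linarith)⟩
  · rintro ⟨h0, h1⟩
    exact ⟨t⁻¹ - 1, by linarith [(one_lt_inv₀ h0).mpr h1], by simp⟩

/-- Substitute t = 1/(1+v), chosen so that inversion will turn f(w/(1+v)) into a value at
(-1/w)(1+v). Now -i(tw - w) is a positive multiple of +iw, which is why a different root appears
than beyond w. -/
theorem integral_lower_ray (f : ℂ → ℂ) (w : ℂ) :
    ∫ t in Ioo (0 : ℝ) 1, kernelFun f w (t * w) * w = w / csqrt (I * w) *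
      ∫ v in Ioi (0 : ℝ), ((Real.sqrt v)⁻¹ : ℂ) *
        ((((1 + v) ^ 2)⁻¹ * Real.sqrt (1 + v) : ℝ) * f (w * (1 + v)⁻¹)) := by
  have h1 := integral_image_eq_integral_abs_deriv_smul (s := Ioi (0 : ℝ)) measurableSet_Ioi
    (f := fun v : ℝ => (1 + v)⁻¹) (f' := fun v => -1 / (1 + v) ^ 2)
    (fun x hx => (((hasDerivAt_id x).const_add 1).inv (by
      have : 0 < x := hx
      simp only [id]
      positivity)).hasDerivWithinAt)
    (fun x _ y _ hxy => add_left_cancel (inv_injective hxy)) (fun t : ℝ => kernelFun f w (t * w) * w)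
  rw [image_inv_one_add_Ioi] at h1
  rw [h1, ← integral_const_mul]
  refine setIntegral_congr_fun measurableSet_Ioi fun v hv => ?_
  have hv0 : 0 < v := hv
  have h1v : (0 : ℝ) < 1 + v := by positivity
  have h1v' : ((1 + v : ℝ) : ℂ) ≠ 0 := ofReal_ne_zero.mpr h1v.ne'
  have hs : ((Real.sqrt (1 + v) : ℝ) : ℂ) ≠ 0 := ofReal_ne_zero.mpr (Real.sqrt_pos.mpr h1v).ne'
  simp only [kernelFun]
  have e1 : -I * ((((1 + v)⁻¹ : ℝ) : ℂ) * w - w) = ((v / (1 + v) : ℝ) : ℂ) * (I * w) := by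
    push_cast at h1v' ⊢
    field_simp
    ring
  rw [e1, csqrt_ofReal_mul (div_pos hv0 h1v), Real.sqrt_div hv0.le,
    show |-1 / (1 + v) ^ 2| = ((1 + v) ^ 2)⁻¹ by
      rw [abs_div, abs_neg, abs_one, one_div, abs_of_pos (by positivity)], real_smul,
    show (((1 + v)⁻¹ : ℝ) : ℂ) * w = w * (1 + v)⁻¹ by push_cast; ring]
  push_cast
  rw [div_eq_mul_inv, div_eq_mul_inv, div_eq_mul_inv, mul_inv, mul_inv, inv_inv]
  ring

section

theorem csqrt_neg_I_mul_mul_inv {w : ℂ} {x : ℝ} (hx : 0 < x) :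
    (csqrt (-I * (w * (x : ℂ)⁻¹)))⁻¹ = Real.sqrt x * (csqrt (-I * w))⁻¹ := by
  rw [show -I * (w * (x : ℂ)⁻¹) = ((x⁻¹ : ℝ) : ℂ) * (-I * w) by push_cast; ring,
    csqrt_ofReal_mul (inv_pos.mpr hx), Real.sqrt_inv, mul_inv, ofReal_inv, inv_inv]

theorem mul_ofReal_im_pos {z : ℂ} (hz : 0 < z.im) {x : ℝ} (hx : 0 < x) : 0 < (z * x).im := by
  rw [im_mul_ofReal]; exact mul_pos hz hx

variable {N : ℕ} {b b' : ℤ → ℂ}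

/-- The transformation has weight 3/2, so it yields (1+v)^{3/2}, exactly cancelling the weight
(1+v)^{-3/2} left by the substitution. -/
theorem integral_lower_ray_one (h : IsThetaPair N b b') {w : ℂ} (hw : 0 < w.im) :
    ∫ t in Ioo (0 : ℝ) 1, kernelFun (twistTheta N b 1) w (t * w) * w =
      w / csqrt (I * w) * (((Real.sqrt N : ℂ))⁻¹ * (csqrt (-I * w))⁻¹ * w⁻¹ ^ 1 *
        abelIntegral (twistTheta N b' 1) (-1 / w)) := by
  have hw0 := ne_zero_of_im_pos hw
  rw [integral_lower_ray, abelIntegral]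
  congr 1
  rw [← integral_const_mul]
  refine setIntegral_congr_fun measurableSet_Ioi fun v hv => ?_
  have h1v : (0 : ℝ) < 1 + v := by have : 0 < v := hv; positivity
  have h1v' : ((1 + v : ℝ) : ℂ) ≠ 0 := ofReal_ne_zero.mpr h1v.ne'
  have him : 0 < (w * ((1 + v : ℝ) : ℂ)⁻¹).im := by
    rw [← ofReal_inv]; exact mul_ofReal_im_pos hw (inv_pos.mpr h1v)
  have hs : ((Real.sqrt (1 + v) : ℝ) : ℂ) * (Real.sqrt (1 + v) : ℝ) = (1 + v : ℝ) := by
    rw [← ofReal_mul, Real.mul_self_sqrt h1v.le]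
  have ht := h.trans_one _ him
  rw [csqrt_neg_I_mul_mul_inv h1v, show -1 / (w * ((1 + v : ℝ) : ℂ)⁻¹) = -1 / w * (1 + v : ℝ) by
    field_simp, mul_inv, inv_inv] at ht
  push_cast at ht h1v' hs ⊢
  rw [ht]
  generalize twistTheta N b' 1 (-1 / w * (1 + v)) = T
  generalize (csqrt (-I * w))⁻¹ = X
  have : ((1 + v : ℂ) ^ 2)⁻¹ * (Real.sqrt (1 + v) : ℂ) * ((Real.sqrt (1 + v) : ℂ) * (1 + v)) = 1 := by
    field_simp
    linear_combination hs
  linear_combination ((Real.sqrt v : ℂ))⁻¹ * ((Real.sqrt N : ℂ))⁻¹ * X * w⁻¹ * T * this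

theorem exists_norm_twistTheta_ray_le (hN : 0 < N) {B : ℝ} (hb : ∀ m, ‖b m‖ ≤ B) (h0 : b 0 = 0)
    (K : ℕ) {z : ℂ} (hz : 0 < z.im) : ∃ C c : ℝ, 0 < C ∧ 0 < c ∧ ∀ v : ℝ, 0 ≤ v →
      ‖twistTheta N b K (z * (1 + v))‖ ≤ C * Real.exp (-c * v) := by
  obtain ⟨C, c, hC, hc, h⟩ := exists_norm_twistTheta_le hN hb h0 K hz
  refine ⟨C, c * z.im, hC, mul_pos hc hz, fun v hv => ?_⟩
  have him : (z * (1 + v)).im = z.im * (1 + v) := by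
    rw [← ofReal_one, ← ofReal_add, im_mul_ofReal]
  have hv' : 0 ≤ z.im * v := mul_nonneg hz.le hv
  refine (h _ (by rw [him]; linarith)).trans
    (mul_le_mul_of_nonneg_left (Real.exp_le_exp.mpr ?_) hC.le)
  rw [him]
  nlinarith [mul_pos hc hz]

theorem hasDerivAt_twistTheta_ray (hN : 0 < N) {B : ℝ} (hb : ∀ m, ‖b m‖ ≤ B) (K : ℕ) {z : ℂ}
    (hz : 0 < z.im) {v : ℝ} (hv : 0 ≤ v) : HasDerivAt (fun v : ℝ => twistTheta N b K (z * (1 + v)))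
      (Real.pi * I / N * twistTheta N b (K + 2) (z * (1 + v)) * z) v := by
  have him : 0 < (z * (1 + v)).im := by
    rw [← ofReal_one, ← ofReal_add]; exact mul_ofReal_im_pos hz (by positivity)
  have h1 : HasDerivAt (fun v : ℝ => z * (1 + (v : ℂ))) z v := by
    simpa using ((hasDerivAt_id v).ofReal_comp.const_add 1).const_mul z
  exact (hasDerivAt_twistTheta hN hb K him).comp v h1

theorem integrableOn_rpow_mul_twistTheta_ray (hN : 0 < N) {B : ℝ} (hb : ∀ m, ‖b m‖ ≤ B)
    (h0 : b 0 = 0) (K : ℕ) {z : ℂ} (hz : 0 < z.im) {s : ℝ} (hs : -1 < s) :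
    IntegrableOn (fun v : ℝ => ((v ^ s : ℝ) : ℂ) * twistTheta N b K (z * (1 + v))) (Ioi 0) := by
  obtain ⟨C, c, hC, hc, h⟩ := exists_norm_twistTheta_ray_le hN hb h0 K hz
  have h1 := (integrableOn_rpow_mul_exp_neg_mul_rpow hs zero_lt_one hc).const_mul C
  refine h1.mono' (AEStronglyMeasurable.mul (Measurable.aestronglyMeasurable (by fun_prop))
    (ContinuousOn.aestronglyMeasurable (fun v hv =>
      (hasDerivAt_twistTheta_ray hN hb K hz (le_of_lt hv)).continuousAt.continuousWithinAt)
      measurableSet_Ioi)) ?_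
  filter_upwards [ae_restrict_mem measurableSet_Ioi] with v hv
  have hv0 : 0 < v := hv
  rw [norm_mul, Complex.norm_real, Real.norm_of_nonneg (Real.rpow_nonneg hv0.le _), Real.rpow_one,
    mul_left_comm]
  exact mul_le_mul_of_nonneg_left (h v hv0.le) (Real.rpow_nonneg hv0.le _)

theorem integrableOn_inv_sqrt_mul_twistTheta_ray (hN : 0 < N) {B : ℝ} (hb : ∀ m, ‖b m‖ ≤ B)
    (h0 : b 0 = 0) (K : ℕ) {z : ℂ} (hz : 0 < z.im) :
    IntegrableOn (fun v : ℝ => ((Real.sqrt v)⁻¹ : ℂ) * twistTheta N b K (z * (1 + v))) (Ioi 0) := by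
  refine (integrableOn_rpow_mul_twistTheta_ray hN hb h0 K hz (s := -(1 / 2)) (by norm_num)).congr_fun
    (fun v hv => ?_) measurableSet_Ioi
  simp only
  rw [Real.rpow_neg (le_of_lt hv), ← Real.sqrt_eq_rpow, ofReal_inv]

theorem integrableOn_sqrt_mul_twistTheta_ray (hN : 0 < N) {B : ℝ} (hb : ∀ m, ‖b m‖ ≤ B)
    (h0 : b 0 = 0) (K : ℕ) {z : ℂ} (hz : 0 < z.im) :
    IntegrableOn (fun v : ℝ => (Real.sqrt v : ℂ) * twistTheta N b K (z * (1 + v))) (Ioi 0) := by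
  refine (integrableOn_rpow_mul_twistTheta_ray hN hb h0 K hz (s := 1 / 2) (by norm_num)).congr_fun
    (fun v _ => ?_) measurableSet_Ioi
  simp only
  rw [← Real.sqrt_eq_rpow]

/-- The integral of the derivative of √v θ(z(1+v)): the boundary terms vanish at 0 through √v and at
∞ through decay. -/
theorem integral_sqrt_mul_twistTheta_ray (hN : 0 < N) {B : ℝ} (hb : ∀ m, ‖b m‖ ≤ B)
    (h0 : b 0 = 0) (K : ℕ) {z : ℂ} (hz : 0 < z.im) :
    1 / 2 * abelIntegral (twistTheta N b K) z + Real.pi * I / N * z *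
      ∫ v in Ioi (0 : ℝ), (Real.sqrt v : ℂ) * twistTheta N b (K + 2) (z * (1 + v)) = 0 := by
  have hi1 := (integrableOn_inv_sqrt_mul_twistTheta_ray hN hb h0 K hz).const_mul (1 / 2)
  have hi2 := (integrableOn_sqrt_mul_twistTheta_ray hN hb h0 (K + 2) hz).const_mul
    (Real.pi * I / N * z)
  have hderiv : ∀ v ∈ Ioi (0 : ℝ), HasDerivAt
      (fun v : ℝ => (Real.sqrt v : ℂ) * twistTheta N b K (z * (1 + v)))
      (1 / 2 * (((Real.sqrt v)⁻¹ : ℂ) * twistTheta N b K (z * (1 + v))) + Real.pi * I / N * z *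
        ((Real.sqrt v : ℂ) * twistTheta N b (K + 2) (z * (1 + v)))) v := by
    intro v hv
    have hv0 : 0 < v := hv
    refine (((Real.hasDerivAt_sqrt hv0.ne').ofReal_comp).mul
      (hasDerivAt_twistTheta_ray hN hb K hz hv0.le)).congr_deriv ?_
    push_cast
    rw [one_div, mul_inv]
    ring
  have hcont : ContinuousWithinAt (fun v : ℝ => (Real.sqrt v : ℂ) * twistTheta N b K (z * (1 + v)))
      (Ici 0) 0 := by
    refine ContinuousAt.continuousWithinAt (ContinuousAt.mul ?_
      (hasDerivAt_twistTheta_ray hN hb K hz le_rfl).continuousAt)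
    fun_prop
  have hint := hi1.add hi2
  have hlim := tendsto_zero_of_hasDerivAt_of_integrableOn_Ioi hderiv hint
    (integrableOn_sqrt_mul_twistTheta_ray hN hb h0 K hz)
  have hftc := integral_Ioi_of_hasDerivAt_of_tendsto hcont hderiv hint hlim
  rw [integral_add hi1 hi2, integral_const_mul, integral_const_mul] at hftc
  rw [abelIntegral, hftc]
  simp

/-- For K = 2 the law has an extra term with K = 0, and the main term keeps a surplus factor 1+v.
Splitting (1+v)/√v = 1/√v + √v, the √v part is an integration by parts that cancels the extra term,
so the answer has the same shape as for K = 1. -/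
theorem integral_lower_ray_two (hN : 0 < N) (h : IsThetaPair N b b') {w : ℂ} (hw : 0 < w.im) :
    ∫ t in Ioo (0 : ℝ) 1, kernelFun (twistTheta N b 2) w (t * w) * w =
      w / csqrt (I * w) * (((Real.sqrt N : ℂ))⁻¹ * (csqrt (-I * w))⁻¹ * w⁻¹ ^ 2 *
        abelIntegral (twistTheta N b' 2) (-1 / w)) := by
  obtain ⟨B', hB'⟩ := h.bdd'
  have hw0 := ne_zero_of_im_pos hw
  have hτ := neg_one_div_im_pos hw
  have hN' : (N : ℂ) ≠ 0 := Nat.cast_ne_zero.mpr hN.ne'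
  have hpi : (Real.pi : ℂ) ≠ 0 := ofReal_ne_zero.mpr Real.pi_ne_zero
  rw [integral_lower_ray]
  congr 1
  have hi0 := (integrableOn_inv_sqrt_mul_twistTheta_ray hN hB' h.zero' 0 hτ).const_mul
    (-(N / (2 * Real.pi * I)) * w⁻¹)
  have hi1 := (integrableOn_inv_sqrt_mul_twistTheta_ray hN hB' h.zero' 2 hτ).const_mul (w⁻¹ ^ 2)
  have hi2 := (integrableOn_sqrt_mul_twistTheta_ray hN hB' h.zero' 2 hτ).const_mul (w⁻¹ ^ 2)
  have hftc := integral_sqrt_mul_twistTheta_ray hN hB' h.zero' 0 hτ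
  have hval : ∫ v in Ioi (0 : ℝ), ((Real.sqrt v)⁻¹ : ℂ) *
        ((((1 + v) ^ 2)⁻¹ * Real.sqrt (1 + v) : ℝ) * twistTheta N b 2 (w * (1 + v)⁻¹)) =
      ∫ v in Ioi (0 : ℝ), ((Real.sqrt N : ℂ))⁻¹ * (csqrt (-I * w))⁻¹ *
        (-(N / (2 * Real.pi * I)) * w⁻¹ *
            (((Real.sqrt v)⁻¹ : ℂ) * twistTheta N b' 0 (-1 / w * (1 + v))) +
          w⁻¹ ^ 2 * (((Real.sqrt v)⁻¹ : ℂ) * twistTheta N b' 2 (-1 / w * (1 + v))) +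
          w⁻¹ ^ 2 * ((Real.sqrt v : ℂ) * twistTheta N b' 2 (-1 / w * (1 + v)))) := by
    refine setIntegral_congr_fun measurableSet_Ioi fun v hv => ?_
    have hv0 : 0 < v := hv
    have h1v : (0 : ℝ) < 1 + v := by positivity
    have h1v' : ((1 + v : ℝ) : ℂ) ≠ 0 := ofReal_ne_zero.mpr h1v.ne'
    have him : 0 < (w * ((1 + v : ℝ) : ℂ)⁻¹).im := by
      rw [← ofReal_inv]; exact mul_ofReal_im_pos hw (inv_pos.mpr h1v)
    have hs : ((Real.sqrt (1 + v) : ℝ) : ℂ) * (Real.sqrt (1 + v) : ℝ) = (1 + v : ℝ) := by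
      rw [← ofReal_mul, Real.mul_self_sqrt h1v.le]
    have hsv : ((Real.sqrt v : ℝ) : ℂ) * (Real.sqrt v : ℝ) = v := by
      rw [← ofReal_mul, Real.mul_self_sqrt hv0.le]
    have hsv0 : ((Real.sqrt v : ℝ) : ℂ) ≠ 0 := ofReal_ne_zero.mpr (Real.sqrt_pos.mpr hv0).ne'
    have ht := h.trans_two hN him
    rw [csqrt_neg_I_mul_mul_inv h1v, show -1 / (w * ((1 + v : ℝ) : ℂ)⁻¹) = -1 / w * (1 + v : ℝ) by
      field_simp, mul_inv, inv_inv] at ht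
    push_cast at ht h1v' hs ⊢
    rw [ht]
    generalize twistTheta N b' 0 (-1 / w * (1 + v)) = T
    generalize twistTheta N b' 2 (-1 / w * (1 + v)) = T₂
    generalize (csqrt (-I * w))⁻¹ = X
    have e1 : ((1 + v : ℂ) ^ 2)⁻¹ * (Real.sqrt (1 + v) : ℂ) *
        ((Real.sqrt (1 + v) : ℂ) * (1 + v)) = 1 := by
      field_simp
      linear_combination hs
    have e2 : ((Real.sqrt v : ℂ))⁻¹ * (1 + v) = ((Real.sqrt v : ℂ))⁻¹ + Real.sqrt v := by
      field_simp
      linear_combination -hsv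
    linear_combination ((Real.sqrt v : ℂ))⁻¹ * ((Real.sqrt N : ℂ))⁻¹ * X *
        (-(N / (2 * Real.pi * I)) * w⁻¹ * T + w⁻¹ ^ 2 * (1 + v) * T₂) * e1 +
      ((Real.sqrt N : ℂ))⁻¹ * X * w⁻¹ ^ 2 * T₂ * e2
  have hsum := integral_add (hi0.add hi1) hi2
  simp only [Pi.add_apply] at hsum
  rw [hval, integral_const_mul, hsum, integral_add hi0 hi1, integral_const_mul, integral_const_mul,
    integral_const_mul]
  change _ * (_ * _ * abelIntegral (twistTheta N b' 0) (-1 / w) +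
    _ * abelIntegral (twistTheta N b' 2) (-1 / w) + _) = _
  rw [zero_add] at hftc
  generalize abelIntegral (twistTheta N b' 0) (-1 / w) = A at hftc ⊢
  generalize (∫ v in Ioi (0 : ℝ), (Real.sqrt v : ℂ) * twistTheta N b' 2 (-1 / w * (1 + v))) = S
    at hftc ⊢
  have e : w⁻¹ ^ 2 * S = N / (2 * Real.pi * I) * w⁻¹ * A := by
    calc w⁻¹ ^ 2 * S = N / (2 * Real.pi * I) * w⁻¹ * A - N / (Real.pi * I) * w⁻¹ *
          (1 / 2 * A + Real.pi * I / N * (-1 / w) * S) := by field_simp; ring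
      _ = _ := by rw [hftc]; ring
  rw [e]
  ring

theorem integral_imAxis_kernelFun (hN : 0 < N) (h : IsThetaPair N b b') {K : ℕ}
    (hK : K = 1 ∨ K = 2) {w : ℂ} (hw : 0 < w.im) (hre : w.re ≠ 0) :
    ∫ y in Ioi (0 : ℝ), kernelFun (twistTheta N b K) w (I * y) * I =
      w / csqrt (-I * w) * abelIntegral (twistTheta N b K) w +
      w / csqrt (I * w) * (((Real.sqrt N : ℂ))⁻¹ * (csqrt (-I * w))⁻¹ * w⁻¹ ^ K *
        abelIntegral (twistTheta N b' K) (-1 / w)) := by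
  obtain ⟨B, hB⟩ := h.bdd
  have hdec := h.coneDecay hN K
  have hdiff : ∀ z : ℂ, 0 < z.im → DifferentiableAt ℂ (twistTheta N b K) z :=
    fun z hz => (hasDerivAt_twistTheta hN hB K hz).differentiableAt
  have hint : IntegrableOn (fun t : ℝ => kernelFun (twistTheta N b K) w (t * w) * w) (Ioi 0) :=
    (integrableOn_kernelFun_ray_self hdec hdiff hw).mul_const w
  rw [integral_imAxis_eq_integral_ray hdec hdiff hw hre,
    ← Ioc_union_Ioi_eq_Ioi (zero_le_one' ℝ),
    setIntegral_union Ioc_disjoint_Ioi_same measurableSet_Ioi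
      (hint.mono_set Ioc_subset_Ioi_self) (hint.mono_set (Ioi_subset_Ioi zero_le_one)),
    integral_Ioc_eq_integral_Ioo, integral_upper_ray, add_comm]
  congr 1
  rcases hK with rfl | rfl
  · exact integral_lower_ray_one h hw
  · exact integral_lower_ray_two hN h hw

end

section

/-! ### False theta series -/

/-- The coefficients `sgn(m) b(m)`. -/
def signTwist (b : ℤ → ℂ) (m : ℤ) : ℂ := b m * (m.sign : ℂ)

theorem norm_signTwist_le {b : ℤ → ℂ} {B : ℝ} (hb : ∀ m, ‖b m‖ ≤ B) (m : ℤ) :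
    ‖signTwist b m‖ ≤ B := by
  rw [signTwist, norm_mul]
  refine (mul_le_of_le_one_right (norm_nonneg _) ?_).trans (hb m)
  rcases lt_trichotomy m 0 with h | rfl | h
  · simp [Int.sign_eq_neg_one_of_neg h]
  · simp
  · simp [Int.sign_eq_one_of_pos h]

theorem csqrt_inv {z : ℂ} (hz : z ∈ slitPlane) : csqrt z⁻¹ = (csqrt z)⁻¹ :=
  inv_cpow _ _ (slitPlane_arg_ne_pi hz)

theorem integral_inv_sqrt_mul_exp {a : ℂ} (ha : 0 < a.re) :
    ∫ v in Ioi (0 : ℝ), ((Real.sqrt v)⁻¹ : ℂ) * cexp (-a * v) = csqrt (Real.pi / a) := by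
  have h := integral_comp_rpow_Ioi_of_pos
    (g := fun v : ℝ => ((Real.sqrt v)⁻¹ : ℂ) * cexp (-a * v)) zero_lt_two
  rw [← h, csqrt]
  have h2 := integral_gaussian_complex_Ioi ha
  rw [show (Real.pi / a : ℂ) ^ (1 / 2 : ℂ) = 2 * ((Real.pi / a : ℂ) ^ (1 / 2 : ℂ) / 2) by ring,
    ← h2, ← integral_const_mul]
  refine setIntegral_congr_fun measurableSet_Ioi fun x hx => ?_
  have hx0 : 0 < x := hx
  have hx' : (x : ℂ) ≠ 0 := ofReal_ne_zero.mpr hx0.ne'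
  simp only [Real.rpow_two, Real.sqrt_sq hx0.le, real_smul]
  norm_num
  field_simp

variable {N : ℕ} {b b' : ℤ → ℂ}

theorem twistTerm_ray (K : ℕ) (z : ℂ) (v : ℝ) (m : ℤ) :
    twistTerm N b K (z * (1 + v)) m =
      twistTerm N b K z m * cexp (-(-(Real.pi * I * (m : ℂ) ^ 2 / N * z)) * v) := by
  rw [twistTerm, twistTerm, mul_assoc _ (cexp _) (cexp _), ← Complex.exp_add]
  ring_nf

/-- The integral in v is a Gamma integral proportional to 1/|m|. It lowers the power of m by one and
leaves the sign m/|m|; this is how false theta series arise from theta series. -/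
theorem integral_inv_sqrt_mul_twistTerm (hN : 0 < N) (K : ℕ) {z : ℂ} (hz : 0 < z.im) (m : ℤ) :
    ∫ v in Ioi (0 : ℝ), ((Real.sqrt v)⁻¹ : ℂ) * twistTerm N b (K + 1) (z * (1 + v)) m =
      (Real.sqrt N : ℂ) * (csqrt (-I * z))⁻¹ * twistTerm N (signTwist b) K z m := by
  rcases eq_or_ne m 0 with rfl | hm
  · simp [twistTerm, signTwist]
  have hN' : (0 : ℝ) < N := Nat.cast_pos.mpr hN
  have hNc : (N : ℂ) ≠ 0 := Nat.cast_ne_zero.mpr hN.ne'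
  have hmc : (m : ℂ) ≠ 0 := Int.cast_ne_zero.mpr hm
  have hmr : (m : ℝ) ≠ 0 := Int.cast_ne_zero.mpr hm
  have hz0 := ne_zero_of_im_pos hz
  have hpi : (Real.pi : ℂ) ≠ 0 := ofReal_ne_zero.mpr Real.pi_ne_zero
  have ha : 0 < (-(Real.pi * I * (m : ℂ) ^ 2 / N * z)).re := by
    rw [show -(Real.pi * I * (m : ℂ) ^ 2 / N * z) =
      ((Real.pi * (m : ℝ) ^ 2 / N : ℝ) : ℂ) * (-I * z) by push_cast; ring, re_ofReal_mul]
    have : (-I * z).re = z.im := by simp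
    rw [this]
    positivity
  simp_rw [twistTerm_ray, mul_left_comm _ (twistTerm N b (K + 1) z m)]
  rw [integral_const_mul, integral_inv_sqrt_mul_exp ha,
    show (Real.pi / (-(Real.pi * I * (m : ℂ) ^ 2 / N * z)) : ℂ) =
      ((N / (m : ℝ) ^ 2 : ℝ) : ℂ) * (-I * z)⁻¹ by push_cast; field_simp,
    csqrt_ofReal_mul (by positivity), csqrt_inv (neg_I_mul_mem_slitPlane hz),
    Real.sqrt_div hN'.le, Real.sqrt_sq_eq_abs]
  have hs : (m : ℂ) * (((|(m : ℝ)| : ℝ) : ℂ))⁻¹ = (m.sign : ℂ) := by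
    rcases lt_or_gt_of_ne hm with h | h
    · rw [Int.sign_eq_neg_one_of_neg h, abs_of_neg (Int.cast_lt_zero.mpr h)]
      push_cast
      field_simp
    · rw [Int.sign_eq_one_of_pos h, abs_of_pos (Int.cast_pos.mpr h)]
      push_cast
      field_simp
  rw [twistTerm, twistTerm, signTwist, ← hs]
  push_cast
  ring

/-- Sum and integral are interchanged by dominated convergence. Since m² ≥ 1 for the nonzero terms,
the v-dependent exponential can be bounded independently of m, and the bound factors into a summable
sequence times an integrable function. -/
theorem abelIntegral_twistTheta (hN : 0 < N) {B : ℝ} (hb : ∀ m, ‖b m‖ ≤ B) (K : ℕ) {z : ℂ}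
    (hz : 0 < z.im) : abelIntegral (twistTheta N b (K + 1)) z =
      (Real.sqrt N : ℂ) * (csqrt (-I * z))⁻¹ * twistTheta N (signTwist b) K z := by
  have hN' : (0 : ℝ) < N := Nat.cast_pos.mpr hN
  have hB : 0 ≤ B := (norm_nonneg _).trans (hb 0)
  have hsum := summable_pow_mul_exp_sq (K + 1) (div_pos hz hN')
  have him : ∀ v : ℝ, 0 < v → 0 < (z * (1 + v)).im := fun v hv => by
    rw [← ofReal_one, ← ofReal_add]; exact mul_ofReal_im_pos hz (by positivity)
  have key := hasSum_integral_of_dominated_convergence (μ := volume.restrict (Ioi (0 : ℝ)))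
    (F := fun (m : ℤ) (v : ℝ) => ((Real.sqrt v)⁻¹ : ℂ) * twistTerm N b (K + 1) (z * (1 + v)) m)
    (f := fun v : ℝ => ((Real.sqrt v)⁻¹ : ℂ) * twistTheta N b (K + 1) (z * (1 + v)))
    (fun (m : ℤ) (v : ℝ) => B * (|(m : ℝ)| ^ (K + 1) *
      Real.exp (-Real.pi * (z.im / N) * (m : ℝ) ^ 2)) *
        (v ^ (-(1 / 2) : ℝ) * Real.exp (-(Real.pi * (z.im / N)) * v ^ (1 : ℝ)))) ?_ ?_ ?_ ?_ ?_
  · rw [abelIntegral, ← key.tsum_eq, twistTheta, ← tsum_mul_left]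
    exact tsum_congr fun m => integral_inv_sqrt_mul_twistTerm hN K hz m
  · intro m
    refine Measurable.aestronglyMeasurable ?_
    unfold twistTerm
    fun_prop
  · intro m
    filter_upwards [ae_restrict_mem measurableSet_Ioi] with v hv
    have hv0 : 0 < v := hv
    rcases eq_or_ne m 0 with rfl | hm
    · simp [twistTerm]
    have hm1 : (1 : ℝ) ≤ (m : ℝ) ^ 2 := by
      have : (1 : ℤ) ≤ m ^ 2 := by have := sq_pos_of_ne_zero hm; omega
      exact_mod_cast this
    rw [twistTerm_ray, norm_mul, norm_mul, mul_left_comm]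
    refine mul_le_mul (norm_twistTerm_le hb (K + 1) le_rfl m) ?_ (by positivity) (by positivity)
    rw [norm_inv, Complex.norm_real, Real.norm_of_nonneg (Real.sqrt_nonneg _),
      Real.rpow_neg hv0.le, ← Real.sqrt_eq_rpow, Real.rpow_one, neg_neg, mul_assoc,
      norm_exp_quadratic]
    refine mul_le_mul_of_nonneg_left (Real.exp_le_exp.mpr ?_) (by positivity)
    rw [im_mul_ofReal]
    have : Real.pi * (z.im / N) * v * 1 ≤ Real.pi * (z.im / N) * v * (m : ℝ) ^ 2 :=
      mul_le_mul_of_nonneg_left hm1 (by positivity)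
    have e : -Real.pi * (m : ℝ) ^ 2 / N * (z.im * v) =
      -(Real.pi * (z.im / N) * v * (m : ℝ) ^ 2) := by ring
    rw [e]
    linarith
  · exact ae_of_all _ fun v => (hsum.mul_left B).mul_right _
  · simp_rw [tsum_mul_right]
    exact (integrableOn_rpow_mul_exp_neg_mul_rpow (by norm_num) zero_lt_one
      (by positivity)).const_mul _
  · filter_upwards [ae_restrict_mem measurableSet_Ioi] with v hv
    exact ((summable_twistTerm hN hb (K + 1) (him v hv)).hasSum).mul_left _

end

/-! ### The Eichler integral as a function of the branch point -/

/-- The integral `∫₀^{i∞} f(z) / √(-i (z - w)) dz` along the imaginary axis. -/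
def eichlerIntegral (f : ℂ → ℂ) (w : ℂ) : ℂ := ∫ y in Ioi (0 : ℝ), kernelFun f w (I * y) * I

theorem I_mul_ofReal_im (y : ℝ) : (I * (y : ℂ)).im = y := by simp

theorem neg_I_mul_imAxis_sub (y : ℝ) (w : ℂ) : -I * (I * y - w) = y + I * w := by
  linear_combination -(y : ℂ) * I_mul_I

theorem imAxis_mem_slitPlane {w : ℂ} (hw : w.re ≠ 0) (y : ℝ) : (y : ℂ) + I * w ∈ slitPlane := by
  rw [mem_slitPlane_iff]
  right
  simpa using hw

theorem abs_re_le_norm_imAxis (y : ℝ) (w : ℂ) : |w.re| ≤ ‖(y : ℂ) + I * w‖ := by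
  have := abs_im_le_norm ((y : ℂ) + I * w)
  simpa using this

theorem norm_inv_csqrt_imAxis_le {w : ℂ} {ρ : ℝ} (hρ : 0 < ρ) (hw : ρ ≤ |w.re|) (y : ℝ) :
    ‖(csqrt ((y : ℂ) + I * w))⁻¹‖ ≤ (Real.sqrt ρ)⁻¹ := by
  rw [norm_inv, norm_csqrt]
  exact inv_anti₀ (Real.sqrt_pos.mpr hρ)
    (Real.sqrt_le_sqrt (hw.trans (abs_re_le_norm_imAxis y w)))

theorem norm_inv_imAxis_le {w : ℂ} {ρ : ℝ} (hρ : 0 < ρ) (hw : ρ ≤ |w.re|) (y : ℝ) :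
    ‖((y : ℂ) + I * w)⁻¹‖ ≤ ρ⁻¹ := by
  rw [norm_inv]
  exact inv_anti₀ hρ (hw.trans (abs_re_le_norm_imAxis y w))

theorem ConeDecay.exists_norm_imAxis_le {f : ℂ → ℂ} (hf : ConeDecay f) :
    ∃ C c : ℝ, 0 < C ∧ 0 < c ∧ ∀ y : ℝ, 0 < y → ‖f (I * y)‖ ≤ C * Real.exp (-c * (y + y⁻¹)) := by
  obtain ⟨C, c, hC, hc, h⟩ := hf 1 zero_lt_one
  refine ⟨C, c, hC, hc, fun y hy => ?_⟩
  have hn : ‖I * (y : ℂ)‖ = y := by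
    rw [norm_mul, norm_I, one_mul, Complex.norm_real, Real.norm_of_nonneg hy.le]
  have := h (I * y) (by rwa [I_mul_ofReal_im]) (by rw [I_mul_ofReal_im, hn, one_mul])
  rwa [hn] at this

theorem continuousOn_imAxis {f : ℂ → ℂ} (hd : ∀ z : ℂ, 0 < z.im → DifferentiableAt ℂ f z) :
    ContinuousOn (fun y : ℝ => f (I * y)) (Ioi 0) := by
  intro y hy
  have h1 : ContinuousAt f (I * y) := (hd _ (by rw [I_mul_ofReal_im]; exact hy)).continuousAt
  exact (ContinuousAt.comp (f := fun y : ℝ => I * (y : ℂ)) h1 (by fun_prop)).continuousWithinAt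

theorem ConeDecay.integrableOn_imAxis {f : ℂ → ℂ} (hf : ConeDecay f)
    (hd : ∀ z : ℂ, 0 < z.im → DifferentiableAt ℂ f z) :
    IntegrableOn (fun y : ℝ => f (I * y)) (Ioi 0) := by
  obtain ⟨C, c, hC, hc, h⟩ := hf.exists_norm_imAxis_le
  refine ((exp_neg_integrableOn_Ioi 0 hc).const_mul C).mono'
    ((continuousOn_imAxis hd).aestronglyMeasurable measurableSet_Ioi) ?_
  filter_upwards [ae_restrict_mem measurableSet_Ioi] with y hy
  have hy0 : 0 < y := hy
  refine (h y hy0).trans (mul_le_mul_of_nonneg_left (Real.exp_le_exp.mpr ?_) hC.le)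
  have : 0 < y⁻¹ := by positivity
  nlinarith

theorem ConeDecay.tendsto_imAxis_zero {f : ℂ → ℂ} (hf : ConeDecay f) :
    Tendsto (fun y : ℝ => f (I * y)) (𝓝[>] 0) (𝓝 0) := by
  obtain ⟨C, c, hC, hc, h⟩ := hf.exists_norm_imAxis_le
  refine squeeze_zero_norm' (a := fun y : ℝ => C * Real.exp (-(c * (y + y⁻¹)))) ?_ ?_
  · filter_upwards [self_mem_nhdsWithin] with y hy
    rw [← neg_mul]
    exact h y hy
  · have h1 : Tendsto (fun y : ℝ => y + y⁻¹) (𝓝[>] 0) atTop :=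
      tendsto_atTop_mono' _ (by
        filter_upwards [self_mem_nhdsWithin] with y hy
        exact le_add_of_nonneg_left (le_of_lt hy)) tendsto_inv_nhdsGT_zero
    have h2 := (Real.tendsto_exp_neg_atTop_nhds_zero.comp (h1.const_mul_atTop hc)).const_mul C
    simpa using h2

theorem ConeDecay.tendsto_imAxis_atTop {f : ℂ → ℂ} (hf : ConeDecay f) :
    Tendsto (fun y : ℝ => f (I * y)) atTop (𝓝 0) := by
  obtain ⟨C, c, hC, hc, h⟩ := hf.exists_norm_imAxis_le
  refine squeeze_zero_norm' (a := fun y : ℝ => C * Real.exp (-(c * (y + y⁻¹)))) ?_ ?_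
  · filter_upwards [eventually_gt_atTop 0] with y hy
    rw [← neg_mul]
    exact h y hy
  · have h1 : Tendsto (fun y : ℝ => y + y⁻¹) atTop atTop :=
      tendsto_atTop_mono' _ (by
        filter_upwards [eventually_gt_atTop 0] with y hy
        exact le_add_of_nonneg_right (by positivity)) tendsto_id
    have h2 := (Real.tendsto_exp_neg_atTop_nhds_zero.comp (h1.const_mul_atTop hc)).const_mul C
    simpa using h2

theorem kernelFun_imAxis (f : ℂ → ℂ) (w : ℂ) (y : ℝ) :
    kernelFun f w (I * y) = f (I * y) * (csqrt ((y : ℂ) + I * w))⁻¹ := by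
  rw [kernelFun, neg_I_mul_imAxis_sub, div_eq_mul_inv]

theorem hasDerivAt_inv_csqrt {u : ℂ} (hu : u ∈ slitPlane) :
    HasDerivAt (fun u => (csqrt u)⁻¹) (-(1 / 2) * u⁻¹ * (csqrt u)⁻¹) u := by
  have hu0 := slitPlane_ne_zero hu
  have hc := csqrt_ne_zero hu0
  refine ((hasDerivAt_csqrt hu).inv hc).congr_deriv ?_
  field_simp

theorem continuous_inv_csqrt_imAxis {w : ℂ} (hw : w.re ≠ 0) :
    Continuous fun y : ℝ => (csqrt ((y : ℂ) + I * w))⁻¹ := by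
  refine continuous_iff_continuousAt.mpr fun y => ?_
  exact ContinuousAt.comp (f := fun y : ℝ => (y : ℂ) + I * w)
    (hasDerivAt_inv_csqrt (imAxis_mem_slitPlane hw y)).continuousAt (by fun_prop)

theorem continuous_inv_imAxis {w : ℂ} (hw : w.re ≠ 0) :
    Continuous fun y : ℝ => ((y : ℂ) + I * w)⁻¹ :=
  Continuous.inv₀ (by fun_prop) fun y => slitPlane_ne_zero (imAxis_mem_slitPlane hw y)

theorem integrableOn_imAxis_kernelFun {f : ℂ → ℂ} (hf : ConeDecay f)
    (hd : ∀ z : ℂ, 0 < z.im → DifferentiableAt ℂ f z) {w : ℂ} (hw : w.re ≠ 0) :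
    IntegrableOn (fun y : ℝ => kernelFun f w (I * y)) (Ioi 0) := by
  simp_rw [kernelFun_imAxis]
  exact (hf.integrableOn_imAxis hd).mul_bdd (continuous_inv_csqrt_imAxis hw).aestronglyMeasurable
    (ae_of_all _ fun y => norm_inv_csqrt_imAxis_le (abs_pos.mpr hw) le_rfl y)

/-- Differentiation in `w` followed by partial integration. -/
theorem hasDerivAt_eichlerIntegral {f f' : ℂ → ℂ} (hf : ConeDecay f) (hf' : ConeDecay f')
    (hd : ∀ z : ℂ, 0 < z.im → HasDerivAt f (f' z) z)
    (hd' : ∀ z : ℂ, 0 < z.im → DifferentiableAt ℂ f' z) {w : ℂ} (hw : w.re ≠ 0) :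
    HasDerivAt (eichlerIntegral f) (eichlerIntegral f' w) w := by
  have hdf : ∀ z : ℂ, 0 < z.im → DifferentiableAt ℂ f z := fun z hz => (hd z hz).differentiableAt
  -- On this ball |Re x| ≥ ρ, and Re x is the imaginary part of y + ix. Hence the kernel and its
  -- derivative are bounded uniformly in y.
  set ρ := |w.re| / 2 with hρdef
  have hρ : 0 < ρ := half_pos (abs_pos.mpr hw)
  have hball : ∀ x ∈ Metric.ball w ρ, ρ ≤ |x.re| := by
    intro x hx
    have h1 : |(x - w).re| < ρ := (abs_re_le_norm _).trans_lt (by rwa [← dist_eq_norm])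
    have h2 := abs_sub_abs_le_abs_sub w.re x.re
    rw [sub_re, abs_sub_comm] at h1
    linarith
  have hne : ∀ x ∈ Metric.ball w ρ, x.re ≠ 0 := fun x hx =>
    abs_pos.mp (hρ.trans_le (hball x hx))
  set D : ℂ → ℝ → ℂ := fun x y => -(1 / 2) * ((y : ℂ) + I * x)⁻¹ * (csqrt ((y : ℂ) + I * x))⁻¹
    with hD
  have hDcont : ∀ {x : ℂ}, x.re ≠ 0 → Continuous (D x) := fun hx =>
    (continuous_const.mul (continuous_inv_imAxis hx)).mul (continuous_inv_csqrt_imAxis hx)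
  have hDbound : ∀ x ∈ Metric.ball w ρ, ∀ y : ℝ, ‖D x y‖ ≤ 1 / 2 * ρ⁻¹ * (Real.sqrt ρ)⁻¹ := by
    intro x hx y
    rw [hD]
    simp only
    rw [norm_mul, norm_mul]
    have : ‖-(1 / 2 : ℂ)‖ = 1 / 2 := by norm_num
    rw [this]
    exact mul_le_mul (mul_le_mul_of_nonneg_left (norm_inv_imAxis_le hρ (hball x hx) y)
      one_half_pos.le) (norm_inv_csqrt_imAxis_le hρ (hball x hx) y) (norm_nonneg _) (by positivity)
  have hwball : w ∈ Metric.ball w ρ := Metric.mem_ball_self hρ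
  have key := hasDerivAt_integral_of_dominated_loc_of_deriv_le
    (μ := volume.restrict (Ioi (0 : ℝ))) (F := fun x y => kernelFun f x (I * (y : ℂ)) * I)
    (F' := fun x y => f (I * (y : ℂ)) * (D x y * I) * I)
    (bound := fun y => ‖f (I * (y : ℂ))‖ * (1 / 2 * ρ⁻¹ * (Real.sqrt ρ)⁻¹))
    (Metric.ball_mem_nhds w hρ) ?_ ?_ ?_ ?_ ?_ ?_
  · refine key.2.congr_deriv ?_
    -- The kernel depends only on z - w, so its w-derivative is minus its z-derivative and can be
    -- moved onto f. The boundary terms vanish because f decays at both ends while the kernel stays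
    -- bounded.
    have hparts := integral_Ioi_mul_deriv_eq_deriv_mul (a := 0) (a' := 0) (b' := 0)
      (u := fun y : ℝ => f (I * y)) (u' := fun y : ℝ => f' (I * y) * I)
      (v := fun y : ℝ => (csqrt ((y : ℂ) + I * w))⁻¹) (v' := D w) ?_ ?_ ?_ ?_ ?_ ?_
    · rw [eichlerIntegral]
      calc ∫ y in Ioi (0 : ℝ), f (I * y) * (D w y * I) * I
          = ∫ y in Ioi (0 : ℝ), -(f (I * y) * D w y) := by
            refine integral_congr_ae (ae_of_all _ fun y => ?_)
            simp only
            linear_combination (f (I * y) * D w y) * I_mul_I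
        _ = -∫ y in Ioi (0 : ℝ), f (I * y) * D w y := integral_neg _
        _ = ∫ y in Ioi (0 : ℝ), f' (I * y) * I * (csqrt ((y : ℂ) + I * w))⁻¹ := by
            rw [hparts]; ring
        _ = _ := by
            refine integral_congr_ae (ae_of_all _ fun y => ?_)
            simp only [kernelFun_imAxis]
            ring
    · intro y hy
      have h1 : HasDerivAt (fun y : ℝ => I * (y : ℂ)) I y := by
        simpa using (hasDerivAt_id y).ofReal_comp.const_mul I
      exact (hd _ (by rw [I_mul_ofReal_im]; exact hy)).comp y h1
    · intro y _
      have h1 : HasDerivAt (fun y : ℝ => (y : ℂ) + I * w) 1 y := by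
        simpa using (hasDerivAt_id y).ofReal_comp.add_const (I * w)
      exact ((hasDerivAt_inv_csqrt (imAxis_mem_slitPlane hw y)).comp y h1).congr_deriv (mul_one _)
    · exact (hf.integrableOn_imAxis hdf).mul_bdd (hDcont hw).aestronglyMeasurable
        (ae_of_all _ fun y => hDbound w hwball y)
    · exact ((hf'.integrableOn_imAxis hd').mul_const I).mul_bdd
        (continuous_inv_csqrt_imAxis hw).aestronglyMeasurable
        (ae_of_all _ fun y => norm_inv_csqrt_imAxis_le (abs_pos.mpr hw) le_rfl y)
    · refine hf.tendsto_imAxis_zero.zero_mul_isBoundedUnder_le ?_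
      exact isBoundedUnder_of ⟨_, fun y => norm_inv_csqrt_imAxis_le (abs_pos.mpr hw) le_rfl y⟩
    · refine hf.tendsto_imAxis_atTop.zero_mul_isBoundedUnder_le ?_
      exact isBoundedUnder_of ⟨_, fun y => norm_inv_csqrt_imAxis_le (abs_pos.mpr hw) le_rfl y⟩
  · filter_upwards [Metric.ball_mem_nhds w hρ] with x hx
    exact ((integrableOn_imAxis_kernelFun hf hdf (hne x hx)).mul_const I).aestronglyMeasurable
  · exact (integrableOn_imAxis_kernelFun hf hdf hw).mul_const I
  · exact ((hf.integrableOn_imAxis hdf).aestronglyMeasurable.mul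
      ((hDcont hw).mul continuous_const).aestronglyMeasurable).mul_const I
  · refine ae_of_all _ fun y x hx => ?_
    rw [norm_mul, norm_mul, norm_mul, norm_I, mul_one, mul_one]
    exact mul_le_mul_of_nonneg_left (hDbound x hx y) (norm_nonneg _)
  · exact (hf.integrableOn_imAxis hdf).norm.mul_const _
  · refine ae_of_all _ fun y x hx => ?_
    simp_rw [kernelFun_imAxis]
    have h1 : HasDerivAt (fun x : ℂ => (y : ℂ) + I * x) I x := by
      simpa using ((hasDerivAt_id x).const_mul I).const_add (y : ℂ)
    exact (((hasDerivAt_inv_csqrt (imAxis_mem_slitPlane (hne x hx) y)).comp x h1).const_mul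
      (f (I * y))).mul_const I

section

/-! ### The transformation formula for false theta series -/

theorem csqrt_mul {x y : ℂ} (hx : x ≠ 0) (hy : y ≠ 0) (h : arg x + arg y ∈ Ioc (-Real.pi) Real.pi) :
    csqrt (x * y) = csqrt x * csqrt y := by
  rw [csqrt, csqrt, csqrt, cpow_def_of_ne_zero (mul_ne_zero hx hy), cpow_def_of_ne_zero hx,
    cpow_def_of_ne_zero hy, Complex.log_mul hx hy h, add_mul, Complex.exp_add]

theorem csqrt_mul_of_re_pos {w : ℂ} (hw : 0 < w.im) (hre : 0 < w.re) :
    csqrt (I * w) * csqrt (-I * w) = w := by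
  have hw0 := ne_zero_of_im_pos hw
  have h1 : |arg w| < Real.pi / 2 := abs_arg_lt_pi_div_two_iff.mpr (Or.inl hre)
  rw [abs_lt] at h1
  have e1 : csqrt (I * w) = csqrt I * csqrt w :=
    csqrt_mul I_ne_zero hw0 (by rw [arg_I]; constructor <;> linarith [Real.pi_pos])
  have e2 : csqrt (-I * w) = csqrt (-I) * csqrt w :=
    csqrt_mul (neg_ne_zero.mpr I_ne_zero) hw0 (by
      rw [arg_neg_I]; constructor <;> linarith [Real.pi_pos])
  have e3 : csqrt (-I) = (csqrt I)⁻¹ := by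
    rw [← inv_I]
    exact csqrt_inv (by simp [mem_slitPlane_iff])
  have e4 := csqrt_ne_zero I_ne_zero
  rw [e1, e2, e3]
  calc _ = csqrt w ^ 2 := by field_simp
    _ = w := csqrt_sq w

theorem csqrt_conj {z : ℂ} (hz : z ∈ slitPlane) :
    csqrt ((starRingEnd ℂ) z) = (starRingEnd ℂ) (csqrt z) := by
  have h : (starRingEnd ℂ) (1 / 2 : ℂ) = 1 / 2 := by rw [map_div₀, map_one, map_ofNat]
  rw [csqrt, csqrt, conj_cpow _ _ (slitPlane_arg_ne_pi hz), h]

/-- For Re w > 0 the arguments add without wrapping around. The case Re w < 0 is the reflection w ↦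
-w̄ of the first and brings in the sign. -/
theorem csqrt_I_mul_mul_csqrt_neg_I_mul {w : ℂ} (hw : 0 < w.im) (hre : w.re ≠ 0) :
    csqrt (I * w) * csqrt (-I * w) = Real.sign w.re * w := by
  rcases lt_or_gt_of_ne hre with h | h
  · have h1 := csqrt_mul_of_re_pos (w := -(starRingEnd ℂ) w) (by simpa using hw) (by simpa using h)
    have e1 : I * -(starRingEnd ℂ) w = (starRingEnd ℂ) (I * w) := by simp
    have e2 : -I * -(starRingEnd ℂ) w = (starRingEnd ℂ) (-I * w) := by simp
    have hs : I * w ∈ slitPlane := by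
      rw [mem_slitPlane_iff]; right; simpa using hre
    rw [e1, e2, csqrt_conj hs, csqrt_conj (neg_I_mul_mem_slitPlane hw), ← map_mul, ← map_neg] at h1
    rw [(starRingEnd ℂ).injective h1, Real.sign_of_neg h]
    simp
  · rw [csqrt_mul_of_re_pos hw h, Real.sign_of_pos h]
    simp

theorem sign_neg_one_div_re {τ : ℂ} (hτ : 0 < τ.im) :
    Real.sign (-1 / τ).re = -Real.sign τ.re := by
  have h0 : 0 < (normSq τ)⁻¹ := inv_pos.mpr (normSq_pos.mpr (ne_zero_of_im_pos hτ))
  have : (-1 / τ).re = -(τ.re * (normSq τ)⁻¹) := by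
    rw [div_eq_mul_inv, neg_one_mul, neg_re, inv_re, div_eq_mul_inv]
  rw [this]
  rcases lt_trichotomy τ.re 0 with h | h | h
  · rw [Real.sign_of_neg h, Real.sign_of_pos (neg_pos.mpr (mul_neg_of_neg_of_pos h h0)), neg_neg]
  · simp [h]
  · rw [Real.sign_of_pos h, Real.sign_of_neg (neg_neg_of_pos (mul_pos h h0))]

theorem neg_one_div_re_ne_zero {τ : ℂ} (hτ : 0 < τ.im) (hre : τ.re ≠ 0) : (-1 / τ).re ≠ 0 := by
  intro h
  have := sign_neg_one_div_re hτ
  rw [h, Real.sign_zero, zero_eq_neg, Real.sign_eq_zero_iff] at this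
  exact hre this

variable {N : ℕ} {b b' : ℤ → ℂ}

/-- The rotated integral at w = -1/τ, solved for the false theta series of b: the half beyond w is
i√N times that series, and the half below w is the dual series at -1/w = τ. -/
theorem falseTheta_transform_base (hN : 0 < N) (h : IsThetaPair N b b') {k : ℕ}
    (hk : k = 0 ∨ k = 1) {τ : ℂ} (hτ : 0 < τ.im) (hre : τ.re ≠ 0) :
    twistTheta N (signTwist b) k (-1 / τ) =
      -I * ((Real.sqrt N : ℂ))⁻¹ * eichlerIntegral (twistTheta N b (k + 1)) (-1 / τ) -
        Real.sign τ.re * ((Real.sqrt N : ℂ))⁻¹ * csqrt (-I * τ) * ((-τ) ^ k *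
          twistTheta N (signTwist b') k τ) := by
  obtain ⟨B, hB⟩ := h.bdd
  obtain ⟨B', hB'⟩ := h.bdd'
  have hw := neg_one_div_im_pos hτ
  have hwre := neg_one_div_re_ne_zero hτ hre
  have hτ0 := ne_zero_of_im_pos hτ
  have hsN : (Real.sqrt N : ℂ) ≠ 0 :=
    ofReal_ne_zero.mpr (Real.sqrt_pos.mpr (Nat.cast_pos.mpr hN)).ne'
  have key := integral_imAxis_kernelFun hN h (K := k + 1) (by omega) hw hwre
  have hprod := csqrt_I_mul_mul_csqrt_neg_I_mul hw hwre
  rw [sign_neg_one_div_re hτ, ofReal_neg] at hprod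
  have hττ : -1 / (-1 / τ) = τ := by field_simp
  rw [abelIntegral_twistTheta hN hB k hw, hττ, abelIntegral_twistTheta hN hB' k hτ,
    ← eichlerIntegral] at key
  have hw0 := ne_zero_of_im_pos hw
  have hinv : (-1 / τ)⁻¹ = -τ := by field_simp
  have hA := csqrt_sq (-I * (-1 / τ))
  have hC := csqrt_sq (-I * τ)
  have hA0 := csqrt_ne_zero (slitPlane_ne_zero (neg_I_mul_mem_slitPlane hw))
  have hC0 := csqrt_ne_zero (slitPlane_ne_zero (neg_I_mul_mem_slitPlane hτ))
  have hB0 : csqrt (I * (-1 / τ)) ≠ 0 := csqrt_ne_zero (mul_ne_zero I_ne_zero hw0)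
  rw [hinv] at key
  have hσ : (Real.sign τ.re : ℂ) * Real.sign τ.re = 1 := by
    rcases lt_or_gt_of_ne hre with h | h
    · rw [Real.sign_of_neg h]; norm_num
    · rw [Real.sign_of_pos h]; norm_num
  -- What remains is algebra with A² = -iw, C² = -iτ, DA = -σw and σ² = 1, where w = -1/τ.
  generalize csqrt (-I * (-1 / τ)) = A at *
  generalize csqrt (-I * τ) = C at *
  generalize csqrt (I * (-1 / τ)) = D at *
  generalize (Real.sqrt N : ℂ) = s at *
  generalize (Real.sign τ.re : ℂ) = σ at *
  generalize twistTheta N (signTwist b') k τ = F' at *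
  generalize twistTheta N (signTwist b) k (-1 / τ) = F at *
  have hI := I_mul_I
  have e1 : -1 / τ / A * (s * A⁻¹ * F) = I * s * F := by
    have : -1 / τ / A * A⁻¹ = I := by
      rw [div_mul_eq_mul_div, div_eq_iff hA0, ← div_eq_mul_inv, div_eq_iff hA0]
      linear_combination -I * hA + (-1 / τ) * hI
    linear_combination (s * F) * this
  have e2 : -1 / τ / D * (s⁻¹ * A⁻¹ * (-τ) ^ (k + 1) * (s * C⁻¹ * F')) =
      -σ * (-τ) ^ (k + 1) * C⁻¹ * F' := by
    have h1 : -1 / τ / D * A⁻¹ = -σ := by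
      rw [div_mul_eq_mul_div, div_eq_iff hB0, ← div_eq_mul_inv, div_eq_iff hA0]
      linear_combination σ * hprod + (1 / τ) * hσ
    calc _ = (-1 / τ / D * A⁻¹) * (s⁻¹ * s) * (-τ) ^ (k + 1) * C⁻¹ * F' := by ring
      _ = _ := by rw [h1, inv_mul_cancel₀ hsN, mul_one]
  have e3 : C⁻¹ * τ = I * C := by
    rw [inv_mul_eq_div, div_eq_iff hC0]
    linear_combination -I * hC + τ * hI
  rw [e1, e2] at key
  rw [key]
  have e4 : -I * s⁻¹ * (I * s * F) = F := by
    calc _ = -(I * I) * (s⁻¹ * s) * F := by ring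
      _ = F := by rw [hI, inv_mul_cancel₀ hsN]; ring
  rw [mul_add, e4, pow_succ]
  linear_combination (I * s⁻¹ * σ * (-τ) ^ k * F') * e3 + (s⁻¹ * σ * (-τ) ^ k * F' * C) * hI

/-! ### The recursion for the constants and the induction on κ -/

theorem dCoeff_zero (ι : ℕ) : dCoeff 0 ι 0 = 1 := by
  have : (ι.factorial : ℂ) ≠ 0 := Nat.cast_ne_zero.mpr ι.factorial_ne_zero
  simp [dCoeff, this]

theorem dCoeff_succ_zero {ι : ℕ} (hι : ι = 0 ∨ ι = 1) (κ : ℕ) :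
    dCoeff (κ + 1) ι 0 = (2 * κ + 2 * ι + 1) * dCoeff κ ι 0 := by
  have h1 : ((κ.factorial : ℕ) : ℂ) ≠ 0 := Nat.cast_ne_zero.mpr κ.factorial_ne_zero
  have h3 : ((κ : ℂ) + 1) ≠ 0 := by exact_mod_cast κ.succ_ne_zero
  simp only [dCoeff, zero_le, if_true, pow_zero, one_mul, Nat.sub_zero]
  rw [show 2 * (κ + 1) + ι = (2 * κ + ι + 1) + 1 by ring, Nat.factorial_succ, Nat.factorial_succ,
    Nat.factorial_succ κ]
  push_cast
  rcases hι with rfl | rfl <;> (push_cast; simp; field_simp; ring)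

/-- This recursion reflects the two ways a τ-derivative hits a term: the first summand comes from
the powers of τ, the second from the theta series, whose index r goes up by one. It relies on ι² =
ι. -/
theorem dCoeff_succ_succ {ι : ℕ} (hι : ι = 0 ∨ ι = 1) {κ r : ℕ} (hr : r ≤ κ) :
    dCoeff (κ + 1) ι (r + 1) =
      (2 * κ + 2 * ι + 2 * r + 3) * dCoeff κ ι (r + 1) + 2 * Real.pi * I * dCoeff κ ι r := by
  obtain ⟨j, rfl⟩ := Nat.exists_eq_add_of_le hr
  have hpi : (Real.pi : ℂ) ≠ 0 := ofReal_ne_zero.mpr Real.pi_ne_zero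
  have h1 : ((j.factorial : ℕ) : ℂ) ≠ 0 := Nat.cast_ne_zero.mpr j.factorial_ne_zero
  have h2 : (((2 * r + ι).factorial : ℕ) : ℂ) ≠ 0 := Nat.cast_ne_zero.mpr (Nat.factorial_ne_zero _)
  have h3 : (2 * (r : ℂ) + ι + 1) ≠ 0 := by exact_mod_cast (2 * r + ι).succ_ne_zero
  have h4 : (2 * (r : ℂ) + ι + 1 + 1) ≠ 0 := by exact_mod_cast (2 * r + ι + 1).succ_ne_zero
  have e1 : 2 * (r + 1) + ι = (2 * r + ι + 1) + 1 := by ring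
  have e2 : 2 * (r + j + 1) + ι = (2 * (r + j) + ι + 1) + 1 := by ring
  have hι2 : (ι : ℂ) * ι = ι := by rcases hι with rfl | rfl <;> simp
  simp only [dCoeff]
  rcases j with _ | j
  · rw [if_pos (by omega), if_neg (by omega), if_pos (by omega), e1]
    simp only [Nat.add_zero, Nat.sub_self, Nat.factorial_zero, Nat.cast_one]
    rw [Nat.factorial_succ (2 * r + ι + 1), Nat.factorial_succ (2 * r + ι)]
    push_cast
    field_simp
    ring
  · have h5 : ((j.factorial : ℕ) : ℂ) ≠ 0 := Nat.cast_ne_zero.mpr j.factorial_ne_zero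
    have h6 : ((j : ℂ) + 1) ≠ 0 := by exact_mod_cast j.succ_ne_zero
    rw [if_pos (by omega), if_pos (by omega), if_pos (by omega), e1, e2,
      show r + (j + 1) + 1 - (r + 1) = j + 1 by omega,
      show r + (j + 1) - r = j + 1 by omega, show r + (j + 1) - (r + 1) = j by omega,
      Nat.factorial_succ (2 * (r + (j + 1)) + ι + 1), Nat.factorial_succ (2 * (r + (j + 1)) + ι),
      Nat.factorial_succ (2 * r + ι + 1), Nat.factorial_succ (2 * r + ι), Nat.factorial_succ j]
    push_cast
    field_simp
    rcases hι with rfl | rfl <;> (push_cast; ring)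

end

section

theorem sum_dCoeff_succ {ι : ℕ} (hι : ι = 0 ∨ ι = 1) (κ : ℕ) (F : ℕ → ℂ) (x τ : ℂ) :
    ∑ r ∈ Finset.range (κ + 1 + 1), dCoeff (κ + 1) ι r * x ^ (κ + 1 - r) * τ ^ r * F r =
      ∑ r ∈ Finset.range (κ + 1), dCoeff κ ι r * x ^ (κ - r) * τ ^ r *
        ((2 * κ + 2 * ι + 2 * r + 1) * x * F r + 2 * Real.pi * I * τ * F (r + 1)) := by
  set A : ℕ → ℂ := fun r =>
    dCoeff κ ι r * (2 * κ + 2 * ι + 2 * r + 1) * x ^ (κ + 1 - r) * τ ^ r * F r with hA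
  -- The value 0 of `dCoeff` beyond r = κ lets both sums run over the same range.
  have hlast : A (κ + 1) = 0 := by
    have : dCoeff κ ι (κ + 1) = 0 := by simp [dCoeff]
    simp [hA, this]
  have h1 : ∑ r ∈ Finset.range (κ + 1), dCoeff κ ι r * x ^ (κ - r) * τ ^ r *
        ((2 * κ + 2 * ι + 2 * r + 1) * x * F r + 2 * Real.pi * I * τ * F (r + 1)) =
      ∑ r ∈ Finset.range (κ + 1 + 1), A r + ∑ r ∈ Finset.range (κ + 1),
        2 * Real.pi * I * dCoeff κ ι r * x ^ (κ - r) * τ ^ (r + 1) * F (r + 1) := by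
    rw [Finset.sum_range_succ A, hlast, add_zero, ← Finset.sum_add_distrib]
    refine Finset.sum_congr rfl fun r hr => ?_
    have hr' : r ≤ κ := Nat.lt_succ_iff.mp (Finset.mem_range.mp hr)
    simp only [hA]
    rw [Nat.succ_sub hr', pow_succ, pow_succ]
    ring
  rw [h1, Finset.sum_range_succ', Finset.sum_range_succ' A, add_right_comm, ← Finset.sum_add_distrib]
  congr 1
  · refine Finset.sum_congr rfl fun r hr => ?_
    have hr' : r ≤ κ := Nat.lt_succ_iff.mp (Finset.mem_range.mp hr)
    simp only [hA]
    rw [dCoeff_succ_succ hι hr', Nat.succ_sub_succ]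
    push_cast
    ring
  · simp only [hA]
    rw [dCoeff_succ_zero hι]
    push_cast
    ring

variable {N : ℕ} {b b' : ℤ → ℂ}

/-- The elementary part of the transformation formula, without its constants. -/
def falseThetaCompanion (N : ℕ) (c : ℤ → ℂ) (κ ι : ℕ) (τ : ℂ) : ℂ :=
  csqrt (-I * τ) * (τ ^ (κ + ι) * ∑ r ∈ Finset.range (κ + 1),
    dCoeff κ ι r * (N : ℂ) ^ (κ - r) * τ ^ r * twistTheta N c (2 * r + ι) τ)

/-- The induction step for the elementary part. The factor τ⁻² also occurs in the derivative of
-1/τ, so it cancels when the two sides of the formula are compared. -/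
theorem hasDerivAt_falseThetaCompanion (hN : 0 < N) {c : ℤ → ℂ} {B : ℝ} (hc : ∀ m, ‖c m‖ ≤ B)
    {ι : ℕ} (hι : ι = 0 ∨ ι = 1) (κ : ℕ) {τ : ℂ} (hτ : 0 < τ.im) :
    HasDerivAt (falseThetaCompanion N c κ ι)
      ((2 * (N : ℂ))⁻¹ * τ⁻¹ ^ 2 * falseThetaCompanion N c (κ + 1) ι τ) τ := by
  have hτ0 := ne_zero_of_im_pos hτ
  have hN' : (N : ℂ) ≠ 0 := Nat.cast_ne_zero.mpr hN.ne'
  have hs := neg_I_mul_mem_slitPlane hτ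
  have h1 : HasDerivAt (fun z : ℂ => -I * z) (-I) τ := by
    simpa using (hasDerivAt_id τ).const_mul (-I)
  have hsq : HasDerivAt (fun z => csqrt (-I * z)) (1 / 2 * τ⁻¹ * csqrt (-I * τ)) τ := by
    refine ((hasDerivAt_csqrt hs).comp τ h1).congr_deriv ?_
    field_simp
  have hpow : ∀ n : ℕ, HasDerivAt (fun z : ℂ => z ^ n) (n * (τ ^ n * τ⁻¹)) τ := by
    intro n
    refine (hasDerivAt_pow n τ).congr_deriv ?_
    rcases n with _ | n
    · simp
    · rw [Nat.add_sub_cancel, pow_succ τ n, mul_assoc (τ ^ n), mul_inv_cancel₀ hτ0, mul_one]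
  have hterm : ∀ r ∈ Finset.range (κ + 1), HasDerivAt (fun z =>
      dCoeff κ ι r * (N : ℂ) ^ (κ - r) * z ^ r * twistTheta N c (2 * r + ι) z)
      (dCoeff κ ι r * (N : ℂ) ^ (κ - r) * (r * (τ ^ r * τ⁻¹)) * twistTheta N c (2 * r + ι) τ +
        dCoeff κ ι r * (N : ℂ) ^ (κ - r) * τ ^ r *
          (Real.pi * I / N * twistTheta N c (2 * r + ι + 2) τ)) τ := fun r _ =>
    ((hpow r).const_mul _).mul (hasDerivAt_twistTheta hN hc (2 * r + ι) hτ)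
  have hsum := HasDerivAt.fun_sum hterm
  refine (hsq.mul ((hpow (κ + ι)).mul hsum)).congr_deriv ?_
  rw [falseThetaCompanion, sum_dCoeff_succ hι κ (fun r => twistTheta N c (2 * r + ι) τ)]
  simp only [Pi.mul_apply, Finset.mul_sum, mul_add (csqrt (-I * τ))]
  rw [← Finset.sum_add_distrib, ← Finset.sum_add_distrib]
  refine Finset.sum_congr rfl fun r _ => ?_
  rw [show 2 * (r + 1) + ι = 2 * r + ι + 2 by ring, show κ + 1 + ι = κ + ι + 1 by ring,
    pow_succ τ (κ + ι)]
  push_cast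
  field_simp
  ring

theorem eichlerIntegral_const_mul (a : ℂ) (f : ℂ → ℂ) (w : ℂ) :
    eichlerIntegral (fun z => a * f z) w = a * eichlerIntegral f w := by
  rw [eichlerIntegral, eichlerIntegral, ← integral_const_mul]
  refine integral_congr_ae (ae_of_all _ fun y => ?_)
  simp only [kernelFun]
  ring

theorem eventually_sign_re_eq {τ : ℂ} (hre : τ.re ≠ 0) :
    ∀ᶠ z : ℂ in 𝓝 τ, z.re ≠ 0 ∧ Real.sign z.re = Real.sign τ.re := by
  rcases lt_or_gt_of_ne hre with h | h
  · filter_upwards [(isOpen_lt continuous_re continuous_const).mem_nhds h] with z hz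
    exact ⟨ne_of_lt hz, by rw [Real.sign_of_neg hz, Real.sign_of_neg h]⟩
  · filter_upwards [(isOpen_lt continuous_const continuous_re).mem_nhds h] with z hz
    exact ⟨ne_of_gt hz, by rw [Real.sign_of_pos hz, Real.sign_of_pos h]⟩

/-- Differentiate the formula for κ and multiply by Nτ²/(πi). This is legitimate because sgn(Re τ)
is locally constant off the imaginary axis, so the formula holds in a neighbourhood of τ. -/
theorem falseTheta_transform (hN : 0 < N) (h : IsThetaPair N b b') {ι : ℕ}
    (hι : ι = 0 ∨ ι = 1) (κ : ℕ) : ∀ {τ : ℂ}, 0 < τ.im → τ.re ≠ 0 →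
    twistTheta N (signTwist b) (2 * κ + ι) (-1 / τ) =
      -I * ((Real.sqrt N : ℂ))⁻¹ * eichlerIntegral (twistTheta N b (2 * κ + ι + 1)) (-1 / τ) -
        Real.sign τ.re * ((Real.sqrt N : ℂ))⁻¹ * ((-1) ^ ι / (2 * Real.pi * I) ^ κ) *
          falseThetaCompanion N (signTwist b') κ ι τ := by
  obtain ⟨B, hB⟩ := h.bdd
  obtain ⟨B', hB'⟩ := h.bdd'
  induction κ with
  | zero =>
    intro τ hτ hre
    rw [Nat.mul_zero, zero_add, falseTheta_transform_base hN h hι hτ hre, falseThetaCompanion]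
    simp only [zero_add, Finset.range_one, Finset.sum_singleton, pow_zero, Nat.mul_zero,
      dCoeff_zero, Nat.sub_zero]
    rw [neg_pow τ ι]
    ring
  | succ κ ih =>
    intro τ hτ hre
    have hτ0 := ne_zero_of_im_pos hτ
    have hw := neg_one_div_im_pos hτ
    have hN' : (N : ℂ) ≠ 0 := Nat.cast_ne_zero.mpr hN.ne'
    have hpi : (Real.pi : ℂ) ≠ 0 := ofReal_ne_zero.mpr Real.pi_ne_zero
    have hinv := hasDerivAt_neg_one_div hτ0
    have hL := (hasDerivAt_twistTheta hN (norm_signTwist_le hB) (2 * κ + ι) hw).comp τ hinv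
    have hE := (hasDerivAt_eichlerIntegral (h.coneDecay hN (2 * κ + ι + 1))
      ((h.coneDecay hN (2 * κ + ι + 1 + 2)).const_mul (Real.pi * I / N))
      (fun z hz => hasDerivAt_twistTheta hN hB (2 * κ + ι + 1) hz)
      (fun z hz => ((hasDerivAt_twistTheta hN hB (2 * κ + ι + 1 + 2) hz).differentiableAt.const_mul
        _)) (neg_one_div_re_ne_zero hτ hre)).comp τ hinv
    have hC := hasDerivAt_falseThetaCompanion hN (norm_signTwist_le hB') hι κ hτ
    have hR := (hE.const_mul (-I * ((Real.sqrt N : ℂ))⁻¹)).sub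
      (hC.const_mul (Real.sign τ.re * ((Real.sqrt N : ℂ))⁻¹ * ((-1) ^ ι / (2 * Real.pi * I) ^ κ)))
    have heq := hL.unique (hR.congr_of_eventuallyEq (by
      filter_upwards [eventually_sign_re_eq hre,
        (isOpen_lt continuous_const continuous_im).mem_nhds hτ] with z hz hz'
      simp only [Function.comp, Pi.sub_apply]
      rw [ih hz' hz.1, hz.2]))
    rw [eichlerIntegral_const_mul] at heq
    have e1 : 2 * (κ + 1) + ι = 2 * κ + ι + 2 := by ring
    rw [e1, show 2 * κ + ι + 2 + 1 = 2 * κ + ι + 1 + 2 by ring]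
    generalize eichlerIntegral (twistTheta N b (2 * κ + ι + 1 + 2)) (-1 / τ) = E at *
    generalize falseThetaCompanion N (signTwist b') (κ + 1) ι τ = G at *
    generalize (Real.sqrt N : ℂ) = s at *
    calc twistTheta N (signTwist b) (2 * κ + ι + 2) (-1 / τ)
        = N * τ ^ 2 / (Real.pi * I) * (Real.pi * I / N *
            twistTheta N (signTwist b) (2 * κ + ι + 2) (-1 / τ) * τ⁻¹ ^ 2) := by field_simp
      _ = _ := by
          rw [heq, pow_succ _ κ]
          field_simp

end

section

/-! ### The coefficients of the homological block -/

/-- Unsigned Stirling numbers are the coefficients of the rising factorial; a common factor t has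
been removed, whence the indices d+1 and l+1. -/
theorem sum_stirlingFirst_mul_pow (d : ℕ) (t : ℚ) :
    ∑ l ∈ Finset.range (d + 1), (Nat.stirlingFirst (d + 1) (l + 1) : ℚ) * t ^ l =
      ∏ i ∈ Finset.range d, (t + (i + 1)) := by
  induction d with
  | zero => simp [Nat.stirlingFirst_self]
  | succ d ih =>
    have h1 : ∀ l, (Nat.stirlingFirst (d + 1 + 1) (l + 1) : ℚ) =
        (d + 1) * Nat.stirlingFirst (d + 1) (l + 1) + Nat.stirlingFirst (d + 1) l := fun l => by
      rw [Nat.stirlingFirst_succ_succ]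
      push_cast
      ring
    simp only [h1, add_mul _ _ (t ^ _), Finset.sum_add_distrib]
    rw [Finset.prod_range_succ, ← ih, Finset.sum_range_succ,
      Finset.sum_range_succ' (fun l => (Nat.stirlingFirst (d + 1) l : ℚ) * t ^ l),
      Nat.stirlingFirst_eq_zero_of_lt (by omega : d + 1 < d + 1 + 1), Nat.stirlingFirst_succ_zero]
    simp only [pow_succ, mul_assoc, ← Finset.mul_sum]
    simp only [← mul_assoc, ← Finset.sum_mul]
    push_cast
    ring

variable {n : ℕ} {p : Fin n → ℕ}

theorem bigP_pos (hp : ∀ j, 2 ≤ p j) : 0 < bigP p := Finset.prod_pos fun j _ => by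
  have := hp j
  omega

/-- The polynomial with coefficients `c_ε(k)` interpolates the binomial coefficients. -/
theorem sum_cCoeff_mul_pow (hn : 3 ≤ n) (hp : ∀ j, 2 ≤ p j) (ε : Fin n → ℤˣ) (t : ℚ) :
    ∑ k ∈ Finset.range (n - 2), cCoeff p ε k * ((2 * bigP p : ℕ) * t + numer p ε) ^ k =
      ((n - 3).factorial : ℚ)⁻¹ * ∏ i ∈ Finset.range (n - 3), (t + (i + 1)) := by
  have hP : (bigP p : ℚ) ≠ 0 := Nat.cast_ne_zero.mpr (bigP_pos hp).ne'
  rw [numer_eq p hp, ← sum_stirlingFirst_mul_pow, show n - 2 = n - 3 + 1 by omega]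
  set x := shift p ε with hx
  set d := n - 3 with hd
  set M : ℚ := (2 * bigP p : ℕ) * t + bigP p * x with hM
  have hd2 : n - 2 = d + 1 := by omega
  simp only [cCoeff, Finset.mul_sum, Finset.sum_mul]
  rw [Finset.sum_comm' (s' := fun l => Finset.range (l + 1)) (t' := Finset.range (d + 1))
    (fun k l => by simp only [Finset.mem_range, Finset.mem_Icc]; omega)]
  refine Finset.sum_congr rfl fun l _ => ?_
  -- Solving M = 2Pt + Px for t; expanding the l-th power by the binomial theorem gives precisely
  -- the factors in `cCoeff`.
  have ht : t = (-2)⁻¹ * (-(M / bigP p) + x) := by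
    rw [hM]
    push_cast
    field_simp
    ring
  have hpow : t ^ l = ((-2 : ℚ) ^ l)⁻¹ * ∑ k ∈ Finset.range (l + 1),
      (-(M / bigP p)) ^ k * x ^ (l - k) * (l.choose k : ℚ) := by
    rw [← add_pow, ← inv_pow, ← mul_pow, ← ht]
  rw [hpow, hd2]
  simp only [Finset.mul_sum]
  refine Finset.sum_congr rfl fun k _ => ?_
  rw [neg_pow (M / bigP p), div_pow]
  ring

theorem choose_eq_prod (d m : ℕ) :
    ((m + d).choose d : ℚ) = (d.factorial : ℚ)⁻¹ * ∏ i ∈ Finset.range d, ((m : ℚ) + (i + 1)) := by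
  have h := Nat.ascFactorial_eq_factorial_mul_choose m d
  have h0 : (d.factorial : ℚ) ≠ 0 := Nat.cast_ne_zero.mpr d.factorial_ne_zero
  rw [Nat.ascFactorial_eq_prod_range] at h
  rw [eq_inv_mul_iff_mul_eq₀ h0]
  have h' : ((∏ i ∈ Finset.range d, (m + 1 + i) : ℕ) : ℚ) =
      ((d.factorial * (m + d).choose d : ℕ) : ℚ) := by rw [h]
  push_cast at h'
  rw [← h']
  exact Finset.prod_congr rfl fun i _ => by ring

theorem prod_shift_eq_zero {d : ℕ} {j : ℤ} (h1 : -(d : ℤ) ≤ j) (h2 : j < 0) :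
    ∏ i ∈ Finset.range d, ((j : ℚ) + (i + 1)) = 0 := by
  refine Finset.prod_eq_zero (i := (-j - 1).toNat) (Finset.mem_range.mpr (by omega)) ?_
  have : (((-j - 1).toNat : ℤ) : ℚ) = -j - 1 := by
    rw [Int.toNat_of_nonneg (by omega)]
    push_cast
    ring
  rw [Int.cast_natCast] at this
  rw [this]
  ring

theorem prod_shift_reflect (d : ℕ) (t : ℚ) :
    ∏ i ∈ Finset.range d, (-t - (d + 1) + (i + 1)) =
      (-1) ^ d * ∏ i ∈ Finset.range d, (t + (i + 1)) := by
  rw [← Finset.prod_range_reflect, ← Finset.card_range d, ← Finset.prod_const,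
    Finset.card_range, ← Finset.prod_mul_distrib]
  refine Finset.prod_congr rfl fun i hi => ?_
  have : i < d := Finset.mem_range.mp hi
  rw [Nat.sub_sub, Nat.cast_sub (by omega)]
  push_cast
  ring

/-! ### Alternating sums over the signs -/

theorem signProd_update_neg (ε : Fin n → ℤˣ) (j : Fin n) :
    signProd (Function.update ε j (-ε j)) = -signProd ε := by
  rw [signProd, signProd, ← Finset.mul_prod_erase _ _ (Finset.mem_univ j),
    ← Finset.mul_prod_erase (Finset.univ) (fun i => ((ε i : ℤˣ) : ℤ)) (Finset.mem_univ j)]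
  have : ∏ i ∈ Finset.univ.erase j, ((Function.update ε j (-ε j) i : ℤˣ) : ℤ) =
      ∏ i ∈ Finset.univ.erase j, ((ε i : ℤˣ) : ℤ) :=
    Finset.prod_congr rfl fun i hi => by
      rw [Function.update_of_ne (Finset.ne_of_mem_erase hi)]
  rw [this, Function.update_self]
  push_cast
  ring

theorem sum_signProd_mul_eq_zero (f : (Fin n → ℤˣ) → ℚ) (j : Fin n)
    (hf : ∀ ε, f (Function.update ε j (-ε j)) = f ε) :
    ∑ ε : Fin n → ℤˣ, (signProd ε : ℚ) * f ε = 0 := by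
  have hinv : Function.Involutive fun ε : Fin n → ℤˣ => Function.update ε j (-ε j) := by
    intro ε
    simp
  set σ := Function.Involutive.toPerm _ hinv with hσ
  have h := Equiv.sum_comp σ fun ε : Fin n → ℤˣ => (signProd ε : ℚ) * f ε
  have h2 : ∑ ε : Fin n → ℤˣ, (signProd (σ ε) : ℚ) * f (σ ε) =
      -∑ ε : Fin n → ℤˣ, (signProd ε : ℚ) * f ε := by
    rw [← Finset.sum_neg_distrib]
    refine Finset.sum_congr rfl fun ε _ => ?_
    simp only [hσ, Function.Involutive.coe_toPerm, signProd_update_neg, hf]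
    push_cast
    ring
  linarith

/-- Expand the power into monomials. Each involves at most e < n of the signs, so some ε_j is
missing, and flipping it changes only the sign of the product ε_1⋯ε_n. -/
theorem sum_signProd_mul_pow_eq_zero (a : ℚ) (v : Fin n → ℚ) {e : ℕ} (he : e < n) :
    ∑ ε : Fin n → ℤˣ, (signProd ε : ℚ) * (a + ∑ j, (((ε j : ℤˣ) : ℤ) : ℚ) * v j) ^ e = 0 := by
  -- The value `none` stands for the constant a, so a monomial is a map from `Fin e` to `Option (Fin
  -- n)`.
  set w : (Fin n → ℤˣ) → Option (Fin n) → ℚ :=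
    fun ε o => o.elim a fun j => (((ε j : ℤˣ) : ℤ) : ℚ) * v j with hw
  have hexp : ∀ ε : Fin n → ℤˣ, (a + ∑ j, (((ε j : ℤˣ) : ℤ) : ℚ) * v j) ^ e =
      ∑ φ : Fin e → Option (Fin n), ∏ i, w ε (φ i) := by
    intro ε
    rw [← Fintype.sum_pow, Fintype.sum_option]
    rfl
  simp only [hexp, Finset.mul_sum]
  rw [Finset.sum_comm]
  refine Finset.sum_eq_zero fun φ _ => ?_
  obtain ⟨j, hj⟩ : ∃ j, ∀ i, φ i ≠ some j := by
    by_contra! hcon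
    choose g hg using hcon
    have hinj : Function.Injective g := fun x y hxy => by
      have := hg x
      rw [hxy, hg y] at this
      exact (Option.some_injective _ this).symm
    have := Fintype.card_le_of_injective g hinj
    simp only [Fintype.card_fin] at this
    omega
  refine sum_signProd_mul_eq_zero _ j fun ε => Finset.prod_congr rfl fun i _ => ?_
  rcases ho : φ i with _ | j'
  · rfl
  · simp only [hw, Option.elim]
    rw [Function.update_of_ne]
    rintro rfl
    exact hj i ho

/-- Only powers of x_ε with exponent l - k ≤ n - 3 occur. The vanishing says that the dual
coefficients are 0 at the origin. -/
theorem sum_signProd_mul_cCoeff (hn : 3 ≤ n) (k : ℕ) :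
    ∑ ε : Fin n → ℤˣ, (signProd ε : ℚ) * cCoeff p ε k = 0 := by
  simp only [cCoeff, Finset.mul_sum]
  rw [Finset.sum_comm]
  refine Finset.sum_eq_zero fun l hl => ?_
  have hl' : l - k < n := by
    have := (Finset.mem_Icc.mp hl).2
    omega
  have h := sum_signProd_mul_pow_eq_zero ((n : ℚ) - 2) (fun j => ((p j : ℚ))⁻¹) hl'
  calc _ = ((-1) ^ k / ((bigP p : ℚ) ^ k * ((n - 3).factorial : ℚ)) * (((-2 : ℚ) ^ l)⁻¹ *
        (Nat.stirlingFirst (n - 2) (l + 1) : ℚ) * (l.choose k : ℚ))) *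
        ∑ ε : Fin n → ℤˣ, (signProd ε : ℚ) * shift p ε ^ (l - k) := by
        rw [Finset.mul_sum]
        exact Finset.sum_congr rfl fun ε _ => by ring
    _ = 0 := by
        simp only [shift, div_eq_mul_inv]
        rw [h, mul_zero]

theorem signProd_neg (ε : Fin n → ℤˣ) : signProd (-ε) = (-1) ^ n * signProd ε := by
  simp [signProd, Finset.prod_neg]

theorem numer_neg (ε : Fin n → ℤˣ) :
    numer p (-ε) = (2 * bigP p : ℕ) * ((n : ℤ) - 2) - numer p ε := by
  simp only [numer, Pi.neg_apply, Units.val_neg, neg_mul, Finset.sum_neg_distrib]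
  push_cast
  ring

end

section

/-! ### The completed series as a combination of false theta functions -/

variable {n : ℕ} {p : Fin n → ℕ}

theorem two_mul_bigP_pos (hp : ∀ j, 2 ≤ p j) : 0 < 2 * bigP p :=
  Nat.mul_pos two_pos (bigP_pos hp)

theorem injective_progression {N : ℕ} (hN : 0 < N) (a : ℤ) :
    Function.Injective fun j : ℤ => (N : ℤ) * j + a := fun i j h => by
  have hN' : (N : ℤ) ≠ 0 := by exact_mod_cast hN.ne'
  exact mul_left_cancel₀ hN' (add_right_cancel h)

theorem summable_twistTerm_progression {N : ℕ} (hN : 0 < N) {b : ℤ → ℂ} {B : ℝ}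
    (hb : ∀ m, ‖b m‖ ≤ B) (k : ℕ) (a : ℤ) {τ : ℂ} (hτ : 0 < τ.im) :
    Summable fun j : ℤ => twistTerm N b k τ (N * j + a) :=
  (summable_twistTerm hN hb k hτ).comp_injective (injective_progression hN a)

theorem qpow_sq_div_four_mul (hp : ∀ j, 2 ≤ p j) (m : ℤ) (τ : ℂ) :
    qpow ((m : ℝ) ^ 2 / (4 * (bigP p : ℝ))) τ =
      cexp (Real.pi * I * (m : ℂ) ^ 2 / (2 * bigP p : ℕ) * τ) := by
  have hP : (bigP p : ℂ) ≠ 0 := Nat.cast_ne_zero.mpr (bigP_pos hp).ne'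
  rw [qpow]
  congr 1
  push_cast
  field_simp
  ring

theorem numer_eq_add (ε : Fin n → ℤˣ) :
    numer p ε = (2 * bigP p : ℕ) * m0 p ε + ell p ε := by
  have h := Int.mul_ediv_add_emod (numer p ε) (2 * (bigP p : ℤ))
  rw [m0, ell]
  push_cast
  exact h.symm

/-- The summand of the homological block, extended to all integers `j`. -/
def blockTerm (p : Fin n → ℕ) (ε : Fin n → ℤˣ) (τ : ℂ) (j : ℤ) : ℂ :=
  ((((n - 3).factorial : ℚ)⁻¹ * ∏ i ∈ Finset.range (n - 3), ((j : ℚ) + (i + 1)) : ℚ) : ℂ) *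
    cexp (Real.pi * I * (((2 * bigP p : ℕ) * j + numer p ε : ℤ) : ℂ) ^ 2 / (2 * bigP p : ℕ) * τ)

theorem sum_cCoeff_mul_twistTerm (hn : 3 ≤ n) (hp : ∀ j, 2 ≤ p j) (ε : Fin n → ℤˣ) (b : ℤ → ℂ)
    (τ : ℂ) (j : ℤ) :
    ∑ k ∈ Finset.range (n - 2),
      (cCoeff p ε k : ℂ) * twistTerm (2 * bigP p) b k τ ((2 * bigP p : ℕ) * j + numer p ε) =
      b ((2 * bigP p : ℕ) * j + numer p ε) * blockTerm p ε τ j := by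
  rw [blockTerm, ← sum_cCoeff_mul_pow hn hp ε, Rat.cast_sum, Finset.sum_mul, Finset.mul_sum]
  refine Finset.sum_congr rfl fun k _ => ?_
  rw [twistTerm]
  push_cast
  ring

theorem summable_mul_blockTerm (hn : 3 ≤ n) (hp : ∀ j, 2 ≤ p j) (ε : Fin n → ℤˣ) {b : ℤ → ℂ}
    {B : ℝ} (hb : ∀ m, ‖b m‖ ≤ B) {τ : ℂ} (hτ : 0 < τ.im) :
    Summable fun j => b ((2 * bigP p : ℕ) * j + numer p ε) * blockTerm p ε τ j := by
  simp_rw [← sum_cCoeff_mul_twistTerm hn hp ε b τ]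
  exact summable_sum fun k _ =>
    (summable_twistTerm_progression (two_mul_bigP_pos hp) hb k _ hτ).mul_left _

/-- A shift of the summation index by `m0` passes from the progression through P x_ε to the one
through its residue ℓ. -/
theorem tsum_mul_blockTerm (hn : 3 ≤ n) (hp : ∀ j, 2 ≤ p j) (ε : Fin n → ℤˣ) {b : ℤ → ℂ}
    {B : ℝ} (hb : ∀ m, ‖b m‖ ≤ B) {τ : ℂ} (hτ : 0 < τ.im) :
    ∑' j, b ((2 * bigP p : ℕ) * j + numer p ε) * blockTerm p ε τ j =
      ∑ k ∈ Finset.range (n - 2), (cCoeff p ε k : ℂ) *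
        ∑' j : ℤ, twistTerm (2 * bigP p) b k τ ((2 * bigP p : ℕ) * j + ell p ε) := by
  simp_rw [← sum_cCoeff_mul_twistTerm hn hp ε b τ]
  rw [Summable.tsum_finsetSum fun k _ =>
    (summable_twistTerm_progression (two_mul_bigP_pos hp) hb k _ hτ).mul_left _]
  refine Finset.sum_congr rfl fun k _ => ?_
  rw [tsum_mul_left, ← (Equiv.addRight (m0 p ε)).tsum_eq fun j : ℤ =>
    twistTerm (2 * bigP p) b k τ ((2 * bigP p : ℕ) * j + ell p ε)]
  refine congrArg _ (tsum_congr fun j => congrArg _ ?_)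
  rw [numer_eq_add, Equiv.coe_addRight]
  ring

theorem summable_blockTerm (hn : 3 ≤ n) (hp : ∀ j, 2 ≤ p j) (ε : Fin n → ℤˣ) {τ : ℂ}
    (hτ : 0 < τ.im) : Summable (blockTerm p ε τ) := by
  simpa using summable_mul_blockTerm hn hp ε (b := fun _ => 1) (B := 1) (by simp) hτ

theorem psiTerm_eq_blockTerm (hn : 3 ≤ n) (hp : ∀ j, 2 ≤ p j) (ε : Fin n → ℤˣ) (τ : ℂ) (m : ℕ) :
    psiTerm p ε τ m = blockTerm p ε τ m := by
  rw [psiTerm, blockTerm, show m + n - 3 = m + (n - 3) by omega, Int.cast_natCast (R := ℚ),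
    ← choose_eq_prod, Rat.cast_natCast, ← qpow_sq_div_four_mul hp]
  have h : ((numer p ε : ℚ) : ℝ) = ((bigP p : ℚ) * shift p ε : ℚ) := congrArg _ (numer_eq p hp ε)
  push_cast at h ⊢
  rw [h]
  congr 2
  ring

theorem summable_psiTerm (hn : 3 ≤ n) (hp : ∀ j, 2 ≤ p j) (ε : Fin n → ℤˣ) {τ : ℂ}
    (hτ : 0 < τ.im) : Summable (psiTerm p ε τ) := by
  have := (summable_blockTerm hn hp ε hτ).comp_injective Nat.cast_injective
  exact this.congr fun m => (psiTerm_eq_blockTerm hn hp ε τ m).symm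

theorem blockTerm_neg (hn : 3 ≤ n) (ε : Fin n → ℤˣ) (τ : ℂ) (j : ℤ) :
    blockTerm p (-ε) τ (-j - ((n : ℤ) - 2)) = (-1) ^ (n - 3) * blockTerm p ε τ j := by
  have h := prod_shift_reflect (n - 3) (j : ℚ)
  have hd : (((n - 3 : ℕ) : ℚ) + 1) = n - 2 := by
    rw [Nat.cast_sub hn]
    push_cast
    ring
  rw [hd] at h
  have hM : (2 * bigP p : ℕ) * (-j - ((n : ℤ) - 2)) + numer p (-ε) =
      -((2 * bigP p : ℕ) * j + numer p ε) := by
    rw [numer_neg]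
    ring
  rw [blockTerm, blockTerm, hM, Int.cast_neg, neg_sq, show ((-j - ((n : ℤ) - 2) : ℤ) : ℚ) =
    -j - ((n : ℚ) - 2) by push_cast; ring, h]
  push_cast
  ring

/-- Replacing (ε, j) by (-ε, -j-(n-2)) negates 2Pj + P x_ε. The product of signs contributes (-1)^n
and the polynomial (-1)^{n-3}, so the sum equals its own negative. -/
theorem sum_signProd_mul_tsum_blockTerm (hn : 3 ≤ n) (p : Fin n → ℕ) (τ : ℂ) :
    ∑ ε : Fin n → ℤˣ, (signProd ε : ℂ) * ∑' j, blockTerm p ε τ j = 0 := by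
  set S := ∑ ε : Fin n → ℤˣ, (signProd ε : ℂ) * ∑' j, blockTerm p ε τ j with hS
  have h : S = -S := by
    conv_lhs => rw [hS, ← Equiv.sum_comp (Equiv.neg (Fin n → ℤˣ))]
    rw [hS, ← Finset.sum_neg_distrib]
    refine Finset.sum_congr rfl fun ε _ => ?_
    rw [Equiv.neg_apply, signProd_neg,
      ← (Equiv.subRight ((n : ℤ) - 2)).tsum_eq, ← (Equiv.neg ℤ).tsum_eq]
    simp only [Equiv.neg_apply, Equiv.subRight_apply, blockTerm_neg hn]
    rw [tsum_mul_left]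
    have hs : ((-1 : ℂ)) ^ n * (-1) ^ (n - 3) = -1 := by
      rw [← pow_add]
      exact Odd.neg_one_pow ⟨n - 2, by omega⟩
    push_cast
    linear_combination ((signProd ε : ℂ) * ∑' j, blockTerm p ε τ j) * hs
  linear_combination h / 2

/-- In the window where `sgnEps` is 0, that is -(n-3) ≤ j ≤ -1, the polynomial vanishes. There the
value may be read as -1. -/
theorem sgnEps_mul_blockTerm (hn : 3 ≤ n) (hp : ∀ j, 2 ≤ p j) (ε : Fin n → ℤˣ) (τ : ℂ) (j : ℤ) :
    (sgnEps p ε ((2 * bigP p : ℕ) * j + numer p ε) : ℂ) * blockTerm p ε τ j =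
      (if 0 ≤ j then 1 else -1) * blockTerm p ε τ j := by
  have hP : (0 : ℤ) < 2 * (bigP p : ℤ) := by exact_mod_cast two_mul_bigP_pos hp
  have h1 : 2 * (bigP p : ℤ) * m0 p ε + ell p ε ≤ (2 * bigP p : ℕ) * j + numer p ε ↔ 0 ≤ j := by
    rw [numer_eq_add]
    push_cast
    constructor <;> intro h <;> nlinarith
  have h2 : (2 * bigP p : ℕ) * j + numer p ε ≤ 2 * (bigP p : ℤ) * (m0 p ε - n + 2) + ell p ε ↔
      j ≤ -n + 2 := by
    rw [numer_eq_add]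
    push_cast
    constructor <;> intro h <;> nlinarith
  rw [sgnEps]
  simp only [h1, h2]
  split_ifs with h3 h4
  · simp
  · simp
  · have hz := prod_shift_eq_zero (d := n - 3) (j := j) (by omega) (by omega)
    rw [blockTerm, hz]
    simp

theorem norm_sgnEps_le (ε : Fin n → ℤˣ) (m : ℤ) : ‖(sgnEps p ε m : ℂ)‖ ≤ 1 := by
  rw [sgnEps]
  split_ifs <;> simp

/-- The indicator of j ≥ 0 is half the sum of 1 and a sign; the constant half contributes nothing
after summation over ε. -/
theorem Psi_eq_sgnEps (hn : 3 ≤ n) (hp : ∀ j, 2 ≤ p j) {τ : ℂ} (hτ : 0 < τ.im) :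
    Psi p τ = 1 / 2 * ∑ ε : Fin n → ℤˣ, (signProd ε : ℂ) * ∑ k ∈ Finset.range (n - 2),
      (cCoeff p ε k : ℂ) * ∑' j : ℤ, twistTerm (2 * bigP p) (fun m => (sgnEps p ε m : ℂ)) k τ
        ((2 * bigP p : ℕ) * j + ell p ε) := by
  have key : ∀ ε : Fin n → ℤˣ, ∑' m, psiTerm p ε τ m =
      1 / 2 * (∑' j, (sgnEps p ε ((2 * bigP p : ℕ) * j + numer p ε) : ℂ) * blockTerm p ε τ j) +
        1 / 2 * ∑' j, blockTerm p ε τ j := by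
    intro ε
    have hs := summable_blockTerm hn hp ε hτ
    have hs' := summable_mul_blockTerm hn hp ε (norm_sgnEps_le (p := p) ε) hτ
    rw [← mul_add, ← hs'.tsum_add hs, ← tsum_mul_left]
    have hinj : Function.Injective ((↑) : ℕ → ℤ) := Nat.cast_injective
    rw [← hinj.tsum_eq]
    · refine tsum_congr fun m => ?_
      rw [psiTerm_eq_blockTerm hn hp, sgnEps_mul_blockTerm hn hp, if_pos (Int.natCast_nonneg m)]
      ring
    · intro j hj
      by_contra hcon
      apply hj
      have : ¬ 0 ≤ j := fun h => hcon ⟨j.toNat, Int.toNat_of_nonneg h⟩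
      simp only [sgnEps_mul_blockTerm hn hp, if_neg this]
      ring
  simp only [Psi, key, mul_add, Finset.sum_add_distrib]
  have h0 := sum_signProd_mul_tsum_blockTerm hn p τ
  have h1 : ∑ ε : Fin n → ℤˣ, (signProd ε : ℂ) * (1 / 2 * ∑' j, blockTerm p ε τ j) = 0 := by
    rw [← mul_zero (1 / 2 : ℂ), ← h0, Finset.mul_sum]
    exact Finset.sum_congr rfl fun ε _ => by ring
  rw [h1, add_zero, Finset.mul_sum]
  refine Finset.sum_congr rfl fun ε _ => ?_
  rw [tsum_mul_blockTerm hn hp ε (b := fun m => (sgnEps p ε m : ℂ)) (norm_sgnEps_le ε) hτ]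
  ring

theorem polyTerm_eq (hp : ∀ j, 2 ≤ p j) (ε : Fin n → ℤˣ) (k : ℕ) (τ : ℂ) (j : ℤ) :
    polyTerm p ε k τ j =
      twistTerm (2 * bigP p) (fun m => (sgnEps p ε m : ℂ)) k τ ((2 * bigP p : ℕ) * j + ell p ε) -
      twistTerm (2 * bigP p) (fun m => (m.sign : ℂ)) k τ ((2 * bigP p : ℕ) * j + ell p ε) := by
  simp only [polyTerm, qpow_sq_div_four_mul hp, twistTerm]
  push_cast
  ring

/-- Since 0 < ℓ < 2P, the sign of 2Pj + ℓ is decided by whether j ≥ 0, so the two sign functions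
agree once |j| is large. -/
theorem finite_support_polyTerm (hn : 3 ≤ n) (hp : ∀ j, 2 ≤ p j)
    (hcop : Pairwise fun i j => Nat.Coprime (p i) (p j)) (ε : Fin n → ℤˣ) (k : ℕ) (τ : ℂ) :
    (polyTerm p ε k τ).support.Finite := by
  have hP : (0 : ℤ) < 2 * (bigP p : ℤ) := by exact_mod_cast two_mul_bigP_pos hp
  obtain ⟨hl1, hl2⟩ := ell_mem p (by omega) hp hcop ε
  refine (Set.finite_Icc (-|m0 p ε| - n) |m0 p ε|).subset fun j hj => ?_
  by_contra hcon
  apply hj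
  have hm1 := le_abs_self (m0 p ε)
  have hm2 := neg_abs_le (m0 p ε)
  have hm3 := abs_nonneg (m0 p ε)
  suffices h : sgnEps p ε (2 * (bigP p : ℤ) * j + ell p ε) =
      (2 * (bigP p : ℤ) * j + ell p ε).sign by
    simp only [polyTerm, h, sub_self, Int.cast_zero, zero_mul]
  rw [Set.mem_Icc, not_and_or, not_le, not_le] at hcon
  rcases hcon with h | h
  · rw [Int.sign_eq_neg_one_of_neg (by nlinarith), sgnEps, if_neg (by nlinarith),
      if_pos (by nlinarith)]
  · rw [Int.sign_eq_one_of_pos (by nlinarith), sgnEps, if_pos (by nlinarith)]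

theorem norm_sign_le (m : ℤ) : ‖(m.sign : ℂ)‖ ≤ 1 := by
  simpa [signTwist] using norm_signTwist_le (b := fun _ => 1) (B := 1) (by simp) m

theorem PsiHat_eq (hn : 3 ≤ n) (hp : ∀ j, 2 ≤ p j) {τ : ℂ} (hτ : 0 < τ.im) :
    PsiHat p τ = 1 / 2 * ∑ ε : Fin n → ℤˣ, (signProd ε : ℂ) * ∑ k ∈ Finset.range (n - 2),
      (cCoeff p ε k : ℂ) *
        twistTheta (2 * bigP p) (signTwist (residueInd (2 * bigP p) (ell p ε))) k τ := by
  have hN := two_mul_bigP_pos hp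
  rw [PsiHat, polyP, Psi_eq_sgnEps hn hp hτ, ← mul_sub, ← Finset.sum_sub_distrib]
  refine congrArg _ (Finset.sum_congr rfl fun ε _ => ?_)
  rw [← mul_sub, ← Finset.sum_sub_distrib]
  refine congrArg _ (Finset.sum_congr rfl fun k _ => ?_)
  rw [← mul_sub]
  congr 1
  simp_rw [polyTerm_eq hp]
  rw [(summable_twistTerm_progression hN (norm_sgnEps_le ε) k _ hτ).tsum_sub
    (summable_twistTerm_progression hN norm_sign_le k _ hτ), sub_sub_cancel, twistTheta,
    ← tsum_residueInd_mul hN (ell p ε) fun m => twistTerm (2 * bigP p) (fun m => (m.sign : ℂ)) k τ m]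
  refine tsum_congr fun m => ?_
  simp only [twistTerm, signTwist]
  ring

end

/-! ### Theta functions of shifted lattices -/

theorem norm_qpow (a : ℝ) (τ : ℂ) : ‖qpow a τ‖ = Real.exp (-(2 * Real.pi * a * τ.im)) := by
  rw [qpow, Complex.norm_exp, show 2 * (Real.pi : ℂ) * I * a * τ =
    ((2 * Real.pi * a : ℝ) : ℂ) * (I * τ) by push_cast; ring, re_ofReal_mul]
  simp

/-- The binomial expansion of (√M|j| + |μ|)^k reduces the claim to the known bounds for Jacobi theta
terms, with the linear part of the exponent absorbing the shift μ. -/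
theorem summable_thetaTerm {M : ℕ} (hM : 0 < M) (k : ℕ) (μ : ℝ) {τ : ℂ} (hτ : 0 < τ.im) :
    Summable (thetaTerm M k μ τ) := by
  have hM' : (0 : ℝ) < M := Nat.cast_pos.mpr hM
  set s := Real.sqrt M with hs
  have hs0 : 0 ≤ s := Real.sqrt_nonneg _
  have hss : s ^ 2 = M := Real.sq_sqrt hM'.le
  have hsum : Summable fun j : ℤ => ∑ i ∈ Finset.range (k + 1),
      (s ^ i * |μ| ^ (k - i) * (k.choose i : ℝ)) * (((|j| : ℤ) : ℝ) ^ i *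
        Real.exp (-Real.pi * (τ.im * M * (j : ℝ) ^ 2 - 2 * (τ.im * s * |μ|) * ((|j| : ℤ) : ℝ)))) :=
    summable_sum fun i _ =>
      (summable_pow_mul_jacobiTheta₂_term_bound _ (mul_pos hτ hM') i).mul_left _
  refine .of_norm_bounded hsum fun j => ?_
  rw [thetaTerm, norm_mul, norm_qpow, Complex.norm_real, norm_pow, Real.norm_eq_abs]
  have h1 : |latticePt M μ j| ≤ s * |(j : ℝ)| + |μ| := by
    rw [latticePt]
    refine (abs_add_le _ _).trans_eq ?_
    rw [abs_mul, abs_of_nonneg hs0]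
  have h2 : M * (j : ℝ) ^ 2 - 2 * (s * |μ|) * |(j : ℝ)| ≤ latticePt M μ j ^ 2 := by
    rw [latticePt, add_sq, mul_pow, hss]
    have h3 := neg_abs_le ((j : ℝ) * μ)
    rw [abs_mul] at h3
    nlinarith [sq_nonneg μ, mul_le_mul_of_nonneg_left h3 hs0]
  calc |latticePt M μ j| ^ k * Real.exp (-(2 * Real.pi * (latticePt M μ j ^ 2 / 2) * τ.im))
      ≤ (s * |(j : ℝ)| + |μ|) ^ k * Real.exp (-Real.pi * (τ.im * M * (j : ℝ) ^ 2 -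
          2 * (τ.im * s * |μ|) * |(j : ℝ)|)) := by
        refine mul_le_mul (pow_le_pow_left₀ (abs_nonneg _) h1 k) (Real.exp_le_exp.mpr ?_)
          (Real.exp_pos _).le (by positivity)
        have := mul_le_mul_of_nonneg_left h2 (mul_pos Real.pi_pos hτ).le
        linarith
    _ = _ := by
        rw [add_pow, Finset.sum_mul]
        refine Finset.sum_congr rfl fun i _ => ?_
        rw [Int.cast_abs]
        ring

theorem summable_falseThetaTerm {M : ℕ} (hM : 0 < M) (k : ℕ) (μ : ℝ) {τ : ℂ} (hτ : 0 < τ.im) :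
    Summable (falseThetaTerm M k μ τ) := by
  refine .of_norm_bounded (summable_thetaTerm hM k μ hτ).norm fun j => ?_
  rw [falseThetaTerm, thetaTerm, norm_mul, norm_mul, ofReal_mul, norm_mul]
  refine mul_le_mul_of_nonneg_right (mul_le_of_le_one_left (norm_nonneg _) ?_) (norm_nonneg _)
  rw [Complex.norm_real, Real.norm_eq_abs]
  rcases Real.sign_apply_eq (latticePt M μ j) with h | h | h <;> simp [h]

theorem latticePt_div_sqrt {N : ℕ} (hN : 0 < N) (ℓ j : ℤ) :
    latticePt N ((ℓ : ℝ) / Real.sqrt N) j = (Real.sqrt N)⁻¹ * ((N * j + ℓ : ℤ) : ℝ) := by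
  have hs : 0 < Real.sqrt N := Real.sqrt_pos.mpr (Nat.cast_pos.mpr hN)
  have hss : Real.sqrt N * Real.sqrt N = N := Real.mul_self_sqrt (Nat.cast_nonneg N)
  rw [latticePt, eq_inv_mul_iff_mul_eq₀ hs.ne']
  push_cast
  field_simp
  rw [sq, hss]
  ring

theorem qpow_latticePt {N : ℕ} (hN : 0 < N) (ℓ j : ℤ) (τ : ℂ) :
    qpow (latticePt N ((ℓ : ℝ) / Real.sqrt N) j ^ 2 / 2) τ =
      cexp (Real.pi * I * ((N * j + ℓ : ℤ) : ℂ) ^ 2 / N * τ) := by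
  have hN' : (N : ℂ) ≠ 0 := Nat.cast_ne_zero.mpr hN.ne'
  rw [latticePt_div_sqrt hN, mul_pow, inv_pow, Real.sq_sqrt (Nat.cast_nonneg N), qpow]
  congr 1
  push_cast
  field_simp

theorem theta_eq_twistTheta {N : ℕ} (hN : 0 < N) (k : ℕ) (ℓ : ℤ) (τ : ℂ) :
    theta N k ((ℓ : ℝ) / Real.sqrt N) τ =
      ((Real.sqrt N : ℂ))⁻¹ ^ k * twistTheta N (residueInd N ℓ) k τ := by
  have h := tsum_residueInd_mul hN ℓ fun m => twistTerm N (fun _ => 1) k τ m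
  simp only [twistTerm, one_mul, ← mul_assoc] at h
  rw [twistTheta]
  simp only [twistTerm]
  rw [h, ← tsum_mul_left, theta]
  refine tsum_congr fun j => ?_
  rw [thetaTerm, qpow_latticePt hN, latticePt_div_sqrt hN, mul_pow]
  push_cast
  ring

theorem falseTheta_eq_twistTheta {N : ℕ} (hN : 0 < N) (k : ℕ) (ℓ : ℤ) (τ : ℂ) :
    falseTheta N k ((ℓ : ℝ) / Real.sqrt N) τ =
      ((Real.sqrt N : ℂ))⁻¹ ^ k * twistTheta N (signTwist (residueInd N ℓ)) k τ := by
  have hs : 0 < (Real.sqrt N)⁻¹ := inv_pos.mpr (Real.sqrt_pos.mpr (Nat.cast_pos.mpr hN))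
  have hsign : ∀ m : ℤ, Real.sign ((Real.sqrt N)⁻¹ * (m : ℝ)) = ((m.sign : ℤ) : ℝ) := fun m => by
    rcases lt_trichotomy m 0 with h | rfl | h
    · rw [Real.sign_of_neg (mul_neg_of_pos_of_neg hs (by exact_mod_cast h)),
        Int.sign_eq_neg_one_of_neg h]
      simp
    · simp
    · rw [Real.sign_of_pos (mul_pos hs (by exact_mod_cast h)), Int.sign_eq_one_of_pos h]
      simp
  have h := tsum_residueInd_mul hN ℓ fun m => twistTerm N (fun m => (m.sign : ℂ)) k τ m
  simp only [twistTerm, ← mul_assoc] at h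
  rw [twistTheta]
  simp only [twistTerm, signTwist]
  rw [h, ← tsum_mul_left, falseTheta]
  refine tsum_congr fun j => ?_
  rw [falseThetaTerm, qpow_latticePt hN, latticePt_div_sqrt hN, hsign, mul_pow]
  push_cast
  ring

/-- A character modulo N is constant on residue classes. This converts the dual series into the sum
over ν that defines `etaTilde`. -/
theorem sum_exp_mul_residueInd {N : ℕ} (hN : 0 < N) (ℓ m : ℤ) :
    ∑ ν ∈ Finset.range N, cexp (2 * Real.pi * I * (ℓ * ν / N)) * residueInd N ν m =
      residueChar N ℓ m := by
  have hN' : (N : ℤ) ≠ 0 := by exact_mod_cast hN.ne'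
  have hNC : (N : ℂ) ≠ 0 := Nat.cast_ne_zero.mpr hN.ne'
  have hr0 := Int.emod_nonneg m hN'
  have hr1 := Int.emod_lt_of_pos m (by exact_mod_cast hN : (0 : ℤ) < N)
  have hν : ((m % N).toNat : ℤ) = m % N := Int.toNat_of_nonneg hr0
  have hm := Int.mul_ediv_add_emod m N
  rw [Finset.sum_eq_single (m % N).toNat]
  · rw [hν, residueInd, if_pos (Int.dvd_self_sub_emod), mul_one, residueChar,
      Complex.exp_eq_exp_iff_exists_int]
    refine ⟨-(ℓ * (m / N)), ?_⟩
    have h1 : (((m % N).toNat : ℕ) : ℂ) = ((m % N : ℤ) : ℂ) :=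
      congrArg (Int.cast : ℤ → ℂ) hν |>.symm ▸ (Int.cast_natCast _).symm
    have h2 : (m : ℂ) = N * ((m / N : ℤ) : ℂ) + ((m % N : ℤ) : ℂ) := by
      rw [← Int.cast_natCast (R := ℂ) N, ← Int.cast_mul, ← Int.cast_add, hm]
    rw [h1, h2]
    push_cast
    field_simp
    ring
  · intro ν hν1 hν2
    rw [residueInd, if_neg, mul_zero]
    intro hdvd
    apply hν2
    have hlt : ν < N := Finset.mem_range.mp hν1
    have h3 : (ν : ℤ) % N = m % N := Int.modEq_iff_dvd.mpr hdvd
    rw [Int.emod_eq_of_lt (by omega) (by omega)] at h3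
    omega
  · intro h
    exact absurd (Finset.mem_range.mpr (by omega)) h

section

/-! ### The transformation formula of the completed series -/

variable {n : ℕ} {p : Fin n → ℕ}

/-- The periodic coefficients of the theta function `η_{k+1}`. -/
def blockCoeff (p : Fin n → ℕ) (k : ℕ) (m : ℤ) : ℂ :=
  ∑ ε : Fin n → ℤˣ, (signProd ε : ℂ) * (cCoeff p ε k : ℂ) * residueInd (2 * bigP p) (ell p ε) m

/-- The finite Fourier transform of `blockCoeff`. -/
def blockCoeffDual (p : Fin n → ℕ) (k : ℕ) (m : ℤ) : ℂ :=
  ∑ ε : Fin n → ℤˣ, (signProd ε : ℂ) * (cCoeff p ε k : ℂ) * residueChar (2 * bigP p) (ell p ε) m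

theorem isThetaPair_blockCoeff (hn : 3 ≤ n) (hp : ∀ j, 2 ≤ p j)
    (hcop : Pairwise fun i j => Nat.Coprime (p i) (p j)) (k : ℕ) :
    IsThetaPair (2 * bigP p) (blockCoeff p k) (blockCoeffDual p k) := by
  refine isThetaPair_residue (two_mul_bigP_pos hp)
    (fun ε : Fin n → ℤˣ => (signProd ε : ℂ) * (cCoeff p ε k : ℂ)) (ell p) ?_ fun ε hdvd => ?_
  · have h := congrArg (Rat.cast : ℚ → ℂ) (sum_signProd_mul_cCoeff (p := p) hn k)
    push_cast at h
    exact h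
  · obtain ⟨h1, h2⟩ := ell_mem p (by omega) hp hcop ε
    have := Int.le_of_dvd (by omega) hdvd
    push_cast at this
    omega

theorem signTwist_sum {α : Type*} (s : Finset α) (a : α → ℂ) (f : α → ℤ → ℂ) :
    signTwist (fun m => ∑ i ∈ s, a i * f i m) = fun m => ∑ i ∈ s, a i * signTwist (f i) m := by
  funext m
  simp only [signTwist, Finset.sum_mul, mul_assoc]

theorem twistTheta_signTwist_sum {N : ℕ} (hN : 0 < N) {α : Type*} (s : Finset α) (a : α → ℂ)
    (f : α → ℤ → ℂ) {B : ℝ} (hf : ∀ i m, ‖f i m‖ ≤ B) (K : ℕ) {z : ℂ} (hz : 0 < z.im) :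
    twistTheta N (signTwist fun m => ∑ i ∈ s, a i * f i m) K z =
      ∑ i ∈ s, a i * twistTheta N (signTwist (f i)) K z := by
  rw [signTwist_sum]
  exact twistTheta_sum hN s a _ (fun i m => norm_signTwist_le (hf i) m) K hz

theorem PsiHat_eq_sum_blockCoeff (hn : 3 ≤ n) (hp : ∀ j, 2 ≤ p j) {τ : ℂ} (hτ : 0 < τ.im) :
    PsiHat p τ = ∑ k ∈ Finset.range (n - 2),
      1 / 2 * twistTheta (2 * bigP p) (signTwist (blockCoeff p k)) k τ := by
  rw [PsiHat_eq hn hp hτ, ← Finset.mul_sum]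
  simp only [Finset.mul_sum]
  rw [Finset.sum_comm]
  refine Finset.sum_congr rfl fun k _ => ?_
  unfold blockCoeff
  rw [twistTheta_signTwist_sum (two_mul_bigP_pos hp) _ _ _ (fun ε => norm_residueInd_le _ _) k hτ,
    Finset.mul_sum]
  simp only [mul_assoc]

theorem etaSucc_eq (hp : ∀ j, 2 ≤ p j) (k : ℕ) {z : ℂ} (hz : 0 < z.im) :
    etaSucc p k z = -(1 / 2) * ((Real.sqrt (2 * bigP p : ℕ) : ℂ))⁻¹ ^ (k + 1) *
      twistTheta (2 * bigP p) (blockCoeff p k) (k + 1) z := by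
  have hN := two_mul_bigP_pos hp
  have hcast : (2 * (bigP p : ℝ)) = ((2 * bigP p : ℕ) : ℝ) := by push_cast; ring
  rw [etaSucc, hcast]
  unfold blockCoeff
  rw [twistTheta_sum hN _ _ _ (fun ε => norm_residueInd_le _ _) _ hz, mul_assoc (-(1 / 2) : ℂ)]
  congr 1
  rw [Finset.mul_sum]
  refine Finset.sum_congr rfl fun ε _ => ?_
  rw [theta_eq_twistTheta hN]
  ring

theorem etaTilde_eq (hp : ∀ j, 2 ≤ p j) (k r : ℕ) {τ : ℂ} (hτ : 0 < τ.im) :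
    etaTilde p k r τ = -(1 / 2) * ((Real.sqrt (2 * bigP p : ℕ) : ℂ))⁻¹ ^ (2 * r + k % 2) *
      twistTheta (2 * bigP p) (signTwist (blockCoeffDual p k)) (2 * r + k % 2) τ := by
  have hN := two_mul_bigP_pos hp
  have hcast : (2 * (bigP p : ℝ)) = ((2 * bigP p : ℕ) : ℝ) := by push_cast; ring
  have hcast' : (2 * (bigP p : ℂ)) = ((2 * bigP p : ℕ) : ℂ) := by push_cast; ring
  rw [etaTilde, hcast, hcast', Finset.sum_comm]
  unfold blockCoeffDual
  rw [twistTheta_signTwist_sum hN _ _ _ (fun ε m => (norm_residueChar _ _ m).le) _ hτ,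
    mul_assoc (-(1 / 2) : ℂ)]
  congr 1
  rw [Finset.mul_sum]
  refine Finset.sum_congr rfl fun ε _ => ?_
  have hchar : residueChar (2 * bigP p) (ell p ε) = fun m => ∑ ν ∈ Finset.range (2 * bigP p),
      cexp (2 * Real.pi * I * (ell p ε * ν / (2 * bigP p : ℕ))) *
        residueInd (2 * bigP p) (ν : ℤ) m :=
    funext fun m => (sum_exp_mul_residueInd hN _ m).symm
  rw [hchar, twistTheta_signTwist_sum hN _ _ _ (fun ν => norm_residueInd_le _ _) _ hτ,
    Finset.mul_sum, Finset.mul_sum]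
  refine Finset.sum_congr rfl fun ν _ => ?_
  have h := falseTheta_eq_twistTheta hN (2 * r + k % 2) (ν : ℤ) τ
  rw [Int.cast_natCast] at h
  rw [h]
  ring

theorem eichlerIntegrand_imAxis (hp : ∀ j, 2 ≤ p j) (k : ℕ) (τ : ℂ) {y : ℝ} (hy : 0 < y) :
    eichlerIntegrand p k τ (I * y) = -(1 / 2) * ((Real.sqrt (2 * bigP p : ℕ) : ℂ))⁻¹ ^ (k + 1) *
      kernelFun (twistTheta (2 * bigP p) (blockCoeff p k) (k + 1)) (-1 / τ) (I * y) := by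
  rw [eichlerIntegrand, kernelFun, etaSucc_eq hp k (by rwa [I_mul_ofReal_im]), neg_div τ 1,
    sub_neg_eq_add, mul_div_assoc]

theorem integrableOn_eichlerIntegrand (hn : 3 ≤ n) (hp : ∀ j, 2 ≤ p j)
    (hcop : Pairwise fun i j => Nat.Coprime (p i) (p j)) (k : ℕ) {τ : ℂ} (hτ : 0 < τ.im)
    (hre : τ.re ≠ 0) :
    IntegrableOn (fun y : ℝ => eichlerIntegrand p k τ (I * y)) (Ioi 0) := by
  have hN := two_mul_bigP_pos hp
  have h := isThetaPair_blockCoeff hn hp hcop k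
  obtain ⟨B, hB⟩ := h.bdd
  have hint := integrableOn_imAxis_kernelFun (h.coneDecay hN (k + 1))
    (fun z hz => (hasDerivAt_twistTheta hN hB (k + 1) hz).differentiableAt)
    (neg_one_div_re_ne_zero hτ hre)
  refine IntegrableOn.congr_fun
    (hint.const_mul (-(1 / 2) * ((Real.sqrt (2 * bigP p : ℕ) : ℂ))⁻¹ ^ (k + 1)))
    (fun y hy => ?_) measurableSet_Ioi
  exact (eichlerIntegrand_imAxis hp k τ hy).symm

theorem imAxisIntegral_eichlerIntegrand (hp : ∀ j, 2 ≤ p j) (k : ℕ) (τ : ℂ) :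
    imAxisIntegral (eichlerIntegrand p k τ) =
      -(1 / 2) * ((Real.sqrt (2 * bigP p : ℕ) : ℂ))⁻¹ ^ (k + 1) *
        eichlerIntegral (twistTheta (2 * bigP p) (blockCoeff p k) (k + 1)) (-1 / τ) := by
  rw [imAxisIntegral, eichlerIntegral, ← integral_const_mul]
  refine setIntegral_congr_fun measurableSet_Ioi fun y hy => ?_
  simp only [eichlerIntegrand_imAxis hp k τ hy]
  ring

theorem csqrt_neg_I_mul {τ : ℂ} (hτ : 0 < τ.im) : csqrt (-I * τ) = csqrt (-I) * csqrt τ := by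
  refine csqrt_mul (neg_ne_zero.mpr I_ne_zero) (ne_zero_of_im_pos hτ) ?_
  rw [arg_neg_I]
  have h1 := arg_nonneg_iff.mpr hτ.le
  have h2 := arg_le_pi τ
  constructor <;> linarith [Real.pi_pos]

theorem cpow_natCast_add_half {τ : ℂ} (hτ : τ ≠ 0) (a b : ℕ) :
    τ ^ ((a : ℂ) + (b : ℂ) + 1 / 2) = τ ^ (a + b) * csqrt τ := by
  rw [cpow_add _ _ hτ, ← Nat.cast_add, cpow_natCast, csqrt]

theorem rpow_half_eq {x : ℝ} (hx : 0 ≤ x) (k : ℕ) : x ^ ((k : ℝ) / 2) = Real.sqrt x ^ k := by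
  rw [Real.sqrt_eq_rpow, ← Real.rpow_natCast, ← Real.rpow_mul hx]
  congr 1
  ring

theorem rpow_sub_one_half_eq {x : ℝ} (hx : 0 < x) (k : ℕ) :
    x ^ (((k : ℝ) - 1) / 2) = Real.sqrt x ^ k * (Real.sqrt x)⁻¹ := by
  rw [sub_div, Real.rpow_sub hx, rpow_half_eq hx.le, Real.sqrt_eq_rpow, div_eq_mul_inv]

/-- Pure normalisation of `falseTheta_transform`: lattice points are m/√(2P), which redistributes
powers of √(2P), and √(-iτ) splits as √(-i)√τ because arg τ - π/2 stays in the principal range. -/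
theorem twistTheta_blockCoeff_transform (hn : 3 ≤ n) (hp : ∀ j, 2 ≤ p j)
    (hcop : Pairwise fun i j => Nat.Coprime (p i) (p j)) (k : ℕ) {τ : ℂ} (hτ : 0 < τ.im)
    (hre : τ.re ≠ 0) :
    1 / 2 * twistTheta (2 * bigP p) (signTwist (blockCoeff p k)) k (-1 / τ) =
      (Real.sign τ.re : ℂ) * ((-1) ^ (k % 2) * csqrt (-I) *
        (((2 * (bigP p : ℝ)) ^ (((k : ℝ) - 1) / 2) : ℝ) : ℂ) *
        τ ^ (((k / 2 : ℕ) : ℂ) + ((k % 2 : ℕ) : ℂ) + 1 / 2) / (2 * Real.pi * I) ^ (k / 2) *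
        ∑ r ∈ Finset.range (k / 2 + 1),
          dCoeff (k / 2) (k % 2) r * τ ^ r * etaTilde p k r τ) +
      I * ((((2 * (bigP p : ℝ)) ^ ((k : ℝ) / 2) : ℝ) : ℂ) *
        imAxisIntegral (eichlerIntegrand p k τ)) := by
  have hN := two_mul_bigP_pos hp
  have hk : 2 * (k / 2) + k % 2 = k := Nat.div_add_mod k 2
  have h := falseTheta_transform hN (isThetaPair_blockCoeff hn hp hcop k)
    (Nat.mod_two_eq_zero_or_one k) (k / 2) hτ hre
  rw [hk] at h
  have hcast : (2 * (bigP p : ℝ)) = ((2 * bigP p : ℕ) : ℝ) := by push_cast; ring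
  have hN' : (0 : ℝ) < (2 * bigP p : ℕ) := Nat.cast_pos.mpr hN
  rw [h, falseThetaCompanion, csqrt_neg_I_mul hτ, imAxisIntegral_eichlerIntegrand hp,
    cpow_natCast_add_half (ne_zero_of_im_pos hτ), hcast, rpow_half_eq hN'.le,
    rpow_sub_one_half_eq hN']
  simp only [etaTilde_eq hp k _ hτ]
  simp only [ofReal_mul, ofReal_pow, ofReal_inv]
  have hs0 : ((Real.sqrt (2 * bigP p : ℕ) : ℝ) : ℂ) ≠ 0 :=
    ofReal_ne_zero.mpr (Real.sqrt_pos.mpr hN').ne'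
  have hss : ((Real.sqrt (2 * bigP p : ℕ) : ℝ) : ℂ) ^ 2 = ((2 * bigP p : ℕ) : ℂ) := by
    rw [← ofReal_pow, Real.sq_sqrt hN'.le, ofReal_natCast]
  rw [← hss]
  generalize ((Real.sqrt (2 * bigP p : ℕ) : ℝ) : ℂ) = s at hs0
  have e1 : s ^ k * s⁻¹ ^ (k + 1) = s⁻¹ := by
    rw [pow_succ, ← mul_assoc, ← mul_pow, mul_inv_cancel₀ hs0, one_pow, one_mul]
  have e2 : ∑ r ∈ Finset.range (k / 2 + 1), dCoeff (k / 2) (k % 2) r * (s ^ 2) ^ (k / 2 - r) *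
      τ ^ r * twistTheta (2 * bigP p) (signTwist (blockCoeffDual p k)) (2 * r + k % 2) τ =
      -2 * s ^ k * ∑ r ∈ Finset.range (k / 2 + 1), dCoeff (k / 2) (k % 2) r * τ ^ r *
        (-(1 / 2) * s⁻¹ ^ (2 * r + k % 2) *
          twistTheta (2 * bigP p) (signTwist (blockCoeffDual p k)) (2 * r + k % 2) τ) := by
    rw [Finset.mul_sum]
    refine Finset.sum_congr rfl fun r hr => ?_
    have hr' : r ≤ k / 2 := Nat.lt_succ_iff.mp (Finset.mem_range.mp hr)
    -- With k = 2κ + ι the exponents differ by 2(κ - r), matching the power N^{κ-r} in the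
    -- companion.
    have e3 : s ^ k * s⁻¹ ^ (2 * r + k % 2) = (s ^ 2) ^ (k / 2 - r) := by
      rw [← pow_mul, show s ^ k = s ^ (2 * (k / 2 - r)) * s ^ (2 * r + k % 2) by
        rw [← pow_add]; congr 1; omega, mul_assoc, ← mul_pow, mul_inv_cancel₀ hs0, one_pow,
        mul_one]
    rw [← e3]
    ring
  rw [e2]
  linear_combination (-(I / 2) *
    eichlerIntegral (twistTheta (2 * bigP p) (blockCoeff p k) (k + 1)) (-1 / τ)) * (-e1)

theorem Phi_eq_mul_Psi (hp : ∀ j, 2 ≤ p j) (q : Fin n → ℤ) (τ : ℂ) :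
    Phi p q τ = (-1) ^ n / (2 * (qpow (1 / 2) τ - qpow (-(1 / 2)) τ)) *
      qpow (-(1 / 4) * Theta0 p q) τ * Psi p τ := by
  have hP : (bigP p : ℝ) ≠ 0 := Nat.cast_ne_zero.mpr (bigP_pos hp).ne'
  rw [Phi, Psi]
  refine congrArg _ (Finset.sum_congr rfl fun ε _ => congrArg _ (tsum_congr fun m => ?_))
  rw [psiTerm]
  congr 2
  rw [shift]
  push_cast
  field_simp
  ring

end

end SeifertBlock

end

/-! ### Convergence and the transformation formula of the homological block -/

theorem mainTheorem1 (n : ℕ) (hn : 3 ≤ n) (p : Fin n → ℕ) (q : Fin n → ℤ)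
    (hp : ∀ j, 2 ≤ p j) (hcop : Pairwise fun i j => Nat.Coprime (p i) (p j))
    (hq : ∀ j, q j ≠ 0)
    (hpq : (SeifertBlock.bigP p : ℚ) * ∑ j, (q j : ℚ) / (p j : ℚ) = 1) :
    -- all series converge absolutely on the upper half-plane, `𝒫(q)` is a finite sum,
    -- and `Ψ(q)` is the homological block without its prefactor
    (∀ τ : ℂ, 0 < τ.im →
      (∀ ε : Fin n → ℤˣ, Summable (SeifertBlock.psiTerm p ε τ)) ∧
      (∀ (ε : Fin n → ℤˣ) (k : ℕ), (SeifertBlock.polyTerm p ε k τ).support.Finite) ∧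
      (∀ (k : ℕ) (μ : ℝ),
        Summable (SeifertBlock.thetaTerm (2 * SeifertBlock.bigP p) k μ τ) ∧
        Summable (SeifertBlock.falseThetaTerm (2 * SeifertBlock.bigP p) k μ τ)) ∧
      SeifertBlock.Phi p q τ =
        (-1) ^ n / (2 * (SeifertBlock.qpow (1 / 2) τ - SeifertBlock.qpow (-(1 / 2)) τ)) *
          SeifertBlock.qpow (-(1 / 4) * SeifertBlock.Theta0 p q) τ * SeifertBlock.Psi p τ) ∧
    -- the transformation formula, with `κ = k / 2` and `ι = k % 2`
    (∀ τ : ℂ, 0 < τ.im → τ.re ≠ 0 →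
      (∀ k ∈ Finset.range (n - 2), MeasureTheory.IntegrableOn
        (fun y : ℝ => SeifertBlock.eichlerIntegrand p k τ (Complex.I * y)) (Set.Ioi 0)) ∧
      SeifertBlock.PsiHat p (-1 / τ) =
        (Real.sign τ.re : ℂ) *
          ∑ k ∈ Finset.range (n - 2),
            (-1) ^ (k % 2) * SeifertBlock.csqrt (-Complex.I) *
              (((2 * (SeifertBlock.bigP p : ℝ)) ^ (((k : ℝ) - 1) / 2) : ℝ) : ℂ) *
              τ ^ (((k / 2 : ℕ) : ℂ) + ((k % 2 : ℕ) : ℂ) + 1 / 2) /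
              (2 * Real.pi * Complex.I) ^ (k / 2) *
              ∑ r ∈ Finset.range (k / 2 + 1),
                SeifertBlock.dCoeff (k / 2) (k % 2) r * τ ^ r * SeifertBlock.etaTilde p k r τ +
        Complex.I *
          ∑ k ∈ Finset.range (n - 2),
            (((2 * (SeifertBlock.bigP p : ℝ)) ^ ((k : ℝ) / 2) : ℝ) : ℂ) *
              SeifertBlock.imAxisIntegral (SeifertBlock.eichlerIntegrand p k τ)) := by
  have hN := SeifertBlock.two_mul_bigP_pos hp
  refine ⟨fun τ hτ => ⟨fun ε => SeifertBlock.summable_psiTerm hn hp ε hτ,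
    fun ε k => SeifertBlock.finite_support_polyTerm hn hp hcop ε k τ,
    fun k μ => ⟨SeifertBlock.summable_thetaTerm hN k μ hτ,
      SeifertBlock.summable_falseThetaTerm hN k μ hτ⟩, SeifertBlock.Phi_eq_mul_Psi hp q τ⟩,
    fun τ hτ hre => ⟨fun k _ => SeifertBlock.integrableOn_eichlerIntegrand hn hp hcop k hτ hre, ?_⟩⟩
  rw [SeifertBlock.PsiHat_eq_sum_blockCoeff hn hp (SeifertBlock.neg_one_div_im_pos hτ),
    Finset.mul_sum, Finset.mul_sum, ← Finset.sum_add_distrib]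
  exact Finset.sum_congr rfl fun k _ =>
    SeifertBlock.twistTheta_blockCoeff_transform hn hp hcop k hτ hre
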